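/- **Setting.** Let $\mathbb F_q$ be a finite field with $q$ elements, $\theta$ a variable, $\mathbb C_\infty$ the completion of an algebraic closure of $\mathbb F_q((1/\theta))$, and $\mathbb K$ a perfect field with $\mathbb F_q(\theta)\subset\mathbb K\subset\mathbb C_\infty$. Put $\mathbf A=\mathbb F_q[t]$. For $k\in\mathbb Z$ and a power series $f=\sum a_it^i$ over $\mathbb C_\infty$ let $f^{(k)}=\sum a_i^{q^k}t^i$, and apply this to matrices entrywise. Let $\mathbb T\subset\mathbb C_\infty[[t]]$ be the Tate algebra of power series with $a_i\to0$, $\|f\|=\sup_i|a_i|$ the Gauss norm (for a matrix: the maximum over its entries), and $\mathrm{Cof}(M)$ the cofactor matrix of a square matrix $M$. Let $\mathbb K[\tau]$, $\mathbb K[\sigma]$ be the twisted polynomial rings with $\tau b=b^q\tau$, $\sigma b=b^{1/q}\sigma$, and for $b=\sum b_i\tau^i$ let $b^*=\sum b_i^{(-i)}\sigma^i$, with $(B^*)_{ij}=(B_{ji})^*$ for a matrix $B$. A $t$-module of dimension $d$ over $\mathbb K$ is an $\mathbb F_q$-algebra homomorphism $\varphi:\mathbf A\to\mathrm{Mat}_d(\mathbb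 K[\tau])$, $a\mapsto\varphi_a$, such that the constant term $d\varphi_t$ of $\varphi_t$ is $\theta$ times the identity plus a nilpotent matrix. Its exponential $\mathrm{Exp}_\varphi(\mathbf z)=\sum_{k\ge0}B_k\mathbf z^{(k)}$ is given by the unique $B_k\in\mathrm{Mat}_d(\mathbb K)$ with $B_0=1$ and $\varphi_t\circ\mathrm{Exp}_\varphi=\mathrm{Exp}_\varphi\circ d\varphi_t$; it is *uniformizable* if $\mathrm{Exp}_\varphi:\mathbb C_\infty^d\to\mathbb C_\infty^d$ is surjective. The kernel of $\mathrm{Exp}_\varphi$ is the period lattice, an $\mathbf A$-module through $t\mapsto d\varphi_t$. For $\mathbf y\in\mathbb C_\infty^d$ the Anderson generating function is $\mathcal G_{\mathbf y}(t;\varphi)=\sum_{i\ge0}\mathrm{Exp}_\varphi\big((d\varphi_t)^{-i-1}\mathbf y\big)t^i$. The $t$-motive is $\mathrm{Mat}_{1\times d}(\mathbb K[\tau])$ with $t\cdot m=m\varphi_t$, and the dual $t$-motive is $\mathrm{Mat}_{1\times d}(\mathbb K[\sigma])$ with $t\cdot n=n\varphi_t^*$; the $t$-module is *abelian* if its $t$-motive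 is free of finite rank over $\mathbb K[t]$. For a row $m=(m_1,\dots,m_d)$ over $\mathbb K[\tau]$ with $m_k=\sum_i m_{k,i}\tau^i$ and a column $f$ of power series put $\langle m\mid f\rangle=\sum_{k,i}m_{k,i}f_k^{(i)}$. For $n\ge1$, $\mathbf C^{\otimes n}$, the $n$-th tensor power of the Carlitz module, is the $t$-module of dimension $n$ for which $[t]_n$ has $\theta$ on the diagonal, $1$ just above the diagonal, and $\tau$ added to the lower left entry. **Data.** Let $G=(\mathbb G_a^d,\varphi)$ be a uniformizable abelian $t$-module over $\mathbb K$, and let $n\ge\max(d,1)$. Let $\mathbf m=(\mathbf m_1,\dots,\mathbf m_r)^{\rm tr}$ and $\mathbf n$ be $\mathbb K[t]$-bases of its $t$-motive and its dual $t$-motive, with $\tau\mathbf m=\widetilde\Phi_G\mathbf m$ and $\sigma\mathbf n=\Phi_G\mathbf n$. Let $V_G\in\mathrm{GL}_r(\mathbb K[t])$ satisfy $V_G^{(-1)}\Phi_G=\widetilde\Phi_G^{\rm tr}V_G$, and let $\Psi_G\in\mathrm{GL}_r(\mathbb T)$ satisfy $\Psi_G^{(-1)}=\Phi_G\Psi_G$.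 Let $\boldsymbol\omega_1,\dots,\boldsymbol\omega_r$ be an $\mathbf A$-basis of the period lattice of $G$, and $\Upsilon_G=\big(\langle\tau\mathbf m_i\mid\mathcal G_{\boldsymbol\omega_j}(t;\varphi)\rangle\big)_{i,j}$. Let $\widetilde\pi$ generate the period lattice of $\mathbf C^{\otimes1}$, let $\omega(t)=\mathcal G_{\widetilde\pi}(t;[\cdot]_1)$ and $\Omega=1/\omega^{(1)}$. Assume $\det\Phi_G=c(t-\theta)^d$ with $c\in\mathbb K^\times$, and let $\mathfrak u_c$ be a $(q-1)$-th root of $c^{-q}$. Let $\delta:\mathbf A\to\mathrm{Mat}_{n\times d}(\mathbb K[\tau])$ be a biderivation, that is, $\mathbb F_q$-linear with $\delta(ab)=[a]_n\delta(b)+\delta(a)\varphi_b$, and let $G_\delta$ be the $t$-module of dimension $d+n$ with $\phi_t=\begin{pmatrix}\varphi_t&0\\ \delta(t)&[t]_n\end{pmatrix}$. Let $\widetilde\Phi_\delta\in\mathrm{Mat}_{1\times r}(\mathbb K[t])$ be the row for which the basis of the $t$-motive of $G_\delta$ formed by $(\mathbf m_1,0),\dots,(\mathbf m_r,0),(0,(1,0,\dots,0))$,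 written as a column, satisfies $\tau(\cdot)=\begin{pmatrix}\widetilde\Phi_G&0\\ \widetilde\Phi_\delta&(t-\theta)^n\end{pmatrix}(\cdot)$. Assume that $\delta$ is *special*: $\widetilde\Phi_\delta\in\mathrm{Mat}_{1\times r}(\mathbb K[t])\,\widetilde\Phi_G$. Let $\boldsymbol\lambda_1,\dots,\boldsymbol\lambda_r\in\mathbb C_\infty^n$ be such that $(\boldsymbol\omega_j,\boldsymbol\lambda_j)^{\rm tr}$ is a period of $G_\delta$ for each $j$, and let $g_{j,1}=g_{j,1}(t;\phi)$ be the $(d+1)$-st coordinate of its Anderson generating function. For $\mathbf f\in\mathrm{Mat}_{1\times r}(\mathbb T)$ put $\mathscr L(\mathbf f)=\{\mathbf u\in\mathrm{Mat}_{1\times r}(\mathbb T):\mathbf u^{(-1)}-\mathbf u=\mathbf f\}$. Finally put $$\mathbf h=-\mathfrak u_c^{-1}\,\widetilde\Phi_\delta\,\widetilde\Phi_G^{-1}(V_G^{-1})^{\rm tr},\qquad \mathbf f=\mathbf h\,\Omega^{n-d}\,\mathrm{Cof}(\Psi_G).$$ **Theorem.** 1. $\mathfrak u_c\mathbf h\in\mathrm{Mat}_{1\times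 r}(\mathbb K[t])$. 2. For every $\mathbf u\in\mathscr L(\mathbf f)$, the row $\mathbf g=\mathbf u\,\Omega^{d-n}\,\mathrm{Cof}(\Psi_G)^{-1}$ has entries in $\mathbb T$ and satisfies $$\mathbf g^{(-1)}(t-\theta)^{n-d}\,\mathrm{Cof}(\Phi_G)=\mathbf g+\mathbf h,$$ and there are $a_1,\dots,a_r\in\mathbf A$ such that, with $C=\begin{pmatrix}\mathbb I_r&0\\ (a_1,\dots,a_r)&1\end{pmatrix}$, $$\big(\Omega^ng_{1,1}^{(1)},\dots,\Omega^ng_{r,1}^{(1)},1\big)=\big(\mathfrak u_c\,\mathbf g\,\Omega^n\,V_G^{\rm tr}\,\Upsilon_G,\;1\big)\,C.$$ 3. If $\|\mathbf f\|<1$, then the series $\mathbf S=\sum_{m\ge1}\mathbf f^{(m)}$ converges in $\mathrm{Mat}_{1\times r}(\mathbb T)$ for the Gauss norm, and $\mathbf S\in\mathscr L(\mathbf f)$. If moreover $\Psi_G=(\Upsilon_G^{\rm tr}V_G)^{-1}$, then there is $\kappa\in\mathbb F_q^\times$ with $\det\Psi_G=\kappa\,\mathfrak u_c\,\Omega^d$,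 and there is one matrix $C$ as in 2 for which both the formula of 2 with $\mathbf u=\mathbf S$ and $$\big(\Omega^ng_{1,1}^{(1)},\dots,\Omega^ng_{r,1}^{(1)},1\big)=\Big(\kappa^{-1}\sum_{m\ge1}\big(\mathbf h\,\Omega^{n-d}\,\mathrm{Cof}(\Psi_G)\big)^{(m)},\;1\Big)\,C$$ hold. (In particular $\kappa=1$ if the root $\mathfrak u_c$ is chosen so that $\det\Psi_G=\mathfrak u_c\Omega^d$.) -/

import Mathlib

open scoped NNReal Polynomial PowerSeries Matrix
noncomputable section
namespace AndersonT
universe u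
set_option linter.unusedSectionVars false
set_option linter.style.haveILetI false
variable (Fq : Type u) [Field Fq] [Fintype Fq]

/-- `K_∞ = F_q((1/θ))`: Laurent series over `F_q` whose uniformizer is `1/θ`. -/
def KInfty : Type u := LaurentSeries Fq

namespace KInfty

instance : Field (KInfty Fq) := inferInstanceAs (Field (LaurentSeries Fq))
instance : Algebra Fq (KInfty Fq) := inferInstanceAs (Algebra Fq (LaurentSeries Fq))
instance : Valued (KInfty Fq) (WithZero (Multiplicative ℤ)) :=
  inferInstanceAs (Valued (LaurentSeries Fq) (WithZero (Multiplicative ℤ)))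
instance : CompleteSpace (KInfty Fq) := inferInstanceAs (CompleteSpace (LaurentSeries Fq))

theorem one_lt_card : (1 : ℝ≥0) < (Fintype.card Fq : ℝ≥0) := by
  exact_mod_cast Fintype.one_lt_card

/-- The element `θ`, the inverse of the uniformizer. -/
def theta : KInfty Fq := (HahnSeries.single (-1 : ℤ) (1 : Fq) : LaurentSeries Fq)

theorem v_theta : (Valued.v (theta Fq) : WithZero (Multiplicative ℤ)) = WithZero.exp 1 :=
  (LaurentSeries.valuation_single_zpow Fq (-1)).trans (by simp)

open MonoidWithZeroHom.ValueGroup₀ in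
instance : (Valued.v : Valuation (KInfty Fq) (WithZero (Multiplicative ℤ))).RankOne where
  hom' := (WithZeroMulInt.toNNReal (one_lt_card Fq).ne_zero).comp embedding
  strictMono' := (WithZeroMulInt.toNNReal_strictMono (one_lt_card Fq)).comp embedding_strictMono
  exists_val_nontrivial := ⟨theta Fq, by rw [v_theta]; simp⟩

/-- The absolute value of `K_∞`, normalized by `|θ| = q` (see `norm_theta`). -/
instance : NontriviallyNormedField (KInfty Fq) :=
  Valued.toNontriviallyNormedField (KInfty Fq) (WithZero (Multiplicative ℤ))

theorem norm_def (x : KInfty Fq) :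
    ‖x‖ = WithZeroMulInt.toNNReal (one_lt_card Fq).ne_zero (Valued.v x) := by
  change ((WithZeroMulInt.toNNReal (one_lt_card Fq).ne_zero
    (MonoidWithZeroHom.ValueGroup₀.embedding (Valued.v.restrict x)) : ℝ≥0) : ℝ) = _
  congr 2
  exact MonoidWithZeroHom.ValueGroup₀.embedding_restrict₀ _

instance : IsUltrametricDist (KInfty Fq) :=
  IsUltrametricDist.isUltrametricDist_of_forall_norm_add_le_max_norm
    (fun x y => Valued.v.norm_add_le x y)

theorem norm_theta : ‖theta Fq‖ = Fintype.card Fq := by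
  rw [norm_def, v_theta]
  rw [WithZeroMulInt.toNNReal_neg_apply _ WithZero.exp_ne_zero]
  have h : WithZero.unzero (WithZero.exp_ne_zero (a := (1 : ℤ))) = Multiplicative.ofAdd 1 := rfl
  rw [h]
  simp
end KInfty

/-- An algebraic closure of `K_∞`, with the unique extension of the absolute value. -/
def AlgClKInfty : Type u := AlgebraicClosure (KInfty Fq)

namespace AlgClKInfty
instance : Field (AlgClKInfty Fq) := inferInstanceAs (Field (AlgebraicClosure (KInfty Fq)))
instance : IsAlgClosed (AlgClKInfty Fq) :=
  inferInstanceAs (IsAlgClosed (AlgebraicClosure (KInfty Fq)))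
instance : Algebra (KInfty Fq) (AlgClKInfty Fq) :=
  inferInstanceAs (Algebra (KInfty Fq) (AlgebraicClosure (KInfty Fq)))
instance : Algebra.IsAlgebraic (KInfty Fq) (AlgClKInfty Fq) :=
  inferInstanceAs (Algebra.IsAlgebraic (KInfty Fq) (AlgebraicClosure (KInfty Fq)))
instance : NormedField (AlgClKInfty Fq) := spectralNorm.normedField (KInfty Fq) (AlgClKInfty Fq)
instance : NormedAlgebra (KInfty Fq) (AlgClKInfty Fq) :=
  spectralNorm.normedAlgebra (KInfty Fq) (AlgClKInfty Fq)
instance : IsUltrametricDist (AlgClKInfty Fq) := IsUltrametricDist.of_normedAlgebra (KInfty Fq)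
end AlgClKInfty

/-- `C_∞`, the completion of an algebraic closure of `K_∞`. -/
def CInfty : Type u := UniformSpace.Completion (AlgClKInfty Fq)

namespace CInfty
instance : NormedField (CInfty Fq) :=
  inferInstanceAs (NormedField (UniformSpace.Completion (AlgClKInfty Fq)))
instance : CompleteSpace (CInfty Fq) :=
  inferInstanceAs (CompleteSpace (UniformSpace.Completion (AlgClKInfty Fq)))

def ofAlgCl : AlgClKInfty Fq →+* CInfty Fq := UniformSpace.Completion.coeRingHom

theorem denseRange_ofAlgCl : DenseRange (ofAlgCl Fq) := UniformSpace.Completion.denseRange_coe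
theorem norm_ofAlgCl (x : AlgClKInfty Fq) : ‖ofAlgCl Fq x‖ = ‖x‖ := 
  UniformSpace.Completion.norm_coe x

instance : NormedAlgebra (KInfty Fq) (CInfty Fq) where
  __ := ((ofAlgCl Fq).comp (algebraMap (KInfty Fq) (AlgClKInfty Fq))).toAlgebra
  norm_smul_le a b := by
    change ‖ofAlgCl Fq (algebraMap _ _ a) * b‖ ≤ _
    rw [norm_mul, norm_ofAlgCl, norm_algebraMap']

instance : IsUltrametricDist (CInfty Fq) := IsUltrametricDist.of_normedAlgebra (KInfty Fq)

instance : Algebra Fq (CInfty Fq) :=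
  ((algebraMap (KInfty Fq) (CInfty Fq)).comp (algebraMap Fq (KInfty Fq))).toAlgebra

/-- The element `θ` of `C_∞`. -/
def theta : CInfty Fq := algebraMap (KInfty Fq) (CInfty Fq) (KInfty.theta Fq)

theorem norm_theta : ‖theta Fq‖ = Fintype.card Fq := by
  rw [theta, norm_algebraMap', KInfty.norm_theta]

/-- `C_∞` is perfect, so that negative Frobenius twists make sense. -/
instance : PerfectField (CInfty Fq) := by
  obtain ⟨p, hp⟩ := CharP.exists Fq
  have := hp
  have : Fact p.Prime := ⟨(CharP.char_is_prime_or_zero Fq p).resolve_right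
    (CharP.char_ne_zero_of_finite Fq p)⟩
  have : CharP (CInfty Fq) p := charP_of_injective_algebraMap (algebraMap Fq (CInfty Fq)).injective p
  have : CharP (AlgClKInfty Fq) p := (RingHom.charP_iff (ofAlgCl Fq) (ofAlgCl Fq).injective p).2 inferInstance
  have hdist : ∀ x y : CInfty Fq,
      dist (frobenius (CInfty Fq) p x) (frobenius (CInfty Fq) p y) = dist x y ^ p := by
    intro x y
    rw [dist_eq_norm, dist_eq_norm, ← map_sub, frobenius_def, norm_pow]
  have hp0 : p ≠ 0 := (Fact.out : p.Prime).ne_zero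
  have hind : IsUniformInducing (frobenius (CInfty Fq) p) := by
    rw [Metric.isUniformInducing_iff]
    refine ⟨?_, fun δ hδ => ⟨δ ^ p, by positivity, fun {a b} h => ?_⟩⟩
    · rw [Metric.uniformContinuous_iff]
      intro ε hε
      refine ⟨min ε 1, by positivity, fun {a b} h => ?_⟩
      rw [hdist]
      calc dist a b ^ p ≤ dist a b :=
            pow_le_of_le_one dist_nonneg (h.le.trans (min_le_right _ _)) hp0
        _ < ε := h.trans_le (min_le_left _ _)
    · rw [hdist] at h
      exact lt_of_pow_lt_pow_left₀ p hδ.le h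
  have hcl : IsClosed (Set.range (frobenius (CInfty Fq) p)) :=
    hind.isComplete_range.isClosed
  have hsub : Set.range (ofAlgCl Fq) ⊆ Set.range (frobenius (CInfty Fq) p) := by
    rintro _ ⟨x, rfl⟩
    obtain ⟨y, rfl⟩ := surjective_frobenius (AlgClKInfty Fq) p x
    exact ⟨ofAlgCl Fq y, by simp [frobenius_def]⟩
  have hsurj : Function.Surjective (frobenius (CInfty Fq) p) := by
    intro x
    have := hcl.closure_subset_iff.2 hsub
    exact this (denseRange_ofAlgCl Fq x)
  have : PerfectRing (CInfty Fq) p := PerfectRing.ofSurjective _ _ hsurj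
  exact PerfectRing.toPerfectField _ p
end CInfty



section Frobenius
variable (F : Type*) [Field F] [Algebra Fq F] [PerfectField F]

theorem frob_bijective : Function.Bijective (FiniteField.frobeniusAlgHom Fq F) := by
  obtain ⟨p, hp⟩ := CharP.exists Fq
  have hpp : Fact p.Prime := ⟨(CharP.char_is_prime_or_zero Fq p).resolve_right
    (CharP.char_ne_zero_of_finite Fq p)⟩
  have : CharP F p := charP_of_injective_algebraMap (algebraMap Fq F).injective p
  exact (FiniteField.frobeniusAlgEquiv Fq F p).bijective

/-- The `q`-power Frobenius automorphism of a perfect field containing `F_q`. -/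
def frob : F ≃ₐ[Fq] F := AlgEquiv.ofBijective (FiniteField.frobeniusAlgHom Fq F) (frob_bijective Fq F)

theorem frob_apply (x : F) : frob Fq F x = x ^ Fintype.card Fq := rfl

/-- The `n`-th power of the Frobenius, `x ↦ x ^ (q ^ n)`, for any integer `n`. -/
def frobZ (n : ℤ) : F ≃ₐ[Fq] F := frob Fq F ^ n

theorem frobZ_natCast_apply (n : ℕ) (x : F) : frobZ Fq F n x = x ^ Fintype.card Fq ^ n := by
  rw [frobZ, zpow_natCast]
  induction n generalizing x with
  | zero => simp
  | succ n ih => rw [pow_succ, AlgEquiv.mul_apply, ih, frob_apply, ← pow_mul, pow_succ']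

theorem frobZ_neg_one_pow (x : F) : frobZ Fq F (-1) x ^ Fintype.card Fq = x := by
  rw [← frob_apply, frobZ, zpow_neg_one]
  exact (frob Fq F).apply_symm_apply x

end Frobenius

section Twisted
variable {Fq} {F : Type*} [Field F] [Algebra Fq F]

/-- Twisted polynomials `∑ b_i X^i` over `F`, with the rule `X * b = s b * X`. -/
def TwistedPoly (_s : F ≃ₐ[Fq] F) : Type _ := SkewPolynomial F

namespace TwistedPoly
variable (s : F ≃ₐ[Fq] F)

/-- The action of the powers of `s` that defines the twisted multiplication. -/
abbrev action : MulSemiringAction (Multiplicative ℕ) F :=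
  MulSemiringAction.compHom F (powersHom (F →+* F) (s : F →+* F))

instance : Ring (TwistedPoly s) :=
  letI := action s
  inferInstanceAs (Ring (SkewPolynomial F))

instance : Module F (TwistedPoly s) := inferInstanceAs (Module F (SkewPolynomial F))

variable {s}
/-- The coefficient `b_n` of `b = ∑ b_i X^i` (coefficients on the left). -/
def coeff (b : TwistedPoly s) (n : ℕ) : F := SkewPolynomial.coeff b n

variable (s)
/-- The monomial `x X^n`. -/
def monomial (n : ℕ) : F →ₗ[F] TwistedPoly s := SkewPolynomial.monomial n

/-- Constants. -/
def C : F →+* TwistedPoly s :=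
  letI := action s
  SkewPolynomial.CRingHom (R := F)

/-- The variable (`τ` or `σ`). -/
def X : TwistedPoly s := monomial s 1 1

variable {s}
@[ext] theorem ext {a b : TwistedPoly s} (h : ∀ n, coeff a n = coeff b n) : a = b :=
  SkewPolynomial.ext_iff.2 h

theorem coeff_monomial (n m : ℕ) (x : F) : coeff (monomial s n x) m = if n = m then x else 0 :=
  SkewPolynomial.coeff_monomial

theorem coeff_add (a b : TwistedPoly s) (n : ℕ) : coeff (a + b) n = coeff a n + coeff b n :=
  congrArg (fun f => f (Multiplicative.ofAdd n)) (SkewMonoidAlgebra.coeff_add a b)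

theorem coeff_smul (c : F) (b : TwistedPoly s) (n : ℕ) : coeff (c • b) n = c * coeff b n := rfl

def coeffHom (n : ℕ) : TwistedPoly s →+ F where
  toFun b := coeff b n
  map_zero' := rfl
  map_add' a b := coeff_add a b n

theorem action_smul (n : ℕ) (y : F) :
    letI := action s
    (Multiplicative.ofAdd n) • y = (s ^ n) y := by
  change ((s : F →+* F) ^ n) y = (s ^ n) y
  induction n generalizing y with
  | zero => rfl
  | succ n ih => rw [pow_succ, pow_succ]; exact ih (s y)

theorem monomial_mul_monomial (n m : ℕ) (x y : F) :
    monomial s n x * monomial s m y = monomial s (n + m) (x * (s ^ n) y) := by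
  rw [← action_smul]
  let _ := action s
  exact SkewMonoidAlgebra.single_mul_single

theorem coeff_mul (a b : TwistedPoly s) (n : ℕ) :
    coeff (a * b) n = ∑ p ∈ Finset.HasAntidiagonal.antidiagonal n, coeff a p.1 * (s ^ p.1) (coeff b p.2) := by
  have key : ∀ (q : TwistedPoly s → Prop), q 0 → (∀ a b, q a → q b → q (a + b)) →
      (∀ n x, q (monomial s n x)) → ∀ a, q a := by
    intro q h0 hadd hm a
    refine SkewPolynomial.induction (R := F) (motive := q) a h0 ?_
    intro n r p _ _ hp
    exact hadd _ _ (hm n r) hp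
  revert a
  refine key _ ?_ ?_ ?_
  · rw [zero_mul]
    have : ∀ k, coeff (0 : TwistedPoly s) k = 0 := fun k => rfl
    simp [this]
  · intro a a' h h'
    rw [add_mul, coeff_add, h, h', ← Finset.sum_add_distrib]
    exact Finset.sum_congr rfl fun p _ => by rw [coeff_add, add_mul]
  intro i x
  revert b
  refine key _ ?_ ?_ ?_
  · rw [mul_zero]
    have : ∀ k, coeff (0 : TwistedPoly s) k = 0 := fun k => rfl
    simp [this]
  · intro b b' h h'
    rw [mul_add, coeff_add, h, h', ← Finset.sum_add_distrib]
    exact Finset.sum_congr rfl fun p _ => by rw [coeff_add, map_add, mul_add]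
  intro j y
  rw [monomial_mul_monomial, coeff_monomial]
  by_cases h : i + j = n
  · subst h
    rw [if_pos rfl, Finset.sum_eq_single (i, j)]
    · simp [coeff_monomial]
    · rintro ⟨k, l⟩ hkl hne
      simp only [Finset.HasAntidiagonal.mem_antidiagonal] at hkl
      simp only [coeff_monomial]
      by_cases hk : i = k
      · subst hk
        have : j ≠ l := fun h => hne (by rw [h])
        simp [this]
      · simp [hk]
    · simp
  · rw [if_neg h, Finset.sum_eq_zero]
    rintro ⟨k, l⟩ hkl
    simp only [Finset.HasAntidiagonal.mem_antidiagonal] at hkl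
    simp only [coeff_monomial]
    by_cases hk : i = k
    · subst hk
      have : j ≠ l := fun h' => h (by rw [h', hkl])
      simp [this]
    · simp [hk]

instance : IsScalarTower F (TwistedPoly s) (TwistedPoly s) where
  smul_assoc c a b := by
    ext n
    simp only [smul_eq_mul, coeff_smul, coeff_mul, Finset.mul_sum, mul_assoc]

theorem C_eq_monomial (x : F) : C s x = monomial s 0 x := rfl

theorem coeff_C_mul (x : F) (b : TwistedPoly s) (n : ℕ) : coeff (C s x * b) n = x * coeff b n := by
  rw [C_eq_monomial, coeff_mul, Finset.sum_eq_single (0, n)]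
  · simp [coeff_monomial]
  · rintro ⟨k, l⟩ hkl hne
    simp only [Finset.HasAntidiagonal.mem_antidiagonal] at hkl
    have : 0 ≠ k := fun h => hne (by ext <;> simp <;> omega)
    simp [coeff_monomial, this]
  · simp

theorem coeff_mul_C (x : F) (b : TwistedPoly s) (n : ℕ) :
    coeff (b * C s x) n = coeff b n * (s ^ n) x := by
  rw [C_eq_monomial, coeff_mul, Finset.sum_eq_single (n, 0)]
  · simp [coeff_monomial]
  · rintro ⟨k, l⟩ hkl hne
    simp only [Finset.HasAntidiagonal.mem_antidiagonal] at hkl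
    have : 0 ≠ l := fun h => hne (by ext <;> simp <;> omega)
    simp [coeff_monomial, this]
  · simp

instance : Algebra Fq (TwistedPoly s) where
  __ := Module.compHom (TwistedPoly s) (algebraMap Fq F)
  algebraMap := (C s).comp (algebraMap Fq F)
  commutes' c b := by
    ext n
    change coeff (C s (algebraMap Fq F c) * b) n = coeff (b * C s (algebraMap Fq F c)) n
    rw [coeff_C_mul, coeff_mul_C, AlgEquiv.commutes, mul_comm]
  smul_def' c b := by
    ext n
    change coeff (algebraMap Fq F c • b) n = coeff (C s (algebraMap Fq F c) * b) n
    rw [coeff_C_mul, coeff_smul]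

/-- The set of exponents with a nonzero coefficient. -/
def support (b : TwistedPoly s) : Finset ℕ := SkewPolynomial.support b

theorem mem_support (b : TwistedPoly s) (n : ℕ) : n ∈ support b ↔ coeff b n ≠ 0 :=
  SkewPolynomial.mem_support_iff

end TwistedPoly
end Twisted

section TModules

variable {Fq} {F : Type*} [Field F] [Algebra Fq F] [PerfectField F]

variable (Fq F) in
/-- `F[τ]`, with `τ b = b^q τ`. -/
abbrev TauPoly : Type _ := TwistedPoly (frob Fq F)

variable (Fq F) in
/-- `F[σ]`, with `σ b = b^(1/q) σ`. -/
abbrev SigmaPoly : Type _ := TwistedPoly (frob Fq F)⁻¹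

/-- `b = ∑ b_i τ^i ↦ b^* = ∑ b_i^(-i) σ^i`. -/
def starPoly (b : TauPoly Fq F) : SigmaPoly Fq F :=
  ∑ i ∈ b.support, TwistedPoly.monomial _ i (frobZ Fq F (-(i : ℤ)) (b.coeff i))

theorem coeff_starPoly (b : TauPoly Fq F) (n : ℕ) :
    (starPoly b).coeff n = frobZ Fq F (-(n : ℤ)) (b.coeff n) := by
  have h : (starPoly b).coeff n = ∑ i ∈ b.support,
      (TwistedPoly.monomial (frob Fq F)⁻¹ i (frobZ Fq F (-(i : ℤ)) (b.coeff i))).coeff n :=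
    map_sum (TwistedPoly.coeffHom n) _ _
  rw [h]
  simp only [TwistedPoly.coeff_monomial, Finset.sum_ite_eq']
  split_ifs with h0
  · rfl
  · rw [TwistedPoly.mem_support, not_not] at h0
    rw [h0, map_zero]

variable (Fq) in
/-- An Anderson `t`-module over `F` with underlying space `G_a^ι` (dimension `card ι`): an
`F_q`-algebra homomorphism `phi : F_q[t] → Mat_ι(F[τ])` such that the constant term of `phi t`
is `θ Id + N` with `N` nilpotent. -/
structure TModule (θ : F) (ι : Type*) [Fintype ι] [DecidableEq ι] where
  phi : Fq[X] →ₐ[Fq] Matrix ι ι (TauPoly Fq F)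
  isNilpotent : IsNilpotent ((phi Polynomial.X).map (fun b => b.coeff 0) - Matrix.scalar ι θ)

namespace TModule
variable {θ : F} {ι : Type*} [Fintype ι] [DecidableEq ι] (G : TModule Fq θ ι)

/-- `φ_t`. -/
def phiT : Matrix ι ι (TauPoly Fq F) := G.phi Polynomial.X

/-- The coefficients `A_i` of `φ_t = A_0 + A_1 τ + ⋯`; in particular `A_0 = dφ_t`. -/
def coeffMat (i : ℕ) : Matrix ι ι F := G.phiT.map fun b => b.coeff i

/-- Multiplication by `t` on `Mat_{1×ι}(F[τ])`: `m ↦ m φ_t`. -/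
def motiveT : (ι → TauPoly Fq F) →ₗ[F] (ι → TauPoly Fq F) where
  toFun x := x ᵥ* G.phiT
  map_add' x y := Matrix.add_vecMul _ x y
  map_smul' c x := Matrix.smul_vecMul c x _

/-- The `t`-motive: row vectors over `F[τ]`, as an `F[t]`-module through `t m = m φ_t`. -/
abbrev Motive : Type _ := Module.AEval' G.motiveT

/-- `G` is abelian: its `t`-motive is free of finite rank over `F[t]`. -/
def IsAbelian : Prop := Module.Free F[X] G.Motive ∧ Module.Finite F[X] G.Motive

/-- A row vector as an element of the `t`-motive. -/
def toMotive (x : ι → TauPoly Fq F) : G.Motive := Module.AEval'.of G.motiveT x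

/-- The row vector underlying an element of the `t`-motive. -/
def ofMotive (x : G.Motive) : ι → TauPoly Fq F := (Module.AEval'.of G.motiveT).symm x

/-- Left multiplication by `τ` on the `t`-motive. -/
def tau (x : G.Motive) : G.Motive := G.toMotive fun k => TwistedPoly.X _ * G.ofMotive x k

/-- `τ m = M m` for a family `m` of elements of the `t`-motive, written as a column. -/
def IsMotiveFrame {κ : Type*} [Fintype κ] (m : κ → G.Motive) (M : Matrix κ κ F[X]) : Prop :=
  ∀ i, G.tau (m i) = ∑ j, M i j • m j

/-- `φ_t^*`, with entries `(φ_t^*)_{ij} = ((φ_t)_{ji})^*`. -/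
def phiTStar : Matrix ι ι (SigmaPoly Fq F) := (G.phiT.map starPoly)ᵀ

/-- Multiplication by `t` on `Mat_{1×ι}(F[σ])`: `n ↦ n φ_t^*`. -/
def dualMotiveT : (ι → SigmaPoly Fq F) →ₗ[F] (ι → SigmaPoly Fq F) where
  toFun x := x ᵥ* G.phiTStar
  map_add' x y := Matrix.add_vecMul _ x y
  map_smul' c x := Matrix.smul_vecMul c x _

/-- The dual `t`-motive: row vectors over `F[σ]`, as an `F[t]`-module through `t n = n φ_t^*`. -/
abbrev DualMotive : Type _ := Module.AEval' G.dualMotiveT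

/-- Left multiplication by `σ` on the dual `t`-motive. -/
def sigma (x : G.DualMotive) : G.DualMotive :=
  Module.AEval'.of G.dualMotiveT
    fun k => TwistedPoly.X _ * (Module.AEval'.of G.dualMotiveT).symm x k

/-- `σ n = M n` for a family `n` of elements of the dual `t`-motive, written as a column. -/
def IsDualMotiveFrame {κ : Type*} [Fintype κ] (n : κ → G.DualMotive) (M : Matrix κ κ F[X]) : Prop :=
  ∀ i, G.sigma (n i) = ∑ j, M i j • n j

/-- The linear operator `B ↦ B (dφ_t)^(k) - (dφ_t) B` on matrices. -/
def expOp (k : ℕ) : Module.End F (Matrix ι ι F) :=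
  LinearMap.mulRight F ((G.coeffMat 0).map (frobZ Fq F k)) - LinearMap.mulLeft F (G.coeffMat 0)

/-- The coefficients `B_k` of the exponential of `G`, namely `B_0 = 1` and, for `k ≥ 1`, the solution
of `B_k (dφ_t)^(k) - (dφ_t) B_k = ∑_{1 ≤ i ≤ k} A_i B_{k-i}^(i)`. The operator on the left is
invertible (`isUnit_expOp`), and the resulting series is the one that satisfies
`φ_t ∘ Exp = Exp ∘ dφ_t` (`expCoeff_spec`). -/
def expCoeff : ℕ → Matrix ι ι F
  | 0 => 1
  | k + 1 => Ring.inverse (G.expOp (k + 1))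
      (∑ i : Fin (k + 1), G.coeffMat (i + 1) * (expCoeff (k - i)).map (frobZ Fq F (((i : ℕ) + 1 : ℕ) : ℤ)))

theorem isUnit_expOp (k : ℕ) (hk : (frobZ Fq F k) θ ≠ θ) : IsUnit (G.expOp k) := by
  set N : Matrix ι ι F := G.coeffMat 0 - Matrix.scalar ι θ with hN
  have hNn : IsNilpotent N := G.isNilpotent
  set N' : Matrix ι ι F := N.map (frobZ Fq F k) with hN'
  have hN'n : IsNilpotent N' :=
    hNn.map ((frobZ Fq F k : F ≃ₐ[Fq] F) : F →+* F).mapMatrix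
  have e0 : G.coeffMat 0 = N + Matrix.scalar ι θ := by rw [hN]; abel
  have e1 : (G.coeffMat 0).map (frobZ Fq F k) = N' + Matrix.scalar ι ((frobZ Fq F k) θ) := by
    rw [e0, hN']
    ext i j
    by_cases h : i = j <;> simp [h]
  have hr : IsNilpotent (LinearMap.mulRight F N') := by
    obtain ⟨e, he⟩ := hN'n
    exact ⟨e, by rw [LinearMap.pow_mulRight, he]; ext; simp⟩
  have hl : IsNilpotent (LinearMap.mulLeft F N) := by
    obtain ⟨e, he⟩ := hNn
    exact ⟨e, by rw [LinearMap.pow_mulLeft, he]; ext; simp⟩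
  have hcomm : Commute (LinearMap.mulRight F N') (LinearMap.mulLeft F N) :=
    (LinearMap.commute_mulLeft_right N N').symm
  have hnil := hcomm.isNilpotent_sub hr hl
  have hu : IsUnit (algebraMap F (Module.End F (Matrix ι ι F)) ((frobZ Fq F k) θ - θ)) :=
    (IsUnit.mk0 _ (sub_ne_zero.2 hk)).map _
  have hsum := hnil.isUnit_add_left_of_commute hu (Algebra.commutes _ _).symm
  have heq : G.expOp k = algebraMap F (Module.End F (Matrix ι ι F)) (frobZ Fq F k θ - θ) +
      (LinearMap.mulRight F N' - LinearMap.mulLeft F N) := by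
    rw [expOp, e1, e0]
    refine LinearMap.ext fun Y => ?_
    simp only [LinearMap.sub_apply, LinearMap.add_apply, LinearMap.mulRight_apply,
      LinearMap.mulLeft_apply, Module.algebraMap_end_apply, Matrix.mul_add, Matrix.add_mul,
      Matrix.scalar_apply, ← Matrix.smul_eq_mul_diagonal, ← Matrix.smul_eq_diagonal_mul, sub_smul]
    abel
  rw [heq]
  exact hsum

theorem expCoeff_spec (hθ : ∀ k : ℕ, k ≠ 0 → frobZ Fq F k θ ≠ θ) (n : ℕ) :
    ∑ p ∈ Finset.HasAntidiagonal.antidiagonal n,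
      G.coeffMat p.1 * (G.expCoeff p.2).map (frobZ Fq F p.1) =
    G.expCoeff n * (G.coeffMat 0).map (frobZ Fq F n) := by
  cases n with
  | zero =>
    have h : G.coeffMat 0 = (G.coeffMat 0).map (frobZ Fq F (0 : ℤ)) := by
      ext i j
      simp [frobZ]
    simpa [expCoeff] using h
  | succ k =>
    have hu := G.isUnit_expOp (k + 1) (hθ (k + 1) k.succ_ne_zero)
    have h1 : G.expOp (k + 1) (G.expCoeff (k + 1)) = ∑ i : Fin (k + 1),
        G.coeffMat (i + 1) * (G.expCoeff (k - i)).map (frobZ Fq F (((i : ℕ) + 1 : ℕ) : ℤ)) := by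
      rw [expCoeff, ← Module.End.mul_apply, Ring.mul_inverse_cancel _ hu, Module.End.one_apply]
    simp only [expOp, LinearMap.sub_apply, LinearMap.mulRight_apply, LinearMap.mulLeft_apply] at h1
    rw [Finset.Nat.sum_antidiagonal_eq_sum_range_succ
      (fun i j => G.coeffMat i * (G.expCoeff j).map (frobZ Fq F i)), Finset.sum_range_succ',
      Finset.sum_range, sub_eq_iff_eq_add.1 h1]
    congr 1
    · exact Finset.sum_congr rfl fun i _ => by rw [Nat.add_sub_add_right]

variable [Algebra F (CInfty Fq)]

/-- The exponential map `Exp_φ(z) = ∑ B_k z^(k)` on `C_∞`-points. -/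
def exp (z : ι → CInfty Fq) : ι → CInfty Fq :=
  ∑' k : ℕ, (G.expCoeff k).map (algebraMap F (CInfty Fq)) *ᵥ fun i => z i ^ Fintype.card Fq ^ k

/-- `G` is uniformizable: the exponential map is surjective. -/
def IsUniformizable : Prop := Function.Surjective G.exp

/-- `dφ_t`, with entries in `C_∞`. -/
def lieT : Matrix ι ι (CInfty Fq) := (G.coeffMat 0).map (algebraMap F (CInfty Fq))

/-- The action of `t` on `Lie G (C_∞)`, multiplication by `dφ_t`. -/
def lieAct : (ι → CInfty Fq) →ₗ[Fq] (ι → CInfty Fq) := G.lieT.mulVecLin.restrictScalars Fq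

/-- A vector as an element of the `F_q[t]`-module `Lie G (C_∞)`. -/
def toLie (z : ι → CInfty Fq) : Module.AEval' G.lieAct := Module.AEval'.of G.lieAct z

/-- `w` is an `F_q[t]`-basis of the period lattice `ker Exp_φ`: linearly independent, and spanning
exactly the kernel. -/
def IsPeriodBasis {r : ℕ} (w : Fin r → ι → CInfty Fq) : Prop :=
  LinearIndependent Fq[X] (fun j => G.toLie (w j)) ∧
    ∀ z, G.exp z = 0 ↔ G.toLie z ∈ Submodule.span Fq[X] (Set.range fun j => G.toLie (w j))

/-- The Anderson generating function `∑ Exp_φ((dφ_t)^(-i-1) y) t^i`. -/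
def agf (y : ι → CInfty Fq) : ι → (CInfty Fq)⟦X⟧ :=
  fun k => PowerSeries.mk fun i => G.exp ((G.lieT⁻¹ ^ (i + 1)) *ᵥ y) k

end TModule

/-- The `n`-fold Frobenius twist of power series over `C_∞`. -/
def twist (n : ℤ) : (CInfty Fq)⟦X⟧ →+* (CInfty Fq)⟦X⟧ :=
  PowerSeries.map (frobZ Fq (CInfty Fq) n : CInfty Fq →+* CInfty Fq)

/-- The `n`-fold Frobenius twist of polynomials. -/
def polyTwist (n : ℤ) : F[X] →+* F[X] :=
  Polynomial.mapRingHom (frobZ Fq F n : F →+* F)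

variable (Fq) in
/-- The Tate algebra: power series whose coefficients tend to `0`. -/
def Tate : Subring (CInfty Fq)⟦X⟧ := PowerSeries.IsRestricted.subring 1

/-- The Gauss norm `sup |a_i|`. -/
def gauss (f : (CInfty Fq)⟦X⟧) : ℝ := PowerSeries.gaussNorm norm 1 f

variable (Fq) in
/-- `t - θ`. -/
def tSubTheta : (CInfty Fq)⟦X⟧ := PowerSeries.X - PowerSeries.C (CInfty.theta Fq)

section
variable (Fq) (F : Type*) [Field F] [Algebra F (CInfty Fq)]
/-- The inclusion of `F[t]` in power series over `C_∞`. -/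
def toPS : F[X] →+* (CInfty Fq)⟦X⟧ :=
  Polynomial.coeToPowerSeries.ringHom.comp (Polynomial.mapRingHom (algebraMap F (CInfty Fq)))
end

/-- The cofactor matrix. -/
def cof {κ R : Type*} [Fintype κ] [DecidableEq κ] [CommRing R] (M : Matrix κ κ R) :
    Matrix κ κ R := M.adjugateᵀ

/-- `⟨b | f⟩ = ∑ b_i f^(i)` for a row `b` over `F[τ]` and a column `f` of power series. -/
def pairing {ι : Type*} [Fintype ι] [Algebra F (CInfty Fq)] (b : ι → TauPoly Fq F)
    (f : ι → (CInfty Fq)⟦X⟧) : (CInfty Fq)⟦X⟧ :=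
  ∑ k, ∑ i ∈ (b k).support,
    PowerSeries.C (algebraMap F (CInfty Fq) ((b k).coeff i)) * twist (i : ℤ) (f k)

section Carlitz

/-- The matrix `[t]_n`: `θ` on the diagonal, `1` above it, and `τ` added in the lower left corner
(`θ + τ` for `n = 1`). -/
def carlitzMatrix (θ : F) (n : ℕ) : Matrix (Fin n) (Fin n) (TauPoly Fq F) :=
  Matrix.of fun i j =>
    (if i = j then TwistedPoly.C _ θ else 0) + (if (i : ℕ) + 1 = j then 1 else 0) +
      (if (i : ℕ) + 1 = n ∧ (j : ℕ) = 0 then TwistedPoly.X _ else 0)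

theorem isNilpotent_of_strictUpper {R : Type*} [CommRing R] {n : ℕ} (N : Matrix (Fin n) (Fin n) R)
    (h : ∀ i j, j ≤ i → N i j = 0) : IsNilpotent N := by
  have key : ∀ k : ℕ, ∀ i j : Fin n, (j : ℕ) < i + k → (N ^ k) i j = 0 := by
    intro k
    induction k with
    | zero =>
      intro i j hij
      rw [pow_zero, Matrix.one_apply_ne]
      rintro rfl
      omega
    | succ k ih =>
      intro i j hij
      rw [pow_succ, Matrix.mul_apply]
      refine Finset.sum_eq_zero fun l _ => ?_
      by_cases hl : (l : ℕ) < i + k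
      · rw [ih i l hl, zero_mul]
      · rw [h l j (Fin.le_def.2 (by omega)), mul_zero]
  exact ⟨n, by ext i j; exact key n i j (by omega)⟩

variable (Fq) in
/-- The `n`-th tensor power of the Carlitz module. -/
def carlitz (θ : F) (n : ℕ) : TModule Fq θ (Fin n) where
  phi := Polynomial.aeval (carlitzMatrix θ n)
  isNilpotent := by
    refine isNilpotent_of_strictUpper _ fun i j hij => ?_
    rw [Polynomial.aeval_X]
    have hne : ¬ ((i : ℕ) + 1 = j) := by have := Fin.le_def.1 hij; omega
    have h0 : ∀ b : Prop, [Decidable b] →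
        TwistedPoly.coeff (if b then TwistedPoly.X (frob Fq F) else 0) 0 = 0 := by
      intro b _
      split_ifs
      · exact TwistedPoly.coeff_monomial 1 0 1
      · rfl
    have h1 : TwistedPoly.coeff (0 : TauPoly Fq F) 0 = 0 := rfl
    have h2 : TwistedPoly.coeff (TwistedPoly.C (frob Fq F) θ) 0 = θ :=
      TwistedPoly.coeff_monomial 0 0 θ
    simp only [carlitzMatrix, Matrix.sub_apply, Matrix.map_apply, Matrix.of_apply,
      TwistedPoly.coeff_add, h0, if_neg hne, add_zero, Matrix.scalar_apply,
      Matrix.diagonal_apply]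
    split_ifs
    · rw [h2, sub_self]
    · rw [h1, sub_self]

end Carlitz

section Extensions
variable {θ : F} {ι : Type*} [Fintype ι] [DecidableEq ι]

/-- A `(φ, [·]_n)`-biderivation. -/
structure Biderivation (G : TModule Fq θ ι) (n : ℕ) where
  toLin : Fq[X] →ₗ[Fq] Matrix (Fin n) ι (TauPoly Fq F)
  leibniz : ∀ a b, toLin (a * b) = (carlitz Fq θ n).phi a * toLin b + toLin a * G.phi b

theorem isNilpotent_fromBlocks {R κ₁ κ₂ : Type*} [CommRing R] [Fintype κ₁] [DecidableEq κ₁]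
    [Fintype κ₂] [DecidableEq κ₂] {N₁ : Matrix κ₁ κ₁ R} {N₂ : Matrix κ₂ κ₂ R}
    (D : Matrix κ₂ κ₁ R) (h₁ : IsNilpotent N₁) (h₂ : IsNilpotent N₂) :
    IsNilpotent (Matrix.fromBlocks N₁ 0 D N₂) := by
  have key : ∀ k : ℕ, ∃ E : Matrix κ₂ κ₁ R,
      Matrix.fromBlocks N₁ 0 D N₂ ^ k = Matrix.fromBlocks (N₁ ^ k) 0 E (N₂ ^ k) := by
    intro k
    induction k with
    | zero => exact ⟨0, by simp⟩
    | succ k ih =>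
      obtain ⟨E, hE⟩ := ih
      exact ⟨E * N₁ + N₂ ^ k * D, by rw [pow_succ, hE, Matrix.fromBlocks_multiply]; simp [pow_succ]⟩
  obtain ⟨a, ha⟩ := h₁
  obtain ⟨b, hb⟩ := h₂
  obtain ⟨E, hE⟩ := key (a + b)
  refine ⟨2 * (a + b), ?_⟩
  rw [two_mul, pow_add, hE, pow_add, pow_add, ha, hb, Matrix.fromBlocks_multiply]
  simp

namespace TModule
variable (G : TModule Fq θ ι) {n : ℕ} (δ : Biderivation G n)

/-- The extension `G_δ`, with `φ_t`, `δ(t)`, `[t]_n` as lower triangular blocks. -/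
def extension : TModule Fq θ (ι ⊕ Fin n) where
  phi := Polynomial.aeval
    (Matrix.fromBlocks G.phiT 0 (δ.toLin Polynomial.X) (carlitz Fq θ n).phiT)
  isNilpotent := by
    have h := isNilpotent_fromBlocks ((δ.toLin Polynomial.X).map fun b => b.coeff 0)
      G.isNilpotent (carlitz Fq θ n).isNilpotent
    convert h using 1
    rw [Polynomial.aeval_X]
    ext (i | i) (j | j)
    · simp [phiT, Matrix.diagonal_apply]
    · simp
      rfl
    · simp
    · simp [phiT, Matrix.diagonal_apply]

/-- The family `(m_1, 0), …, (m_r, 0), (0, (1, 0, …, 0))` in the `t`-motive of the extension,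
where `(1, 0, …, 0)` is the generator of the `t`-motive of the tensor power of the Carlitz module. -/
def extFamily [NeZero n] {r : ℕ} (m : Fin r → G.Motive) : Fin r ⊕ Fin 1 → (G.extension δ).Motive :=
  Sum.elim (fun i => (G.extension δ).toMotive (Sum.elim (G.ofMotive (m i)) 0))
    (fun _ => (G.extension δ).toMotive (Sum.elim 0 (Pi.single 0 1)))

end TModule

/-- The block matrix with rows `(Φt, 0)` and `(Φδ, (t - θ)^n)`. -/
def extFrame (θ : F) (n : ℕ) {r : ℕ} (Φt : Matrix (Fin r) (Fin r) F[X])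
    (Φδ : Matrix (Fin 1) (Fin r) F[X]) : Matrix (Fin r ⊕ Fin 1) (Fin r ⊕ Fin 1) F[X] :=
  Matrix.fromBlocks Φt 0 Φδ (Matrix.of fun _ _ => (Polynomial.X - Polynomial.C θ) ^ n)

end Extensions

section Periods
variable {θ : F} {ι : Type*} [Fintype ι] [DecidableEq ι] [Algebra F (CInfty Fq)]

/-- The matrix with entries `⟨τ m_i | G_{w_j}⟩`, `G_{w_j}` the Anderson generating functions. -/
def TModule.upsilon (G : TModule Fq θ ι) {r : ℕ} (m : Fin r → G.Motive)
    (w : Fin r → ι → CInfty Fq) : Matrix (Fin r) (Fin r) (CInfty Fq)⟦X⟧ :=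
  Matrix.of fun i j => pairing (G.ofMotive (G.tau (m i))) (G.agf (w j))

/-- `g_{j,1}`: the first of the last `n` coordinates of the Anderson generating function of the
period `(w_j, l_j)` of the extension. -/
def TModule.gCoord (G : TModule Fq θ ι) {n : ℕ} [NeZero n] (δ : Biderivation G n) {r : ℕ}
    (w : Fin r → ι → CInfty Fq) (l : Fin r → Fin n → CInfty Fq) (j : Fin r) : (CInfty Fq)⟦X⟧ :=
  (G.extension δ).agf (Sum.elim (w j) (l j)) (Sum.inr 0)

/-- `ω`, the Anderson generating function of the Carlitz period. -/
def carlitzOmega (θ : F) (π : CInfty Fq) : (CInfty Fq)⟦X⟧ := (carlitz Fq θ 1).agf (fun _ => π) 0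

/-- `Ω = 1 / ω^(1)`. -/
def bigOmega (θ : F) (π : CInfty Fq) : (CInfty Fq)⟦X⟧ := (twist 1 (carlitzOmega θ π))⁻¹

end Periods

/-- The set of `u` in `Mat_{1×r}(T)` with `u^(-1) - u = f`. -/
def wpPreimage {r : ℕ} (f : Matrix (Fin 1) (Fin r) (CInfty Fq)⟦X⟧) :
    Set (Matrix (Fin 1) (Fin r) (CInfty Fq)⟦X⟧) :=
  {u | (∀ j, u 0 j ∈ Tate Fq) ∧ u.map (twist (-1)) - u = f}

/-- `S = ∑_{m ≥ 1} f^(m)`, convergent in `Mat_{1×r}(T)` for the Gauss norm. -/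
def IsTwistSum {r : ℕ} (f S : Matrix (Fin 1) (Fin r) (CInfty Fq)⟦X⟧) : Prop :=
  ∀ j, S 0 j ∈ Tate Fq ∧
    Filter.Tendsto (fun M : ℕ => gauss (S 0 j - ∑ m ∈ Finset.Icc 1 M, twist (m : ℤ) (f 0 j)))
      Filter.atTop (nhds 0)

/-- The row `- uc⁻¹ Φδ Φt⁻¹ (V⁻¹)ᵗʳ`. -/
def hRow {F : Type*} [Field F] [Algebra F (CInfty Fq)] {r : ℕ} (uc : CInfty Fq)
    (Φδ : Matrix (Fin 1) (Fin r) F[X]) (Φt : Matrix (Fin r) (Fin r) F[X])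
    (V : Matrix (Fin r) (Fin r) F[X]) : Matrix (Fin 1) (Fin r) (CInfty Fq)⟦X⟧ :=
  -(PowerSeries.C uc⁻¹ • (Φδ.map (toPS Fq F) * (Φt.map (toPS Fq F))⁻¹ *
    ((V.map (toPS Fq F))⁻¹)ᵀ))

/-- The row `(x, 1)`. -/
def withOne {r : ℕ} (x : Matrix (Fin 1) (Fin r) (CInfty Fq)⟦X⟧) :
    Matrix (Fin 1) (Fin r ⊕ Fin 1) (CInfty Fq)⟦X⟧ := Matrix.fromCols x 1

/-- The matrix with rows `(1, 0)` and `(a, 1)`. -/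
def lowerUnipotent {r : ℕ} (a : Matrix (Fin 1) (Fin r) Fq[X]) :
    Matrix (Fin r ⊕ Fin 1) (Fin r ⊕ Fin 1) Fq[X] := Matrix.fromBlocks 1 0 a 1

end TModules
end AndersonT
end

/-!
Write `T = t - θ`. The proof compares solutions of Frobenius difference equations.

* If `Exp_φ(y) = 0`, the generating function `𝒢_y` satisfies `φ_t 𝒢_y = t 𝒢_y`, so that pairing with
  it is `K[t]`-linear on the `t`-motive and turns `τ` into the twist
  (`twist_one_pairing_of_isMotiveFrame`). For `G` this gives `Υ = Φ_t Υ^(-1)` (`upsilon_eq`), for the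
  extension `γ^(1) = Φ_δ Υ^(-1) + T^n γ` for the row `γ` of the `g_{j,1}` (`twist_one_gCoord`), and for
  the Carlitz module `ω^(1) = T ω`, that is `Ω^(-1) = T Ω` (`twist_neg_one_bigOmega`).
* `Cof(Ψ)^(-1) = Cof(Φ) Cof(Ψ)`, so multiplication by `Ω^(n-d) Cof(Ψ)` relates the equation
  `u^(-1) - u = f` to the equation asserted for `g` (`twist_neg_one_mul_smul_cof`).
* With `Φ_δ = x Φ_t`, both `y = Ω^n γ^(1)` and `z = u_c Ω^n g Vᵗʳ Υ` satisfy
  `v^(-1) = v - Ω^n x Υ` (`twist_neg_one_row`, `twist_neg_one_smul_mul_transpose_mul`). Hence `y - z`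
  is fixed by the twist, and it lies in the Tate algebra, where the fixed elements are the
  polynomials over `F_q` (`exists_toPS_of_twist_eq`). This is the row `(a_1, …, a_r)`.

For the last part, `det Ψ` and `u_c Ω^d` satisfy the same equation, so their quotient is a unit of
`F_q[t]`, a constant `κ` (`exists_det_eq_smul`).

Two analytic facts are needed. The exponential is entire and small near the origin
(`TModule.norm_expCoeff_le`), so generating functions lie in the Tate algebra. The proof avoids a
normal form of `dφ_t = θ + N`: in characteristic `p` its `p^e`-th power is scalar as soon as
`N^(p^e) = 0`, and the recursion for the coefficients is estimated through `φ_t^(p^e)`. Secondly, `ω` is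
a unit of the Tate algebra (`norm_coeff_carlitzOmega_le`); this is where it matters that the Carlitz
period generates the period lattice.
-/
noncomputable section
namespace AndersonT
set_option linter.unusedSectionVars false

/-! ### Frobenius twists of power series -/

section FrobeniusTwists
variable {Fq : Type*} [Field Fq] [Fintype Fq]

theorem frobZ_add_apply {F : Type*} [Field F] [Algebra Fq F] [PerfectField F] (a b : ℤ) (x : F) :
    frobZ Fq F (a + b) x = frobZ Fq F a (frobZ Fq F b x) := by
  rw [frobZ, zpow_add, AlgEquiv.mul_apply, frobZ, frobZ]

theorem frobZ_zero_apply {F : Type*} [Field F] [Algebra Fq F] [PerfectField F] (x : F) :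
    frobZ Fq F 0 x = x := by simp [frobZ]

theorem one_lt_card_pow {k : ℕ} (hk : k ≠ 0) : 1 < Fintype.card Fq ^ k :=
  Nat.one_lt_pow hk Fintype.one_lt_card

theorem card_pow_ne_zero (k : ℕ) : Fintype.card Fq ^ k ≠ 0 :=
  pow_ne_zero _ Fintype.card_ne_zero

theorem algebraMap_frobZ_natCast {F : Type*} [Field F] [Algebra Fq F] [PerfectField F]
    [Algebra F (CInfty Fq)] (k : ℕ) (x : F) :
    algebraMap F (CInfty Fq) (frobZ Fq F k x) = algebraMap F (CInfty Fq) x ^ Fintype.card Fq ^ k := by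
  rw [frobZ_natCast_apply, map_pow]

theorem algebraMap_frobZ_neg_one {F : Type*} [Field F] [Algebra Fq F] [PerfectField F]
    [Algebra F (CInfty Fq)] (x : F) :
    algebraMap F (CInfty Fq) (frobZ Fq F (-1) x) = frobZ Fq (CInfty Fq) (-1) (algebraMap F _ x) := by
  apply (frob Fq (CInfty Fq)).injective
  rw [frob_apply, frob_apply, frobZ_neg_one_pow, ← map_pow, frobZ_neg_one_pow]

theorem coeff_twist (n : ℤ) (f : (CInfty Fq)⟦X⟧) (i : ℕ) :
    PowerSeries.coeff i (twist n f) = frobZ Fq (CInfty Fq) n (PowerSeries.coeff i f) := by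
  simp [twist]

theorem coeff_twist_natCast (n : ℕ) (f : (CInfty Fq)⟦X⟧) (i : ℕ) :
    PowerSeries.coeff i (twist (n : ℤ) f) = PowerSeries.coeff i f ^ Fintype.card Fq ^ n := by
  rw [coeff_twist, frobZ_natCast_apply]

theorem coeff_twist_one (f : (CInfty Fq)⟦X⟧) (i : ℕ) :
    PowerSeries.coeff i (twist 1 f) = PowerSeries.coeff i f ^ Fintype.card Fq := by
  simpa using coeff_twist_natCast 1 f i

theorem twist_add (a b : ℤ) (f : (CInfty Fq)⟦X⟧) : twist (a + b) f = twist a (twist b f) := by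
  ext i; simp only [coeff_twist, frobZ_add_apply]

theorem twist_zero (f : (CInfty Fq)⟦X⟧) : twist 0 f = f := by
  ext i; simp only [coeff_twist, frobZ_zero_apply]

theorem twist_neg_one_twist_one (f : (CInfty Fq)⟦X⟧) : twist (-1) (twist 1 f) = f := by
  rw [← twist_add, neg_add_cancel, twist_zero]

theorem twist_one_twist_neg_one (f : (CInfty Fq)⟦X⟧) : twist 1 (twist (-1) f) = f := by
  rw [← twist_add, add_neg_cancel, twist_zero]

theorem twist_C (n : ℤ) (x : CInfty Fq) :
    twist n (PowerSeries.C x) = PowerSeries.C (frobZ Fq (CInfty Fq) n x) := by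
  simp [twist]

theorem twist_inv (n : ℤ) (f : (CInfty Fq)⟦X⟧) (hf : PowerSeries.constantCoeff f ≠ 0) :
    twist n f⁻¹ = (twist n f)⁻¹ := by
  have h : PowerSeries.constantCoeff (twist n f) ≠ 0 := by
    rw [← PowerSeries.coeff_zero_eq_constantCoeff_apply, coeff_twist]
    simpa using hf
  rw [PowerSeries.eq_inv_iff_mul_eq_one h, ← map_mul, PowerSeries.inv_mul_cancel _ hf, map_one]

section
variable {F : Type*} [Field F] [Algebra F (CInfty Fq)]

theorem coeff_toPS (p : F[X]) (i : ℕ) :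
    PowerSeries.coeff i (toPS Fq F p) = algebraMap F (CInfty Fq) (p.coeff i) := by
  simp [toPS]

theorem toPS_C (x : F) : toPS Fq F (Polynomial.C x) = PowerSeries.C (algebraMap F _ x) := by
  simp [toPS]

theorem toPS_X : toPS Fq F Polynomial.X = PowerSeries.X := by
  simp [toPS]

theorem twist_neg_one_toPS [Algebra Fq F] [PerfectField F] (p : F[X]) :
    twist (-1) (toPS Fq F p) = toPS Fq F (polyTwist (Fq := Fq) (-1) p) := by
  ext i
  rw [coeff_twist, coeff_toPS, coeff_toPS, polyTwist, Polynomial.coe_mapRingHom,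
    Polynomial.coeff_map]
  exact (algebraMap_frobZ_neg_one _).symm
end

theorem twist_toPS_base (n : ℤ) (p : Fq[X]) : twist n (toPS Fq Fq p) = toPS Fq Fq p := by
  ext i
  rw [coeff_twist, coeff_toPS, AlgEquiv.commutes]

theorem toPS_base_injective : Function.Injective (toPS Fq Fq) := by
  intro p r h
  ext i
  have := congrArg (PowerSeries.coeff i) h
  rw [coeff_toPS, coeff_toPS] at this
  exact (algebraMap Fq (CInfty Fq)).injective this

end FrobeniusTwists

/-! ### The Tate algebra and the constants of the twist -/

section TateAlgebra
open Filter Topology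
variable {Fq : Type*} [Field Fq] [Fintype Fq]

theorem mem_tate_iff {f : (CInfty Fq)⟦X⟧} :
    f ∈ Tate Fq ↔ Tendsto (fun i => PowerSeries.coeff i f) atTop (𝓝 0) := by
  rw [tendsto_zero_iff_norm_tendsto_zero]
  have : f ∈ Tate Fq ↔ PowerSeries.IsRestricted 1 f := Iff.rfl
  rw [this, PowerSeries.isRestricted_iff']
  simp

theorem tendsto_norm_of_mem_tate {f : (CInfty Fq)⟦X⟧} (hf : f ∈ Tate Fq) :
    Tendsto (fun i => ‖PowerSeries.coeff i f‖) atTop (𝓝 0) :=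
  tendsto_zero_iff_norm_tendsto_zero.1 (mem_tate_iff.1 hf)

theorem tate_of_coeff_eq_zero {f : (CInfty Fq)⟦X⟧} (N : ℕ)
    (h : ∀ i, N ≤ i → PowerSeries.coeff i f = 0) : f ∈ Tate Fq := by
  rw [mem_tate_iff]
  refine tendsto_const_nhds.congr' ?_
  filter_upwards [eventually_ge_atTop N] with i hi using (h i hi).symm

theorem toPS_mem_tate {F : Type*} [Field F] [Algebra F (CInfty Fq)] (p : F[X]) :
    toPS Fq F p ∈ Tate Fq :=
  tate_of_coeff_eq_zero (p.natDegree + 1) fun i hi => by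
    rw [coeff_toPS, Polynomial.coeff_eq_zero_of_natDegree_lt (by omega), map_zero]

theorem C_mem_tate (x : CInfty Fq) : PowerSeries.C x ∈ Tate Fq :=
  tate_of_coeff_eq_zero 1 fun i hi => by
    rw [PowerSeries.coeff_C, if_neg (by omega)]

theorem twist_natCast_mem_tate {f : (CInfty Fq)⟦X⟧} (n : ℕ) (hf : f ∈ Tate Fq) :
    twist (n : ℤ) f ∈ Tate Fq := by
  rw [mem_tate_iff] at hf ⊢
  have := hf.pow (Fintype.card Fq ^ n)
  rw [zero_pow (card_pow_ne_zero n)] at this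
  simpa only [coeff_twist_natCast] using this

theorem twist_one_mem_tate {f : (CInfty Fq)⟦X⟧} (hf : f ∈ Tate Fq) : twist 1 f ∈ Tate Fq := by
  simpa using twist_natCast_mem_tate 1 hf

/-- The Artin–Schreier polynomial splits over the constants: `x ^ q - x = ∏ (x - a)`. -/
theorem prod_sub_algebraMap (x : CInfty Fq) :
    ∏ a : Fq, (x - algebraMap Fq (CInfty Fq) a) = x ^ Fintype.card Fq - x := by
  classical
  have h : ∏ a : Fq, (Polynomial.X - Polynomial.C a) =
      (Polynomial.X ^ Fintype.card Fq - Polynomial.X : Fq[X]) := by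
    have h1 := FiniteField.roots_X_pow_card_sub_X Fq
    have h2 := Polynomial.prod_multiset_X_sub_C_of_monic_of_roots_card_eq
      (p := (Polynomial.X ^ Fintype.card Fq - Polynomial.X : Fq[X]))
      (Polynomial.monic_X_pow_sub (by
        rw [Polynomial.degree_X]; exact_mod_cast Fintype.one_lt_card))
      (by rw [h1, FiniteField.X_pow_card_sub_X_natDegree_eq _ Fintype.one_lt_card]; rfl)
    rw [h1] at h2
    exact h2
  have := congrArg (Polynomial.aeval x) h
  simpa [map_prod] using this

theorem mem_range_algebraMap_of_pow_card {x : CInfty Fq} (hx : x ^ Fintype.card Fq = x) :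
    ∃ a : Fq, algebraMap Fq (CInfty Fq) a = x := by
  have h := prod_sub_algebraMap x
  rw [hx, sub_self, Finset.prod_eq_zero_iff] at h
  obtain ⟨a, _, ha⟩ := h
  exact ⟨a, (sub_eq_zero.1 ha).symm⟩

theorem norm_algebraMap_base {a : Fq} (ha : a ≠ 0) : ‖algebraMap Fq (CInfty Fq) a‖ = 1 := by
  have h : ‖algebraMap Fq (CInfty Fq) a‖ ^ (Fintype.card Fq - 1) = 1 := by
    rw [← norm_pow, ← map_pow, FiniteField.pow_card_sub_one_eq_one a ha, map_one, norm_one]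
  have := Fintype.one_lt_card (α := Fq)
  exact (pow_eq_one_iff_of_nonneg (norm_nonneg _) (by omega)).1 h

theorem norm_algebraMap_base_le (a : Fq) : ‖algebraMap Fq (CInfty Fq) a‖ ≤ 1 := by
  by_cases ha : a = 0
  · simp [ha]
  · exact (norm_algebraMap_base ha).le

/-- A sequence of constants that tends to zero is eventually zero, since nonzero constants have
absolute value `1`. -/
theorem exists_polynomial_of_tendsto (a : ℕ → Fq)
    (ha : ∀ᶠ i in atTop, ‖algebraMap Fq (CInfty Fq) (a i)‖ < 1) :
    ∃ p : Fq[X], ∀ i, p.coeff i = a i := by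
  obtain ⟨N, hN⟩ := eventually_atTop.1 ha
  refine ⟨∑ i ∈ Finset.range N, Polynomial.monomial i (a i), fun i => ?_⟩
  rw [Polynomial.finsetSum_coeff]
  simp only [Polynomial.coeff_monomial, Finset.sum_ite_eq', Finset.mem_range]
  split_ifs with h
  · rfl
  · by_contra h0
    exact absurd (hN i (by omega)) (by rw [norm_algebraMap_base (Ne.symm h0)]; simp)

/-- The elements of the Tate algebra fixed by the twist are the polynomials over `F_q`. -/
theorem exists_toPS_of_twist_eq {f : (CInfty Fq)⟦X⟧} (hf : f ∈ Tate Fq) (h : twist (-1) f = f) :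
    ∃ a : Fq[X], toPS Fq Fq a = f := by
  have h1 : twist 1 f = f := by
    conv_lhs => rw [← h]
    exact twist_one_twist_neg_one f
  have hc : ∀ i, ∃ a : Fq, algebraMap Fq (CInfty Fq) a = PowerSeries.coeff i f := fun i =>
    mem_range_algebraMap_of_pow_card (by rw [← coeff_twist_one, h1])
  choose a ha using hc
  obtain ⟨p, hp⟩ := exists_polynomial_of_tendsto a (by
    simp only [ha]
    exact (tendsto_norm_of_mem_tate hf).eventually (gt_mem_nhds one_pos))
  refine ⟨p, ?_⟩
  ext i
  rw [coeff_toPS, hp, ha]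

end TateAlgebra

/-! ### Matrices over the twisted power series ring -/

section TwistedConvolution
variable {Fq : Type*} [Field Fq] [Fintype Fq] {F : Type*} [Field F] [Algebra Fq F] [PerfectField F]

/-- The product of the formal series `∑ A_i τ^i` and `∑ Y_j τ^j` with matrix coefficients:
its `k`-th coefficient is `∑_{i + j = k} A_i Y_j^(i)`. -/
def twistedConv {κ μ ν : Type*} [Fintype μ] (Fq : Type*) [Field Fq] [Fintype Fq] [Algebra Fq F]
    (A : ℕ → Matrix κ μ F) (Y : ℕ → Matrix μ ν F) (k : ℕ) : Matrix κ ν F :=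
  ∑ p ∈ Finset.HasAntidiagonal.antidiagonal k, A p.1 * (Y p.2).map (frobZ Fq F p.1)

/-- The formal series with constant term `D` and no other terms. -/
def constSeq {κ μ : Type*} (D : Matrix κ μ F) : ℕ → Matrix κ μ F := fun k => if k = 0 then D else 0

theorem map_frobZ_zero {κ μ : Type*} (M : Matrix κ μ F) : M.map (frobZ Fq F 0) = M := by
  ext i j
  simp [frobZ_zero_apply]

theorem map_frobZ_map_frobZ {κ μ : Type*} (M : Matrix κ μ F) (a b : ℕ) :
    (M.map (frobZ Fq F b)).map (frobZ Fq F a) = M.map (frobZ Fq F (a + b : ℕ)) := by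
  ext i j
  simp [frobZ_add_apply]

theorem map_frobZ_mul {κ μ ν : Type*} [Fintype μ] (M : Matrix κ μ F) (N : Matrix μ ν F) (a : ℤ) :
    (M * N).map (frobZ Fq F a) = M.map (frobZ Fq F a) * N.map (frobZ Fq F a) :=
  Matrix.map_mul (f := ((frobZ Fq F a : F ≃ₐ[Fq] F) : F →+* F))

theorem map_frobZ_sum {κ μ σ : Type*} (s : Finset σ) (M : σ → Matrix κ μ F) (a : ℤ) :
    (∑ x ∈ s, M x).map (frobZ Fq F a) = ∑ x ∈ s, (M x).map (frobZ Fq F a) := by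
  ext i j
  simp [Matrix.sum_apply]

theorem twistedConv_assoc {κ μ ν ξ : Type*} [Fintype μ] [Fintype ν] (A : ℕ → Matrix κ μ F)
    (Y : ℕ → Matrix μ ν F) (Z : ℕ → Matrix ν ξ F) :
    twistedConv Fq (twistedConv Fq A Y) Z = twistedConv Fq A (twistedConv Fq Y Z) := by
  funext k
  simp only [twistedConv, Matrix.sum_mul, map_frobZ_sum, map_frobZ_mul, Matrix.mul_sum,
    map_frobZ_map_frobZ]
  rw [Finset.sum_sigma', Finset.sum_sigma']
  refine Finset.sum_nbij' (fun x => ⟨(x.2.1, x.2.2 + x.1.2), (x.2.2, x.1.2)⟩)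
    (fun x => ⟨(x.1.1 + x.2.1, x.2.2), (x.1.1, x.2.1)⟩) ?_ ?_ ?_ ?_ ?_
  · rintro ⟨⟨a, b⟩, ⟨c, e⟩⟩ h
    simp only [Finset.mem_sigma, Finset.HasAntidiagonal.mem_antidiagonal] at h ⊢
    exact ⟨by omega, trivial⟩
  · rintro ⟨⟨a, b⟩, ⟨c, e⟩⟩ h
    simp only [Finset.mem_sigma, Finset.HasAntidiagonal.mem_antidiagonal] at h ⊢
    exact ⟨by omega, trivial⟩
  · rintro ⟨⟨a, b⟩, ⟨c, e⟩⟩ h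
    simp only [Finset.mem_sigma, Finset.HasAntidiagonal.mem_antidiagonal] at h
    obtain ⟨h1, rfl⟩ := h
    rfl
  · rintro ⟨⟨a, b⟩, ⟨c, e⟩⟩ h
    simp only [Finset.mem_sigma, Finset.HasAntidiagonal.mem_antidiagonal] at h
    obtain ⟨h1, rfl⟩ := h
    rfl
  · rintro ⟨⟨a, b⟩, ⟨c, e⟩⟩ h
    simp only [Finset.mem_sigma, Finset.HasAntidiagonal.mem_antidiagonal] at h
    obtain ⟨h1, rfl⟩ := h
    simp only [Matrix.mul_assoc]

theorem twistedConv_constSeq {κ μ ν : Type*} [Fintype μ] (A : ℕ → Matrix κ μ F)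
    (D : Matrix μ ν F) (k : ℕ) :
    twistedConv Fq A (constSeq D) k = A k * D.map (frobZ Fq F k) := by
  rw [twistedConv, Finset.sum_eq_single (k, 0)]
  · simp [constSeq]
  · rintro ⟨a, b⟩ h hne
    rw [Finset.HasAntidiagonal.mem_antidiagonal] at h
    have : b ≠ 0 := fun h0 => hne (by ext <;> simp_all)
    simp [constSeq, this]
  · simp

theorem constSeq_twistedConv {κ μ ν : Type*} [Fintype μ] (D : Matrix κ μ F)
    (Y : ℕ → Matrix μ ν F) (k : ℕ) :
    twistedConv Fq (constSeq D) Y k = D * Y k := by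
  rw [twistedConv, Finset.sum_eq_single (0, k)]
  · simp [constSeq, map_frobZ_zero]
  · rintro ⟨a, b⟩ h hne
    rw [Finset.HasAntidiagonal.mem_antidiagonal] at h
    have : a ≠ 0 := fun h0 => hne (by ext <;> simp_all)
    simp [constSeq, this]
  · simp

theorem frob_pow_eq_frobZ (n : ℕ) : frob Fq F ^ n = frobZ Fq F n := by
  rw [frobZ, zpow_natCast]

theorem TwistedPoly.coeff_sum {σ : Type*} (s : Finset σ) (f : σ → TauPoly Fq F) (n : ℕ) :
    (∑ x ∈ s, f x).coeff n = ∑ x ∈ s, (f x).coeff n :=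
  map_sum (TwistedPoly.coeffHom n) _ _

/-- The coefficients of a matrix over `F[τ]`. -/
def coeffSeq {κ μ : Type*} (M : Matrix κ μ (TauPoly Fq F)) (k : ℕ) : Matrix κ μ F :=
  M.map fun b => b.coeff k

theorem coeffSeq_mul {κ μ ν : Type*} [Fintype μ] (M : Matrix κ μ (TauPoly Fq F))
    (N : Matrix μ ν (TauPoly Fq F)) :
    coeffSeq (M * N) = twistedConv Fq (coeffSeq M) (coeffSeq N) := by
  funext k
  ext i j
  simp only [coeffSeq, twistedConv, Matrix.map_apply, Matrix.mul_apply, Matrix.sum_apply,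
    TwistedPoly.coeff_sum, TwistedPoly.coeff_mul, frob_pow_eq_frobZ]
  rw [Finset.sum_comm]

theorem coeffSeq_one {κ : Type*} [Fintype κ] [DecidableEq κ] :
    coeffSeq (1 : Matrix κ κ (TauPoly Fq F)) = constSeq 1 := by
  funext k
  ext i j
  have h1 : (1 : TauPoly Fq F).coeff k = if k = 0 then 1 else 0 := by
    have : (1 : TauPoly Fq F) = TwistedPoly.C _ 1 := (map_one _).symm
    rw [this, TwistedPoly.C_eq_monomial, TwistedPoly.coeff_monomial]
    simp [eq_comm]
  have h0 : (0 : TauPoly Fq F).coeff k = 0 := rfl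
  by_cases h : i = j <;> by_cases hk : k = 0 <;>
    simp [coeffSeq, constSeq, Matrix.one_apply, h, hk, h1, h0] <;> simp_all

theorem exists_coeffSeq_eq_zero {κ μ : Type*} [Finite κ] [Finite μ]
    (M : Matrix κ μ (TauPoly Fq F)) : ∃ L : ℕ, ∀ i, L ≤ i → coeffSeq M i = 0 := by
  have := Fintype.ofFinite κ
  have := Fintype.ofFinite μ
  refine ⟨Finset.univ.sup fun p : κ × μ => (M p.1 p.2).support.sup id + 1, fun i hi => ?_⟩
  ext a b
  change (M a b).coeff i = 0
  by_contra h
  have h1 : i ≤ (M a b).support.sup id :=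
    Finset.le_sup (f := id) ((TwistedPoly.mem_support _ _).2 h)
  have h2 : (M a b).support.sup id + 1 ≤
      Finset.univ.sup fun p : κ × μ => (M p.1 p.2).support.sup id + 1 :=
    Finset.le_sup (f := fun p : κ × μ => (M p.1 p.2).support.sup id + 1) (Finset.mem_univ (a, b))
  omega

end TwistedConvolution

/-! ### Growth of the coefficients of the exponential -/

section ExponentialCoefficients
open Filter Topology
variable {Fq : Type*} [Field Fq] [Fintype Fq] {F : Type*} [Field F] [Algebra Fq F] [PerfectField F]
  {θ : F} {ι : Type*} [Fintype ι] [DecidableEq ι] (G : TModule Fq θ ι)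

/-- In characteristic `p` a suitable power of `dφ_t = θ + N` is the scalar matrix `θ^s`. -/
theorem TModule.exists_coeffMat_pow : ∃ s : ℕ, s ≠ 0 ∧
    G.coeffMat 0 ^ s = Matrix.scalar ι (θ ^ s) := by
  obtain ⟨p, hp⟩ := CharP.exists Fq
  have hpp : Fact p.Prime := ⟨(CharP.char_is_prime_or_zero Fq p).resolve_right
    (CharP.char_ne_zero_of_finite Fq p)⟩
  have : CharP F p := charP_of_injective_algebraMap (algebraMap Fq F).injective p
  rcases isEmpty_or_nonempty ι with hι | hι
  · exact ⟨1, one_ne_zero, by ext i; exact hι.elim i⟩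
  obtain ⟨e, he⟩ := G.isNilpotent
  change (G.coeffMat 0 - Matrix.scalar ι θ) ^ e = 0 at he
  have hle : e ≤ p ^ e := (Nat.lt_pow_self hpp.out.one_lt).le
  refine ⟨p ^ e, pow_ne_zero _ hpp.out.ne_zero, ?_⟩
  have hcomm : Commute (G.coeffMat 0 - Matrix.scalar ι θ) (Matrix.scalar ι θ) :=
    (Matrix.scalar_commute θ (fun r => mul_comm _ _) _).symm
  have h := add_pow_char_pow_of_commute p (n := e) hcomm
  rw [sub_add_cancel, pow_eq_zero_of_le hle he, zero_add] at h
  rw [h, map_pow]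

theorem TModule.coeffSeq_phiT : coeffSeq G.phiT = G.coeffMat := rfl

variable [Algebra F (CInfty Fq)]

theorem norm_algebraMap_theta_pow (hθ : algebraMap F (CInfty Fq) θ = CInfty.theta Fq) (n : ℕ) :
    ‖algebraMap F (CInfty Fq) (θ ^ n)‖ = (Fintype.card Fq : ℝ) ^ n := by
  rw [map_pow, hθ, norm_pow, CInfty.norm_theta]

theorem one_lt_card_real : (1 : ℝ) < Fintype.card Fq := by
  exact_mod_cast Fintype.one_lt_card

theorem frobZ_theta_ne (hθ : algebraMap F (CInfty Fq) θ = CInfty.theta Fq) {k : ℕ} (hk : k ≠ 0)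
    {s : ℕ} (hs : s ≠ 0) : frobZ Fq F k (θ ^ s) ≠ θ ^ s := by
  intro h
  have h1 := congrArg (fun x => ‖algebraMap F (CInfty Fq) x‖) h
  simp only [algebraMap_frobZ_natCast, norm_pow, norm_algebraMap_theta_pow hθ] at h1
  rw [← pow_mul] at h1
  have h2 := (pow_right_strictMono₀ (one_lt_card_real (Fq := Fq))).injective h1
  have h3 := one_lt_card_pow (Fq := Fq) hk
  have : s * 1 < s * Fintype.card Fq ^ k := Nat.mul_lt_mul_of_pos_left h3 (Nat.pos_of_ne_zero hs)
  omega

theorem TModule.twistedConv_expCoeff (hθ : algebraMap F (CInfty Fq) θ = CInfty.theta Fq) :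
    twistedConv Fq G.coeffMat G.expCoeff =
      twistedConv Fq G.expCoeff (constSeq (G.coeffMat 0)) := by
  funext k
  rw [twistedConv_constSeq]
  exact G.expCoeff_spec (fun k hk => by simpa using frobZ_theta_ne hθ hk one_ne_zero) k

theorem constSeq_mul {κ μ ν : Type*} [Fintype μ] (D : Matrix κ μ F) (E : Matrix μ ν F) :
    twistedConv Fq (constSeq D) (constSeq E) = constSeq (D * E) := by
  funext k
  rw [constSeq_twistedConv]
  by_cases hk : k = 0 <;> simp [constSeq, hk]

/-- The exponential also linearizes the powers of `φ_t`. -/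
theorem TModule.twistedConv_pow_expCoeff (hθ : algebraMap F (CInfty Fq) θ = CInfty.theta Fq)
    (s : ℕ) : twistedConv Fq (coeffSeq (G.phiT ^ s)) G.expCoeff =
      twistedConv Fq G.expCoeff (constSeq (G.coeffMat 0 ^ s)) := by
  induction s with
  | zero =>
    rw [pow_zero, pow_zero, coeffSeq_one]
    funext k
    rw [constSeq_twistedConv, twistedConv_constSeq, Matrix.one_mul]
    have : (1 : Matrix ι ι F).map (frobZ Fq F k) = 1 := by
      ext i j
      by_cases h : i = j <;> simp [Matrix.one_apply, h]
    rw [this, Matrix.mul_one]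
  | succ s ih =>
    rw [pow_succ, coeffSeq_mul, twistedConv_assoc, coeffSeq_phiT, G.twistedConv_expCoeff hθ,
      ← twistedConv_assoc, ih, twistedConv_assoc, constSeq_mul, pow_succ]

/-- If `X (dφ_t)^(k) = (dψ_t) X` with `k ≥ 1`, then `X = 0`: pass to a power for which both sides
are scalar, with different scalars. -/
theorem eq_zero_of_intertwine (hθ : algebraMap F (CInfty Fq) θ = CInfty.theta Fq)
    {κ : Type*} [Fintype κ] [DecidableEq κ] (H : TModule Fq θ κ) {k : ℕ} (hk : k ≠ 0)
    (X : Matrix ι κ F) (hX : X * (H.coeffMat 0).map (frobZ Fq F k) = G.coeffMat 0 * X) : X = 0 := by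
  obtain ⟨s, hs, hGs⟩ := G.exists_coeffMat_pow
  obtain ⟨s', hs', hHs⟩ := H.exists_coeffMat_pow
  have hpow : ∀ e : ℕ, X * ((H.coeffMat 0).map (frobZ Fq F k)) ^ e = G.coeffMat 0 ^ e * X := by
    intro e
    induction e with
    | zero => simp
    | succ e ih =>
      rw [pow_succ, ← Matrix.mul_assoc, ih, Matrix.mul_assoc, hX, ← Matrix.mul_assoc, ← pow_succ]
  have h1 : ((H.coeffMat 0).map (frobZ Fq F k)) ^ (s * s') =
      Matrix.scalar κ (frobZ Fq F k (θ ^ (s * s'))) := by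
    have h2 : ∀ e : ℕ, ((H.coeffMat 0).map (frobZ Fq F k)) ^ e =
        (H.coeffMat 0 ^ e).map (frobZ Fq F k) := fun e =>
      (map_pow ((frobZ Fq F k : F ≃ₐ[Fq] F) : F →+* F).mapMatrix (H.coeffMat 0) e).symm
    rw [h2, mul_comm, pow_mul, hHs, ← map_pow, ← pow_mul]
    ext i j
    by_cases h : i = j <;> simp [h]
  have h2 : G.coeffMat 0 ^ (s * s') = Matrix.scalar ι (θ ^ (s * s')) := by
    rw [pow_mul, hGs, ← map_pow, ← pow_mul]
  have h3 := hpow (s * s')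
  rw [h1, h2] at h3
  ext i j
  have h4 := congrFun (congrFun h3 i) j
  simp only [Matrix.scalar_apply, Matrix.mul_diagonal, Matrix.diagonal_mul] at h4
  have h5 := frobZ_theta_ne hθ hk (mul_ne_zero hs hs')
  rw [mul_comm] at h4
  exact (mul_eq_mul_right_iff.1 h4).resolve_left h5

/-- The coefficients `B_k` of the exponential satisfy `|B_k| ≤ (K δ^k)^(q^k)` with `δ < 1`, so that
the exponential converges everywhere. With `s` as in `exists_coeffMat_pow`, the coefficients of
`φ_t^s` give `(θ^(s q^k) - θ^s) B_k = ∑_{i ≥ 1} A_i B_{k-i}^(i)`, and the factor `|θ|^(s q^k)` on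
the left produces the decay. -/
theorem TModule.norm_expCoeff_le (hθ : algebraMap F (CInfty Fq) θ = CInfty.theta Fq) :
    ∃ K δ : ℝ, 1 ≤ K ∧ 0 < δ ∧ δ < 1 ∧ ∀ k i j,
      ‖algebraMap F (CInfty Fq) (G.expCoeff k i j)‖ ≤ (K * δ ^ k) ^ Fintype.card Fq ^ k := by
  obtain ⟨s, hs, hDs⟩ := G.exists_coeffMat_pow
  set q := Fintype.card Fq with hq
  have hq1 : 1 < q := Fintype.one_lt_card
  set A := coeffSeq (G.phiT ^ s) with hA
  obtain ⟨L, hL⟩ := exists_coeffSeq_eq_zero (G.phiT ^ s)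
  have hconv := G.twistedConv_pow_expCoeff hθ s
  have hA0 : A 0 = Matrix.scalar ι (θ ^ s) := by
    have h := congrFun hconv 0
    rw [twistedConv_constSeq, hDs] at h
    simpa [twistedConv, TModule.expCoeff, map_frobZ_zero, frobZ_zero_apply] using h
  -- a common bound for the coefficients of `φ_t^s`
  obtain ⟨α, hα1, hα⟩ : ∃ α : ℝ, 1 ≤ α ∧ ∀ i a b, ‖algebraMap F (CInfty Fq) (A i a b)‖ ≤ α := by
    refine ⟨1 + ∑ x ∈ (Finset.range L ×ˢ (Finset.univ : Finset (ι × ι))),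
      ‖algebraMap F (CInfty Fq) (A x.1 x.2.1 x.2.2)‖, ?_, fun i a b => ?_⟩
    · exact le_add_of_nonneg_right (Finset.sum_nonneg fun _ _ => norm_nonneg _)
    · by_cases hi : L ≤ i
      · rw [hA, hL i hi]
        simpa using add_nonneg zero_le_one (Finset.sum_nonneg fun _ _ => norm_nonneg _)
      · refine le_trans ?_ (le_add_of_nonneg_left zero_le_one)
        exact Finset.single_le_sum
          (f := fun x : ℕ × ι × ι => ‖algebraMap F (CInfty Fq) (A x.1 x.2.1 x.2.2)‖)
          (fun _ _ => norm_nonneg _)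
          (a := (i, a, b)) (by simp; omega)
  set ρ : ℝ := (q : ℝ) ^ s with hρ
  have hρ1 : 1 < ρ := one_lt_pow₀ (one_lt_card_real (Fq := Fq)) hs
  have hρ0 : 0 < ρ := by linarith
  -- `δ` is chosen with `δ ^ L ≥ 1 / ρ`
  obtain ⟨δ, hδ0, hδ1, hδ⟩ : ∃ δ : ℝ, 0 < δ ∧ δ < 1 ∧ 1 ≤ ρ * δ ^ L := by
    have hr : 0 < 1 - ρ⁻¹ := by
      rw [sub_pos]; exact inv_lt_one_of_one_lt₀ hρ1
    have hr1 : 1 - ρ⁻¹ < 1 := by simp [hρ0]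
    have hL1 : (0 : ℝ) < L + 1 := by positivity
    have hx : (1 - ρ⁻¹) / (L + 1) < 1 := by
      rw [div_lt_one hL1]
      have : (0 : ℝ) ≤ L := Nat.cast_nonneg L
      linarith
    have hx0 : 0 < (1 - ρ⁻¹) / (L + 1) := by positivity
    refine ⟨1 - (1 - ρ⁻¹) / (L + 1), by linarith, by linarith, ?_⟩
    have hb := one_add_mul_le_pow (a := -((1 - ρ⁻¹) / (L + 1))) (by linarith) L
    have h1 : (L : ℝ) * ((1 - ρ⁻¹) / (L + 1)) ≤ 1 - ρ⁻¹ := by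
      rw [mul_div_assoc', div_le_iff₀ hL1]
      nlinarith
    have h2 : ρ⁻¹ ≤ (1 - (1 - ρ⁻¹) / (L + 1)) ^ L := by
      rw [sub_eq_add_neg]
      refine le_trans ?_ hb
      linarith
    calc 1 = ρ * ρ⁻¹ := (mul_inv_cancel₀ hρ0.ne').symm
      _ ≤ _ := mul_le_mul_of_nonneg_left h2 hρ0.le
  have hα0 : 0 < α := by linarith
  have key : ∀ k i j, α * ‖algebraMap F (CInfty Fq) (G.expCoeff k i j)‖ ≤ (α * δ ^ k) ^ q ^ k := by
    intro k
    induction k using Nat.strong_induction_on with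
    | _ k ih =>
    intro a b
    rcases Nat.eq_zero_or_pos k with rfl | hk
    · have : ‖algebraMap F (CInfty Fq) (G.expCoeff 0 a b)‖ ≤ 1 := by
        rw [TModule.expCoeff, Matrix.one_apply]
        split_ifs <;> simp
      simpa using mul_le_mul_of_nonneg_left this hα0.le
    have hrec : (frobZ Fq F k (θ ^ s) - θ ^ s) * G.expCoeff k a b =
        ∑ p ∈ (Finset.HasAntidiagonal.antidiagonal k).erase (0, k),
          ∑ x, A p.1 a x * frobZ Fq F p.1 (G.expCoeff p.2 x b) := by
      have h := congrFun (congrFun (congrFun hconv k) a) b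
      rw [twistedConv_constSeq, hDs, twistedConv,
        ← Finset.add_sum_erase _ _ (show (0, k) ∈ Finset.HasAntidiagonal.antidiagonal k by simp)]
        at h
      change (A 0 * _ + _ : Matrix ι ι F) a b = _ at h
      have e : (Matrix.scalar ι (θ ^ s)).map (frobZ Fq F k) =
          Matrix.diagonal fun _ => frobZ Fq F k (θ ^ s) := by
        ext i j
        by_cases h : i = j <;> simp [h]
      rw [hA0, e, Matrix.add_apply, Matrix.mul_diagonal, Matrix.scalar_apply, Matrix.diagonal_mul,
        Matrix.sum_apply] at h
      simp only [Matrix.map_apply, Nat.cast_zero, frobZ_zero_apply, Matrix.mul_apply] at h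
      rw [sub_mul, sub_eq_iff_eq_add, mul_comm, ← h, add_comm]
    have hnorm : ‖algebraMap F (CInfty Fq) (frobZ Fq F k (θ ^ s) - θ ^ s)‖ = ρ ^ q ^ k := by
      have h1 : ‖algebraMap F (CInfty Fq) (frobZ Fq F k (θ ^ s))‖ = ρ ^ q ^ k := by
        rw [algebraMap_frobZ_natCast, norm_pow, norm_algebraMap_theta_pow hθ]
      have h2 : ‖-algebraMap F (CInfty Fq) (θ ^ s)‖ = ρ := by
        rw [norm_neg, norm_algebraMap_theta_pow hθ]
      have h3 : ρ < ρ ^ q ^ k := lt_self_pow₀ hρ1 (one_lt_card_pow hk.ne')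
      rw [map_sub, sub_eq_add_neg, IsUltrametricDist.norm_add_eq_max_of_norm_ne_norm, h1, h2,
        max_eq_left h3.le]
      rw [h1, h2]
      exact h3.ne'
    have hsum : ‖algebraMap F (CInfty Fq) (∑ p ∈ (Finset.HasAntidiagonal.antidiagonal k).erase (0, k),
          ∑ x, A p.1 a x * frobZ Fq F p.1 (G.expCoeff p.2 x b))‖ ≤
        α⁻¹ * (α * (ρ * δ ^ k)) ^ q ^ k := by
      rw [map_sum]
      have hnn : 0 ≤ α⁻¹ * (α * (ρ * δ ^ k)) ^ q ^ k := by positivity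
      refine IsUltrametricDist.norm_sum_le_of_forall_le_of_nonneg hnn ?_
      rintro ⟨i, j⟩ hp
      rw [Finset.mem_erase, Finset.HasAntidiagonal.mem_antidiagonal] at hp
      obtain ⟨hne, hij⟩ := hp
      simp only at hij
      have hi : i ≠ 0 := fun h0 => hne (by ext <;> simp_all)
      rw [map_sum]
      refine IsUltrametricDist.norm_sum_le_of_forall_le_of_nonneg hnn fun x _ => ?_
      by_cases hiL : L ≤ i
      · rw [hA, hL i hiL]
        simpa using hnn
      rw [map_mul, norm_mul, algebraMap_frobZ_natCast, norm_pow]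
      have hB := ih j (by omega) x b
      have hB' : ‖algebraMap F (CInfty Fq) (G.expCoeff j x b)‖ ≤ α⁻¹ * (α * δ ^ j) ^ q ^ j := by
        rw [le_inv_mul_iff₀ hα0]; exact hB
      have hδj : δ ^ j ≤ ρ * δ ^ k := by
        have h1 : 1 ≤ ρ * δ ^ i := hδ.trans
          (mul_le_mul_of_nonneg_left (pow_le_pow_of_le_one hδ0.le hδ1.le (by omega)) hρ0.le)
        calc δ ^ j = 1 * δ ^ j := (one_mul _).symm
          _ ≤ ρ * δ ^ i * δ ^ j := mul_le_mul_of_nonneg_right h1 (by positivity)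
          _ = ρ * δ ^ k := by rw [mul_assoc, ← pow_add, hij]
      have hαi : α * α⁻¹ ^ q ^ i ≤ α⁻¹ := by
        have h2 : 2 ≤ q ^ i := one_lt_card_pow hi
        calc α * α⁻¹ ^ q ^ i ≤ α * α⁻¹ ^ 2 := by
              refine mul_le_mul_of_nonneg_left ?_ hα0.le
              exact pow_le_pow_of_le_one (by positivity) (inv_le_one_of_one_le₀ hα1) h2
          _ = α⁻¹ := by field_simp
      calc ‖algebraMap F (CInfty Fq) (A i a x)‖ *
            ‖algebraMap F (CInfty Fq) (G.expCoeff j x b)‖ ^ q ^ i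
          ≤ α * (α⁻¹ * (α * δ ^ j) ^ q ^ j) ^ q ^ i := by
            refine mul_le_mul (hα i a x) (pow_le_pow_left₀ (norm_nonneg _) hB' _) (by positivity)
              hα0.le
        _ = (α * α⁻¹ ^ q ^ i) * (α * δ ^ j) ^ q ^ k := by
            rw [mul_pow, ← pow_mul, ← pow_add, add_comm j i, hij, mul_assoc]
        _ ≤ α⁻¹ * (α * (ρ * δ ^ k)) ^ q ^ k := by
            refine mul_le_mul hαi (pow_le_pow_left₀ (by positivity) ?_ _) (by positivity)
              (by positivity)
            exact mul_le_mul_of_nonneg_left hδj hα0.le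
    rw [← hrec, map_mul, norm_mul, hnorm, ← mul_assoc, mul_comm α ρ, mul_assoc ρ, mul_pow ρ,
      mul_left_comm] at hsum
    have := le_of_mul_le_mul_left hsum (by positivity)
    rwa [le_inv_mul_iff₀ hα0] at this
  refine ⟨α, δ, hα1, hδ0, hδ1, fun k i j => le_trans ?_ (key k i j)⟩
  exact le_mul_of_one_le_left (norm_nonneg _) hα1

end ExponentialCoefficients

/-! ### Convergence and functional equation of the exponential -/

section Exponential
open Filter Topology
variable {Fq : Type*} [Field Fq] [Fintype Fq] {F : Type*} [Field F] [Algebra Fq F] [PerfectField F]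
  [Algebra F (CInfty Fq)]

/-- The `q^k`-power Frobenius on coordinate vectors, `z ↦ z^(k)`. -/
def vecFrob (Fq : Type*) [Field Fq] [Fintype Fq] (ι : Type*) (k : ℕ) :
    (ι → CInfty Fq) →+ (ι → CInfty Fq) where
  toFun z i := frobZ Fq (CInfty Fq) k (z i)
  map_zero' := by ext; simp
  map_add' x y := by ext; simp

theorem vecFrob_apply {ι : Type*} (k : ℕ) (z : ι → CInfty Fq) (i : ι) :
    vecFrob Fq ι k z i = z i ^ Fintype.card Fq ^ k := frobZ_natCast_apply _ _ _ _

theorem continuous_vecFrob (ι : Type*) (k : ℕ) : Continuous (vecFrob Fq ι k) := by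
  refine continuous_pi fun i => ?_
  simp only [vecFrob_apply]
  fun_prop

theorem vecFrob_vecFrob {ι : Type*} (a b : ℕ) (z : ι → CInfty Fq) :
    vecFrob Fq ι a (vecFrob Fq ι b z) = vecFrob Fq ι (a + b) z := by
  ext i
  simp only [vecFrob_apply, ← pow_mul, ← pow_add, add_comm a b]

theorem vecFrob_mulVec {κ ι : Type*} [Fintype ι] (M : Matrix κ ι F) (a : ℕ) (z : ι → CInfty Fq) :
    vecFrob Fq κ a (M.map (algebraMap F (CInfty Fq)) *ᵥ z) =
      (M.map (frobZ Fq F a)).map (algebraMap F (CInfty Fq)) *ᵥ vecFrob Fq ι a z := by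
  ext i
  change frobZ Fq (CInfty Fq) a _ = _
  simp only [Matrix.mulVec, dotProduct, map_sum, map_mul, Matrix.map_apply,
    algebraMap_frobZ_natCast, vecFrob_apply]
  simp only [frobZ_natCast_apply]

variable {θ : F} {ι : Type*} [Fintype ι] [DecidableEq ι] (G : TModule Fq θ ι)

namespace TModule

/-- The `k`-th term `B_k z^(k)` of the exponential series. -/
def expTerm (z : ι → CInfty Fq) (k : ℕ) : ι → CInfty Fq :=
  (G.expCoeff k).map (algebraMap F (CInfty Fq)) *ᵥ vecFrob Fq ι k z

theorem exp_eq_tsum (z : ι → CInfty Fq) : G.exp z = ∑' k, G.expTerm z k := by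
  rw [TModule.exp]
  congr 1
  funext k
  rw [expTerm]
  congr 1
  funext i
  exact (vecFrob_apply _ _ _).symm

theorem norm_expTerm_le {K δ : ℝ} (hK : 1 ≤ K) (hδ0 : 0 < δ)
    (h : ∀ k i j, ‖algebraMap F (CInfty Fq) (G.expCoeff k i j)‖ ≤
      (K * δ ^ k) ^ Fintype.card Fq ^ k) (z : ι → CInfty Fq) (k : ℕ) (i : ι) :
    ‖G.expTerm z k i‖ ≤ (K * δ ^ k * ‖z‖) ^ Fintype.card Fq ^ k := by
  have h0 : 0 ≤ (K * δ ^ k * ‖z‖) ^ Fintype.card Fq ^ k := by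
    have := norm_nonneg z
    positivity
  refine IsUltrametricDist.norm_sum_le_of_forall_le_of_nonneg h0 fun j _ => ?_
  rw [norm_mul, mul_pow, vecFrob_apply, norm_pow]
  refine mul_le_mul (h k i j) ?_ (by positivity) (by positivity)
  exact pow_le_pow_left₀ (norm_nonneg _) (norm_le_pi_norm z j) _

variable (hθ : algebraMap F (CInfty Fq) θ = CInfty.theta Fq)
include hθ

theorem hasSum_expTerm (z : ι → CInfty Fq) : HasSum (G.expTerm z) (G.exp z) := by
  rw [exp_eq_tsum]
  refine Summable.hasSum (Pi.summable.2 fun i => ?_)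
  obtain ⟨K, δ, hK, hδ0, hδ1, h⟩ := G.norm_expCoeff_le hθ
  refine NonarchimedeanAddGroup.summable_of_tendsto_cofinite_zero ?_
  rw [Nat.cofinite_eq_atTop, tendsto_zero_iff_norm_tendsto_zero]
  have h1 : Tendsto (fun k : ℕ => K * δ ^ k * ‖z‖) atTop (𝓝 0) := by
    simpa using ((tendsto_pow_atTop_nhds_zero_of_lt_one hδ0.le hδ1).const_mul K).mul_const ‖z‖
  refine tendsto_of_tendsto_of_tendsto_of_le_of_le' tendsto_const_nhds h1
    (Eventually.of_forall fun k => norm_nonneg _) ?_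
  filter_upwards [h1.eventually (ge_mem_nhds one_pos)] with k hk
  refine (G.norm_expTerm_le hK hδ0 h z k i).trans ?_
  have := norm_nonneg z
  exact pow_le_of_le_one (by positivity) hk (card_pow_ne_zero k)

theorem norm_exp_le : ∃ K : ℝ, 1 ≤ K ∧ ∀ z : ι → CInfty Fq, K * ‖z‖ ≤ 1 → ‖G.exp z‖ ≤ K * ‖z‖ := by
  obtain ⟨K, δ, hK, hδ0, hδ1, h⟩ := G.norm_expCoeff_le hθ
  refine ⟨K, hK, fun z hz => ?_⟩
  have hz0 := norm_nonneg z
  refine (pi_norm_le_iff_of_nonneg (by positivity)).2 fun i => ?_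
  have hs := Pi.hasSum.1 (G.hasSum_expTerm hθ z) i
  rw [← hs.tsum_eq]
  refine IsUltrametricDist.norm_tsum_le_of_forall_le_of_nonneg (by positivity) fun k => ?_
  refine (G.norm_expTerm_le hK hδ0 h z k i).trans ?_
  have h1 : K * δ ^ k * ‖z‖ ≤ K * ‖z‖ := by
    have : δ ^ k ≤ 1 := pow_le_one₀ hδ0.le hδ1.le
    nlinarith [mul_nonneg (by linarith : (0:ℝ) ≤ K) hz0]
  exact (pow_le_of_le_one (by positivity) (h1.trans hz) (card_pow_ne_zero k)).trans h1

theorem tendsto_exp {z : ℕ → ι → CInfty Fq} (hz : Tendsto z atTop (𝓝 0)) :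
    Tendsto (fun i => G.exp (z i)) atTop (𝓝 0) := by
  obtain ⟨K, hK, h⟩ := G.norm_exp_le hθ
  rw [tendsto_zero_iff_norm_tendsto_zero] at hz ⊢
  have h1 : Tendsto (fun i => K * ‖z i‖) atTop (𝓝 0) := by simpa using hz.const_mul K
  refine tendsto_of_tendsto_of_tendsto_of_le_of_le' tendsto_const_nhds h1
    (Eventually.of_forall fun k => norm_nonneg _) ?_
  filter_upwards [h1.eventually (ge_mem_nhds one_pos)] with k hk using h _ hk

theorem exp_add (x y : ι → CInfty Fq) : G.exp (x + y) = G.exp x + G.exp y := by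
  have h := (G.hasSum_expTerm hθ x).add (G.hasSum_expTerm hθ y)
  refine (G.hasSum_expTerm hθ (x + y)).unique ?_
  convert h using 2 with k
  simp [expTerm, Matrix.mulVec_add]

theorem exp_smul (c : Fq) (x : ι → CInfty Fq) : G.exp (c • x) = c • G.exp x := by
  have h := (G.hasSum_expTerm hθ x).const_smul (algebraMap Fq (CInfty Fq) c)
  have e : c • G.exp x = algebraMap Fq (CInfty Fq) c • G.exp x := (algebraMap_smul _ _ _).symm
  rw [e]
  refine (G.hasSum_expTerm hθ (c • x)).unique ?_
  convert h using 2 with k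
  have : vecFrob Fq ι k (c • x) = algebraMap Fq (CInfty Fq) c • vecFrob Fq ι k x := by
    ext i
    change frobZ Fq (CInfty Fq) k (c • x i) = algebraMap Fq (CInfty Fq) c * frobZ Fq _ k (x i)
    rw [map_smul, Algebra.smul_def]
  rw [expTerm, expTerm, this, Matrix.mulVec_smul]

/-- The functional equation of the exponential: `φ_t(Exp z) = Exp(dφ_t z)`. -/
theorem sum_coeffMat_exp (z : ι → CInfty Fq) {L : ℕ} (hL : ∀ i, L ≤ i → G.coeffMat i = 0) :
    ∑ i ∈ Finset.range L, (G.coeffMat i).map (algebraMap F (CInfty Fq)) *ᵥ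
      vecFrob Fq ι i (G.exp z) = G.exp (G.lieT *ᵥ z) := by
  set T : ℕ → ℕ → ι → CInfty Fq := fun i k =>
    (G.coeffMat i * (G.expCoeff k).map (frobZ Fq F i)).map (algebraMap F (CInfty Fq)) *ᵥ
      vecFrob Fq ι (i + k) z with hT
  have h1 : ∀ i, HasSum (T i) ((G.coeffMat i).map (algebraMap F (CInfty Fq)) *ᵥ
      vecFrob Fq ι i (G.exp z)) := by
    intro i
    have h := (G.hasSum_expTerm hθ z).map (vecFrob Fq ι i) (continuous_vecFrob ι i)
    have h' := h.map ((G.coeffMat i).map (algebraMap F (CInfty Fq))).mulVecLin.toAddMonoidHom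
      (Continuous.matrix_mulVec continuous_const continuous_id)
    have e : ∀ k, T i k = (G.coeffMat i).map (algebraMap F (CInfty Fq)) *ᵥ
        vecFrob Fq ι i (G.expTerm z k) := fun k => by
      rw [expTerm, vecFrob_mulVec, vecFrob_vecFrob, Matrix.mulVec_mulVec, ← Matrix.map_mul]
    rw [show T i = _ from funext e]
    exact h'
  have h2 : ∀ i, HasSum (fun n => if i ≤ n then T i (n - i) else 0)
      ((G.coeffMat i).map (algebraMap F (CInfty Fq)) *ᵥ vecFrob Fq ι i (G.exp z)) := by
    intro i
    refine ((add_left_injective i).hasSum_iff ?_).1 ?_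
    · intro n hn
      rw [if_neg]
      intro hin
      exact hn ⟨n - i, Nat.sub_add_cancel hin⟩
    · have e : (fun n => if i ≤ n then T i (n - i) else 0) ∘ (fun k => k + i) = T i := by
        funext k
        simp
      rw [e]
      exact h1 i
  have h3 := hasSum_sum (fun i (_ : i ∈ Finset.range L) => h2 i)
  refine h3.unique ?_
  convert G.hasSum_expTerm hθ (G.lieT *ᵥ z) using 2 with n
  have h4 : G.expTerm (G.lieT *ᵥ z) n =
      (G.expCoeff n * (G.coeffMat 0).map (frobZ Fq F n)).map (algebraMap F (CInfty Fq)) *ᵥ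
        vecFrob Fq ι n z := by
    rw [expTerm, TModule.lieT, vecFrob_mulVec, Matrix.mulVec_mulVec]
    simp [Matrix.map_mul]
  rw [h4, ← twistedConv_constSeq, ← G.twistedConv_expCoeff hθ, twistedConv,
    Finset.Nat.sum_antidiagonal_eq_sum_range_succ
      (fun i k => G.coeffMat i * (G.expCoeff k).map (frobZ Fq F i))]
  have h5 : (∑ i ∈ Finset.range n.succ, G.coeffMat i *
      (G.expCoeff (n - i)).map (frobZ Fq F i)).map (algebraMap F (CInfty Fq)) *ᵥ vecFrob Fq ι n z =
      ∑ i ∈ Finset.range n.succ, T i (n - i) := by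
    have : ∀ i ∈ Finset.range n.succ, T i (n - i) =
        (G.coeffMat i * (G.expCoeff (n - i)).map (frobZ Fq F i)).map
          (algebraMap F (CInfty Fq)) *ᵥ vecFrob Fq ι n z := by
      intro i hi
      simp only [Finset.mem_range] at hi
      simp only [hT]
      rw [Nat.add_sub_cancel' (by omega)]
    rw [Finset.sum_congr rfl this, ← Matrix.sum_mulVec]
    congr 1
    ext a b
    simp only [Matrix.map_apply, Matrix.sum_apply, map_sum]
  rw [h5]
  have h6 : ∀ i, L ≤ i → ∀ k, T i k = 0 := fun i hi k => by simp [hT, hL i hi]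
  rw [← Finset.sum_filter]
  refine Finset.sum_subset_zero_on_sdiff ?_ ?_ ?_
  · intro i hi
    simp only [Finset.mem_filter, Finset.mem_range] at hi ⊢
    omega
  · intro i hi
    simp only [Finset.mem_sdiff, Finset.mem_filter, Finset.mem_range, not_and] at hi
    exact h6 i (by omega) _
  · intro i _
    rfl

end TModule
end Exponential

/-! ### Twisted polynomials as additive maps -/

section Evaluation
variable {Fq : Type*} [Field Fq] [Fintype Fq] {F : Type*} [Field F] [Algebra Fq F] [PerfectField F]
  [Algebra F (CInfty Fq)]

theorem TwistedPoly.induction_monomial {motive : TauPoly Fq F → Prop} (zero : motive 0)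
    (add : ∀ a b, motive a → motive b → motive (a + b))
    (monomial : ∀ n x, motive (TwistedPoly.monomial _ n x)) (a : TauPoly Fq F) : motive a := by
  refine SkewPolynomial.induction (R := F) (motive := motive) a zero ?_
  intro n r p _ _ hp
  exact add _ _ (monomial n r) hp

/-- The additive map `x ↦ ∑ b_i x^(q^i)` of `C_∞` defined by `b = ∑ b_i τ^i`. -/
def evalTau (b : TauPoly Fq F) : CInfty Fq →+ CInfty Fq where
  toFun x := ∑ i ∈ b.support, algebraMap F (CInfty Fq) (b.coeff i) * frobZ Fq (CInfty Fq) i x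
  map_zero' := by simp
  map_add' x y := by simp [mul_add, Finset.sum_add_distrib]

theorem evalTau_eq_sum (b : TauPoly Fq F) (s : Finset ℕ) (hs : ∀ i ∉ s, b.coeff i = 0)
    (x : CInfty Fq) : evalTau b x =
      ∑ i ∈ s, algebraMap F (CInfty Fq) (b.coeff i) * frobZ Fq (CInfty Fq) i x := by
  refine Finset.sum_subset ?_ ?_
  · intro i hi
    by_contra h
    exact (TwistedPoly.mem_support _ _).1 hi (hs i h)
  · intro i _ hi
    rw [TwistedPoly.mem_support, not_not] at hi
    rw [hi, map_zero, zero_mul]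

theorem evalTau_zero (x : CInfty Fq) : evalTau (0 : TauPoly Fq F) x = 0 := by
  rw [evalTau_eq_sum 0 ∅ fun _ _ => rfl, Finset.sum_empty]

theorem evalTau_add (a b : TauPoly Fq F) (x : CInfty Fq) :
    evalTau (a + b) x = evalTau a x + evalTau b x := by
  classical
  have h : ∀ c : TauPoly Fq F, c.support ⊆ a.support ∪ b.support →
      ∀ i ∉ a.support ∪ b.support, c.coeff i = 0 := fun c hc i hi => by
    by_contra h0
    exact hi (hc ((TwistedPoly.mem_support _ _).2 h0))
  rw [evalTau_eq_sum a _ (h a Finset.subset_union_left),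
    evalTau_eq_sum b _ (h b Finset.subset_union_right),
    evalTau_eq_sum (a + b) (a.support ∪ b.support), ← Finset.sum_add_distrib]
  · exact Finset.sum_congr rfl fun i _ => by rw [TwistedPoly.coeff_add, map_add, add_mul]
  · intro i hi
    rw [TwistedPoly.coeff_add, h a Finset.subset_union_left i hi,
      h b Finset.subset_union_right i hi, add_zero]

theorem evalTau_monomial (n : ℕ) (c : F) (x : CInfty Fq) :
    evalTau (TwistedPoly.monomial (frob Fq F) n c) x =
      algebraMap F (CInfty Fq) c * frobZ Fq (CInfty Fq) n x := by
  rw [evalTau_eq_sum _ {n}, Finset.sum_singleton, TwistedPoly.coeff_monomial, if_pos rfl]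
  intro i hi
  rw [TwistedPoly.coeff_monomial, if_neg]
  rintro rfl
  simp at hi

theorem evalTau_sum {σ : Type*} (s : Finset σ) (b : σ → TauPoly Fq F) (x : CInfty Fq) :
    evalTau (∑ i ∈ s, b i) x = ∑ i ∈ s, evalTau (b i) x :=
  map_sum (⟨⟨fun b => evalTau b x, evalTau_zero x⟩, fun a b => evalTau_add a b x⟩ :
    TauPoly Fq F →+ CInfty Fq) b s

theorem evalTau_mul (a b : TauPoly Fq F) (x : CInfty Fq) :
    evalTau (a * b) x = evalTau a (evalTau b x) := by
  induction a using TwistedPoly.induction_monomial with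
  | zero => rw [zero_mul, evalTau_zero, evalTau_zero]
  | add a a' h h' => rw [add_mul, evalTau_add, evalTau_add, h, h']
  | monomial i c =>
    induction b using TwistedPoly.induction_monomial with
    | zero => rw [mul_zero, evalTau_zero, map_zero]
    | add b b' h h' => rw [mul_add, evalTau_add, evalTau_add, h, h', map_add]
    | monomial j e =>
      rw [TwistedPoly.monomial_mul_monomial, evalTau_monomial, evalTau_monomial, evalTau_monomial,
        frob_pow_eq_frobZ, map_mul, map_mul, algebraMap_frobZ_natCast,
        ← frobZ_natCast_apply Fq (CInfty Fq), Nat.cast_add, frobZ_add_apply, mul_assoc]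

theorem evalTau_smul (c : F) (b : TauPoly Fq F) (x : CInfty Fq) :
    evalTau (c • b) x = algebraMap F (CInfty Fq) c * evalTau b x := by
  rw [evalTau_eq_sum (c • b) b.support, evalTau_eq_sum b b.support, Finset.mul_sum]
  · exact Finset.sum_congr rfl fun i _ => by rw [TwistedPoly.coeff_smul, map_mul, mul_assoc]
  · intro i hi
    rwa [TwistedPoly.mem_support, not_not] at hi
  · intro i hi
    rw [TwistedPoly.mem_support, not_not] at hi
    rw [TwistedPoly.coeff_smul, hi, mul_zero]

theorem evalTau_one (x : CInfty Fq) : evalTau (1 : TauPoly Fq F) x = x := by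
  have : (1 : TauPoly Fq F) = TwistedPoly.monomial _ 0 1 := (map_one (TwistedPoly.C (frob Fq F))).symm
  rw [this, evalTau_monomial, map_one, one_mul, Nat.cast_zero, frobZ_zero_apply]

theorem evalTau_X (x : CInfty Fq) :
    evalTau (TwistedPoly.X (frob Fq F)) x = frobZ Fq (CInfty Fq) 1 x := by
  rw [TwistedPoly.X, evalTau_monomial, map_one, one_mul, Nat.cast_one]

end Evaluation

/-! ### The pairing of the `t`-motive with columns of power series -/

section Pairing
variable {Fq : Type*} [Field Fq] [Fintype Fq] {F : Type*} [Field F] [Algebra Fq F] [PerfectField F]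
  [Algebra F (CInfty Fq)] {ι : Type*} [Fintype ι]

theorem coeff_pairing (b : ι → TauPoly Fq F) (f : ι → (CInfty Fq)⟦X⟧) (n : ℕ) :
    PowerSeries.coeff n (pairing b f) = ∑ k, evalTau (b k) (PowerSeries.coeff n (f k)) := by
  simp only [pairing, map_sum, PowerSeries.coeff_C_mul, coeff_twist]
  rfl

theorem pairing_mem_tate (b : ι → TauPoly Fq F) {f : ι → (CInfty Fq)⟦X⟧}
    (hf : ∀ k, f k ∈ Tate Fq) : pairing b f ∈ Tate Fq :=
  sum_mem fun k _ => sum_mem fun i _ =>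
    mul_mem (C_mem_tate _) (twist_natCast_mem_tate i (hf k))

theorem pairing_add (a b : ι → TauPoly Fq F) (f : ι → (CInfty Fq)⟦X⟧) :
    pairing (a + b) f = pairing a f + pairing b f := by
  ext n
  simp only [map_add, coeff_pairing, Pi.add_apply, evalTau_add, Finset.sum_add_distrib]

theorem pairing_zero (f : ι → (CInfty Fq)⟦X⟧) : pairing (0 : ι → TauPoly Fq F) f = 0 := by
  ext n
  simp [coeff_pairing, evalTau_zero]

theorem pairing_smul (c : F) (b : ι → TauPoly Fq F) (f : ι → (CInfty Fq)⟦X⟧) :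
    pairing (c • b) f = PowerSeries.C (algebraMap F (CInfty Fq) c) * pairing b f := by
  ext n
  simp only [PowerSeries.coeff_C_mul, coeff_pairing, Pi.smul_apply, evalTau_smul, Finset.mul_sum]

theorem pairing_X_mul (b : ι → TauPoly Fq F) (f : ι → (CInfty Fq)⟦X⟧) :
    pairing (fun k => TwistedPoly.X _ * b k) f = twist 1 (pairing b f) := by
  ext n
  simp only [coeff_twist, coeff_pairing, evalTau_mul, evalTau_X, map_sum]

theorem pairing_single [DecidableEq ι] (k : ι) (f : ι → (CInfty Fq)⟦X⟧) :
    pairing (Pi.single k (1 : TauPoly Fq F)) f = f k := by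
  ext n
  rw [coeff_pairing, Finset.sum_eq_single k]
  · rw [Pi.single_eq_same, evalTau_one]
  · intro j _ hj
    rw [Pi.single_eq_of_ne hj, evalTau_zero]
  · simp

variable {θ : F} [DecidableEq ι] (G : TModule Fq θ ι)

/-- A column `f` of power series with `φ_t f = t f`, where `F[τ]` acts on the coefficients. -/
def TModule.IsEigenColumn (f : ι → (CInfty Fq)⟦X⟧) : Prop :=
  ∀ k, pairing (G.phiT k) f = PowerSeries.X * f k

variable {G} {f : ι → (CInfty Fq)⟦X⟧}

theorem pairing_vecMul_phiT (hf : G.IsEigenColumn f) (x : ι → TauPoly Fq F) :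
    pairing (x ᵥ* G.phiT) f = PowerSeries.X * pairing x f := by
  ext n
  have h1 : PowerSeries.coeff n (pairing (x ᵥ* G.phiT) f) =
      ∑ k, evalTau (x k) (PowerSeries.coeff n (pairing (G.phiT k) f)) := by
    simp only [coeff_pairing, Matrix.vecMul, dotProduct, evalTau_sum, evalTau_mul, map_sum]
    rw [Finset.sum_comm]
  rw [h1]
  simp only [hf _]
  cases n with
  | zero => simp
  | succ n => simp only [PowerSeries.coeff_succ_X_mul, coeff_pairing]

theorem pairing_aeval (hf : G.IsEigenColumn f) (p : F[X]) (x : ι → TauPoly Fq F) :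
    pairing (Polynomial.aeval G.motiveT p x) f = toPS Fq F p * pairing x f := by
  induction p using Polynomial.induction_on' generalizing x with
  | add p r hp hr => rw [map_add, LinearMap.add_apply, pairing_add, hp, hr, map_add, add_mul]
  | monomial n a =>
    induction n generalizing x with
    | zero =>
      rw [Polynomial.monomial_zero_left, Polynomial.aeval_C, Module.algebraMap_end_apply,
        pairing_smul, toPS_C]
    | succ n ih =>
      have h : Polynomial.aeval G.motiveT (Polynomial.monomial (n + 1) a) x =
          Polynomial.aeval G.motiveT (Polynomial.monomial n a) (G.motiveT x) := by
        rw [← Polynomial.monomial_mul_X, map_mul, Polynomial.aeval_X, Module.End.mul_apply]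
      have h2 : G.motiveT x = x ᵥ* G.phiT := rfl
      rw [h, ih, h2, pairing_vecMul_phiT hf, ← Polynomial.monomial_mul_X, map_mul, toPS_X, mul_assoc]

theorem pairing_ofMotive_smul (hf : G.IsEigenColumn f) (p : F[X]) (x : G.Motive) :
    pairing (G.ofMotive (p • x)) f = toPS Fq F p * pairing (G.ofMotive x) f := by
  have : G.ofMotive (p • x) = Polynomial.aeval G.motiveT p (G.ofMotive x) := rfl
  rw [this, pairing_aeval hf]

theorem pairing_ofMotive_sum {σ : Type*} (s : Finset σ) (x : σ → G.Motive) :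
    pairing (G.ofMotive (∑ i ∈ s, x i)) f = ∑ i ∈ s, pairing (G.ofMotive (x i)) f :=
  map_sum (⟨⟨fun x => pairing (G.ofMotive x) f, pairing_zero f⟩,
    fun _ _ => pairing_add _ _ f⟩ : G.Motive →+ (CInfty Fq)⟦X⟧) x s

theorem pairing_tau (x : G.Motive) :
    pairing (G.ofMotive (G.tau x)) f = twist 1 (pairing (G.ofMotive x) f) :=
  pairing_X_mul _ _

theorem twist_one_pairing_of_isMotiveFrame (hf : G.IsEigenColumn f) {κ : Type*} [Fintype κ]
    {m : κ → G.Motive} {M : Matrix κ κ F[X]} (hM : G.IsMotiveFrame m M) (i : κ) :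
    twist 1 (pairing (G.ofMotive (m i)) f) =
      ∑ j, toPS Fq F (M i j) * pairing (G.ofMotive (m j)) f := by
  rw [← pairing_tau, hM i, pairing_ofMotive_sum]
  exact Finset.sum_congr rfl fun j _ => pairing_ofMotive_smul hf _ _

end Pairing

/-! ### Anderson generating functions -/

section GeneratingFunctions
open Filter Topology
variable {Fq : Type*} [Field Fq] [Fintype Fq] {F : Type*} [Field F] [Algebra Fq F] [PerfectField F]
  [Algebra F (CInfty Fq)] {θ : F} {ι : Type*} [Fintype ι] [DecidableEq ι] (G : TModule Fq θ ι)
  (hθ : algebraMap F (CInfty Fq) θ = CInfty.theta Fq)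

theorem CInfty.theta_ne_zero : CInfty.theta Fq ≠ 0 := by
  rw [← norm_ne_zero_iff, CInfty.norm_theta]
  exact_mod_cast Fintype.card_ne_zero

namespace TModule
include hθ

theorem exists_lieT_pow : ∃ s : ℕ, s ≠ 0 ∧
    G.lieT ^ s = Matrix.scalar ι (CInfty.theta Fq ^ s) := by
  obtain ⟨s, hs, h⟩ := G.exists_coeffMat_pow
  refine ⟨s, hs, ?_⟩
  have h1 : G.lieT ^ s = (G.coeffMat 0 ^ s).map (algebraMap F (CInfty Fq)) :=
    (map_pow (algebraMap F (CInfty Fq)).mapMatrix (G.coeffMat 0) s).symm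
  rw [h1, h]
  ext i j
  by_cases hij : i = j <;> simp [hij, hθ]

theorem isUnit_det_lieT : IsUnit G.lieT.det := by
  obtain ⟨s, hs, h⟩ := G.exists_lieT_pow hθ
  rw [← Matrix.isUnit_iff_isUnit_det]
  refine (isUnit_pow_iff hs).1 ?_
  rw [h]
  exact ((CInfty.theta_ne_zero.isUnit).pow s).map _

theorem lieT_mulVec_inv_pow (n : ℕ) (y : ι → CInfty Fq) :
    G.lieT *ᵥ (G.lieT⁻¹ ^ (n + 1) *ᵥ y) = G.lieT⁻¹ ^ n *ᵥ y := by
  rw [Matrix.mulVec_mulVec, pow_succ', ← Matrix.mul_assoc,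
    Matrix.mul_nonsing_inv _ (G.isUnit_det_lieT hθ), Matrix.one_mul]

theorem tendsto_lieT_inv_pow (y : ι → CInfty Fq) :
    Tendsto (fun n => G.lieT⁻¹ ^ n *ᵥ y) atTop (𝓝 0) := by
  obtain ⟨s, hs, h⟩ := G.exists_lieT_pow hθ
  have hs0 : 0 < s := Nat.pos_of_ne_zero hs
  set c : ℝ := ((Fintype.card Fq : ℝ) ^ s)⁻¹ with hc
  have hc0 : 0 ≤ c := by positivity
  have hc1 : c < 1 := inv_lt_one_of_one_lt₀ (one_lt_pow₀ (one_lt_card_real (Fq := Fq)) hs)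
  have hstep : ∀ n, ‖G.lieT⁻¹ ^ (n + s) *ᵥ y‖ = c * ‖G.lieT⁻¹ ^ n *ᵥ y‖ := by
    intro n
    have h1 : CInfty.theta Fq ^ s • (G.lieT⁻¹ ^ (n + s) *ᵥ y) = G.lieT⁻¹ ^ n *ᵥ y := by
      have h2 : G.lieT ^ s * G.lieT⁻¹ ^ (n + s) = G.lieT⁻¹ ^ n := by
        rw [add_comm, pow_add, ← Matrix.mul_assoc, ← (Commute.mul_pow _ s),
          Matrix.mul_nonsing_inv _ (G.isUnit_det_lieT hθ), one_pow, Matrix.one_mul]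
        rw [Commute, SemiconjBy, Matrix.mul_nonsing_inv _ (G.isUnit_det_lieT hθ),
          Matrix.nonsing_inv_mul _ (G.isUnit_det_lieT hθ)]
      rw [← h2, h, ← Matrix.mulVec_mulVec]
      ext i
      simp [Matrix.mulVec_diagonal]
    rw [← h1, norm_smul, norm_pow, CInfty.norm_theta, ← mul_assoc, hc, inv_mul_cancel₀, one_mul]
    have := one_lt_card_real (Fq := Fq)
    positivity
  have hblock : ∀ k r, ‖G.lieT⁻¹ ^ (r + s * k) *ᵥ y‖ = c ^ k * ‖G.lieT⁻¹ ^ r *ᵥ y‖ := by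
    intro k r
    induction k with
    | zero => simp
    | succ k ih => rw [Nat.mul_succ, ← Nat.add_assoc, hstep, ih, pow_succ']; ring
  set B : ℝ := ∑ r ∈ Finset.range s, ‖G.lieT⁻¹ ^ r *ᵥ y‖ with hB
  have hbound : ∀ n, ‖G.lieT⁻¹ ^ n *ᵥ y‖ ≤ c ^ (n / s) * B := by
    intro n
    conv_lhs => rw [← Nat.mod_add_div n s]
    rw [hblock]
    refine mul_le_mul_of_nonneg_left ?_ (by positivity)
    exact Finset.single_le_sum (f := fun r => ‖G.lieT⁻¹ ^ r *ᵥ y‖) (fun _ _ => norm_nonneg _)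
      (Finset.mem_range.2 (Nat.mod_lt n hs0))
  rw [tendsto_zero_iff_norm_tendsto_zero]
  refine squeeze_zero (fun _ => norm_nonneg _) hbound ?_
  have h2 := (tendsto_pow_atTop_nhds_zero_of_lt_one hc0 hc1).comp
    (Nat.tendsto_div_const_atTop hs)
  simpa using h2.mul_const B

theorem agf_mem_tate (y : ι → CInfty Fq) (k : ι) : G.agf y k ∈ Tate Fq := by
  rw [mem_tate_iff]
  have h1 := G.tendsto_exp hθ
    ((G.tendsto_lieT_inv_pow hθ y).comp (tendsto_add_atTop_nat 1))
  have h2 := (tendsto_pi_nhds.1 h1) k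
  simpa [TModule.agf] using h2

theorem sum_evalTau_exp (z : ι → CInfty Fq) (k : ι) :
    ∑ j, evalTau (G.phiT k j) (G.exp z j) = G.exp (G.lieT *ᵥ z) k := by
  obtain ⟨L, hL⟩ := exists_coeffSeq_eq_zero G.phiT
  rw [← G.sum_coeffMat_exp hθ z hL, Finset.sum_apply]
  simp only [Matrix.mulVec, dotProduct]
  rw [Finset.sum_comm]
  refine Finset.sum_congr rfl fun j _ => ?_
  rw [evalTau_eq_sum _ (Finset.range L)]
  · rfl
  · intro i hi
    rw [Finset.mem_range, not_lt] at hi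
    exact congrFun (congrFun (hL i hi) k) j

/-- `φ_t 𝒢_y = t 𝒢_y + Exp(y)`; so the generating function of a period is an eigencolumn. -/
theorem pairing_phiT_agf (y : ι → CInfty Fq) (k : ι) :
    pairing (G.phiT k) (G.agf y) = PowerSeries.X * G.agf y k + PowerSeries.C (G.exp y k) := by
  ext n
  rw [coeff_pairing]
  simp only [TModule.agf, PowerSeries.coeff_mk]
  rw [G.sum_evalTau_exp hθ, G.lieT_mulVec_inv_pow hθ]
  cases n with
  | zero => simp
  | succ n => simp [PowerSeries.coeff_succ_X_mul]

theorem isEigenColumn_agf {y : ι → CInfty Fq} (hy : G.exp y = 0) : G.IsEigenColumn (G.agf y) := by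
  intro k
  rw [G.pairing_phiT_agf hθ, hy, Pi.zero_apply, map_zero, add_zero]

end TModule
end GeneratingFunctions

/-! ### Estimates in the Tate algebra -/

section TateEstimates
open Filter Topology
variable {Fq : Type*} [Field Fq] [Fintype Fq]

/-- The coefficients of the inverse of `1 + ∑ f_i t^i` decay as fast as the `f_i`. -/
theorem norm_coeff_inv_le {f : (CInfty Fq)⟦X⟧} (h0 : PowerSeries.constantCoeff f = 1) {ρ : ℝ}
    (hρ : 0 ≤ ρ) (h : ∀ i, ‖PowerSeries.coeff i f‖ ≤ ρ ^ i) (i : ℕ) :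
    ‖PowerSeries.coeff i f⁻¹‖ ≤ ρ ^ i := by
  induction i using Nat.strong_induction_on with
  | _ i ih =>
  rw [PowerSeries.coeff_inv]
  split_ifs with hi
  · subst hi
    simp [h0]
  · rw [h0, inv_one, norm_mul, norm_neg, norm_one, one_mul]
    refine IsUltrametricDist.norm_sum_le_of_forall_le_of_nonneg (pow_nonneg hρ _) ?_
    rintro ⟨a, b⟩ hab
    rw [Finset.HasAntidiagonal.mem_antidiagonal] at hab
    simp only at hab ⊢
    split_ifs with hb
    · rw [norm_mul, ← hab, pow_add]
      exact mul_le_mul (h a) (ih b hb) (norm_nonneg _) (pow_nonneg hρ _)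
    · simpa using pow_nonneg hρ i

/-- A series in the Tate algebra whose product with a nonzero `p ∈ F_q[t]` is a polynomial of degree
less than `deg p` vanishes. -/
theorem eq_zero_of_coeff_toPS_mul {p : Fq[X]} (hp : p ≠ 0) {D : (CInfty Fq)⟦X⟧} (hD : D ∈ Tate Fq)
    (h : ∀ k, p.natDegree ≤ k → PowerSeries.coeff k (toPS Fq Fq p * D) = 0) : D = 0 := by
  -- comparing coefficients in degree `m + deg p` bounds `D_m` by the later coefficients
  have hstep : ∀ ε : ℝ, 0 ≤ ε → ∀ m, (∀ i, m < i → ‖PowerSeries.coeff i D‖ ≤ ε) →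
      ‖PowerSeries.coeff m D‖ ≤ ε := by
    intro ε hε m hm
    have h1 := h (p.natDegree + m) (Nat.le_add_right _ _)
    rw [PowerSeries.coeff_mul, ← Finset.add_sum_erase _ _
      (show (p.natDegree, m) ∈ Finset.HasAntidiagonal.antidiagonal (p.natDegree + m) by simp),
      add_eq_zero_iff_eq_neg] at h1
    have h2 := congrArg norm h1
    rw [norm_mul, coeff_toPS, norm_algebraMap_base (by simpa using hp), one_mul, norm_neg] at h2
    rw [h2]
    refine IsUltrametricDist.norm_sum_le_of_forall_le_of_nonneg hε ?_
    rintro ⟨a, b⟩ hab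
    rw [Finset.mem_erase, Finset.HasAntidiagonal.mem_antidiagonal] at hab
    obtain ⟨hne, hab⟩ := hab
    simp only at hab ⊢
    rw [norm_mul, coeff_toPS]
    rcases lt_trichotomy b m with hb | hb | hb
    · rw [Polynomial.coeff_eq_zero_of_natDegree_lt (by omega), map_zero, norm_zero, zero_mul]
      exact hε
    · exact absurd (by ext <;> simp <;> omega) hne
    · calc _ ≤ 1 * ε := mul_le_mul (norm_algebraMap_base_le _) (hm b hb) (norm_nonneg _) zero_le_one
        _ = ε := one_mul ε
  ext m
  rw [map_zero, ← norm_le_zero_iff]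
  refine le_of_forall_pos_le_add fun ε hε => ?_
  rw [zero_add]
  obtain ⟨N, hN⟩ := eventually_atTop.1
    ((tendsto_norm_of_mem_tate hD).eventually (ge_mem_nhds hε))
  have hall : ∀ j i, N ≤ i + j → ‖PowerSeries.coeff i D‖ ≤ ε := by
    intro j
    induction j with
    | zero => exact fun i hi => hN i hi
    | succ j ih => exact fun i hi => hstep ε hε.le i fun k hk => ih k (by omega)
  exact hall N m (Nat.le_add_left _ _)

theorem norm_sub_pow_card {z : CInfty Fq} (hz : ‖z‖ < 1) : ‖z - z ^ Fintype.card Fq‖ = ‖z‖ := by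
  by_cases h0 : z = 0
  · simp [h0]
  have hlt : ‖z‖ ^ Fintype.card Fq < ‖z‖ :=
    pow_lt_self_of_lt_one₀ (norm_pos_iff.2 h0) hz Fintype.one_lt_card
  rw [sub_eq_add_neg, IsUltrametricDist.norm_add_eq_max_of_norm_ne_norm, norm_neg, norm_pow,
    max_eq_left hlt.le]
  rw [norm_neg, norm_pow]
  exact hlt.ne'

/-- Approximate solutions of `z = z ^ q` are close to elements of `F_q`. -/
theorem exists_norm_sub_le {z : CInfty Fq} {ε : ℝ} (hε : ε < 1)
    (hz : ‖z - z ^ Fintype.card Fq‖ ≤ ε) : ∃ a : Fq, ‖z - algebraMap Fq (CInfty Fq) a‖ ≤ ε := by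
  have h1 : ‖∏ a : Fq, (z - algebraMap Fq (CInfty Fq) a)‖ < 1 := by
    rw [prod_sub_algebraMap, norm_sub_rev]
    exact hz.trans_lt hε
  obtain ⟨a, ha⟩ : ∃ a : Fq, ‖z - algebraMap Fq (CInfty Fq) a‖ < 1 := by
    by_contra! hcon
    have h2 : ∏ _a : Fq, (1 : ℝ) ≤ ∏ a : Fq, ‖z - algebraMap Fq (CInfty Fq) a‖ :=
      Finset.prod_le_prod (fun _ _ => zero_le_one) fun a _ => hcon a
    rw [Finset.prod_const_one, ← norm_prod] at h2
    linarith
  refine ⟨a, ?_⟩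
  rw [← norm_sub_pow_card ha]
  have h2 : (z - algebraMap Fq (CInfty Fq) a) ^ Fintype.card Fq =
      z ^ Fintype.card Fq - algebraMap Fq (CInfty Fq) a := by
    have h3 := map_sub (frob Fq (CInfty Fq)) z (algebraMap Fq (CInfty Fq) a)
    rwa [AlgEquiv.commutes, frob_apply, frob_apply] at h3
  rw [h2]
  simpa using hz

end TateEstimates

/-! ### The Carlitz period and `Ω` -/

section Carlitz
open Filter Topology
variable {Fq : Type*} [Field Fq] [Fintype Fq] {F : Type*} [Field F] [Algebra Fq F] [PerfectField F]
  [Algebra F (CInfty Fq)] (θ : F)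

/-- The exponential of the Carlitz module as a function of one variable. -/
def carlitzExp (z : CInfty Fq) : CInfty Fq := (carlitz Fq θ 1).exp (fun _ => z) 0

theorem carlitz_phiT_apply (i j : Fin 1) : (carlitz Fq θ 1).phiT i j =
    TwistedPoly.C _ θ + TwistedPoly.X (frob Fq F) := by
  have hi : i = 0 := Subsingleton.elim _ _
  have hj : j = 0 := Subsingleton.elim _ _
  subst hi hj
  rw [TModule.phiT, carlitz, Polynomial.aeval_X, carlitzMatrix]
  simp

theorem evalTau_carlitz_phiT (i j : Fin 1) (x : CInfty Fq) :
    evalTau ((carlitz Fq θ 1).phiT i j) x =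
      algebraMap F (CInfty Fq) θ * x + x ^ Fintype.card Fq := by
  rw [carlitz_phiT_apply, evalTau_add, evalTau_X, TwistedPoly.C_eq_monomial, evalTau_monomial,
    Nat.cast_zero, frobZ_zero_apply]
  congr 1

variable {θ} (hθ : algebraMap F (CInfty Fq) θ = CInfty.theta Fq)
include hθ

theorem carlitz_lieT : (carlitz Fq θ 1).lieT = Matrix.scalar (Fin 1) (CInfty.theta Fq) := by
  ext i j
  have hj : i = j := Subsingleton.elim _ _
  subst hj
  have h : (carlitz Fq θ 1).coeffMat 0 i i = θ := by
    change ((carlitz Fq θ 1).phiT i i).coeff 0 = θ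
    rw [carlitz_phiT_apply, TwistedPoly.coeff_add, TwistedPoly.C_eq_monomial, TwistedPoly.X,
      TwistedPoly.coeff_monomial, TwistedPoly.coeff_monomial]
    simp
  simp [TModule.lieT, h, hθ]

theorem carlitz_lieT_mulVec (z : CInfty Fq) :
    (carlitz Fq θ 1).lieT *ᵥ (fun _ => z) = fun _ => CInfty.theta Fq * z := by
  ext i
  simp [carlitz_lieT hθ, Matrix.mulVec_diagonal]

theorem carlitzExp_theta_mul (z : CInfty Fq) : carlitzExp θ (CInfty.theta Fq * z) =
    CInfty.theta Fq * carlitzExp θ z + carlitzExp θ z ^ Fintype.card Fq := by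
  have h := (carlitz Fq θ 1).sum_evalTau_exp hθ (fun _ => z) 0
  rw [carlitz_lieT_mulVec hθ, Fintype.sum_unique, evalTau_carlitz_phiT, hθ] at h
  exact h.symm

/-- `carlitzExp` as an `F_q`-linear map. -/
def carlitzExpLinear : CInfty Fq →ₗ[Fq] CInfty Fq where
  toFun := carlitzExp θ
  map_add' x y := congrFun ((carlitz Fq θ 1).exp_add hθ (fun _ => x) (fun _ => y)) 0
  map_smul' c x := congrFun ((carlitz Fq θ 1).exp_smul hθ c (fun _ => x)) 0

theorem coeff_carlitzOmega (π : CInfty Fq) (i : ℕ) :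
    PowerSeries.coeff i (carlitzOmega θ π) =
      carlitzExp θ ((CInfty.theta Fq)⁻¹ ^ (i + 1) * π) := by
  have h1 : ((carlitz Fq θ 1).lieT)⁻¹ = Matrix.scalar (Fin 1) (CInfty.theta Fq)⁻¹ := by
    refine Matrix.inv_eq_right_inv ?_
    rw [carlitz_lieT hθ, ← map_mul, mul_inv_cancel₀ CInfty.theta_ne_zero, map_one]
  have h2 : ((carlitz Fq θ 1).lieT)⁻¹ ^ (i + 1) *ᵥ (fun _ => π) =
      fun _ => (CInfty.theta Fq)⁻¹ ^ (i + 1) * π := by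
    rw [h1, ← map_pow]
    ext j
    simp [Matrix.mulVec_diagonal]
  rw [carlitzOmega, TModule.agf, PowerSeries.coeff_mk, h2, carlitzExp]

theorem carlitzOmega_mem_tate (π : CInfty Fq) : carlitzOmega θ π ∈ Tate Fq :=
  (carlitz Fq θ 1).agf_mem_tate hθ _ 0

theorem carlitz_aeval_lieAct (p : Fq[X]) (z : CInfty Fq) :
    Polynomial.aeval (carlitz Fq θ 1).lieAct p (fun _ => z) =
      fun _ => Polynomial.aeval (CInfty.theta Fq) p * z := by
  induction p using Polynomial.induction_on' generalizing z with
  | add p r hp hr =>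
    rw [map_add, LinearMap.add_apply, hp, hr, map_add]
    ext
    simp [add_mul]
  | monomial n a =>
    induction n generalizing z with
    | zero =>
      ext
      simp [Polynomial.aeval_C, Algebra.smul_def]
    | succ n ih =>
      rw [← Polynomial.monomial_mul_X, map_mul, map_mul, Polynomial.aeval_X, Polynomial.aeval_X,
        Module.End.mul_apply]
      have : (carlitz Fq θ 1).lieAct (fun _ => z) = fun _ => CInfty.theta Fq * z :=
        carlitz_lieT_mulVec hθ z
      rw [this, ih]
      simp [mul_assoc]

theorem carlitz_smul_toLie (p : Fq[X]) (z : CInfty Fq) :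
    p • (carlitz Fq θ 1).toLie (fun _ => z) =
      (carlitz Fq θ 1).toLie (fun _ => Polynomial.aeval (CInfty.theta Fq) p * z) := by
  rw [← carlitz_aeval_lieAct hθ]
  rfl

variable {π : CInfty Fq} (hπ : (carlitz Fq θ 1).IsPeriodBasis (fun _ : Fin 1 => fun _ => π))
include hπ

theorem carlitz_exists_of_exp_eq_zero {z : CInfty Fq} (hz : carlitzExp θ z = 0) :
    ∃ b : Fq[X], z = Polynomial.aeval (CInfty.theta Fq) b * π := by
  have h0 : (carlitz Fq θ 1).exp (fun _ => z) = 0 := by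
    ext i
    rw [Subsingleton.elim i 0]
    exact hz
  have h1 := (hπ.2 _).1 h0
  rw [Set.range_const, Submodule.mem_span_singleton] at h1
  obtain ⟨b, hb⟩ := h1
  rw [carlitz_smul_toLie hθ] at hb
  exact ⟨b, (congrFun ((Module.AEval'.of (carlitz Fq θ 1).lieAct).injective hb) 0).symm⟩

theorem carlitz_eq_zero_of_aeval_mul {a : Fq[X]}
    (ha : Polynomial.aeval (CInfty.theta Fq) a * π = 0) : a = 0 := by
  have h1 := Fintype.linearIndependent_iff.1 hπ.1 (fun _ => a) (by
    rw [Fintype.sum_unique, carlitz_smul_toLie hθ, ha]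
    exact map_zero (Module.AEval'.of (carlitz Fq θ 1).lieAct)) 0
  exact h1

theorem carlitzExp_period : carlitzExp θ π = 0 :=
  congrFun ((hπ.2 _).2 (Submodule.subset_span ⟨0, rfl⟩)) 0

theorem carlitz_isUnit_of_aeval_mul_period {a : Fq[X]} {z : CInfty Fq} (hz : carlitzExp θ z = 0)
    (ha : Polynomial.aeval (CInfty.theta Fq) a * z = π) : IsUnit a := by
  obtain ⟨b, rfl⟩ := carlitz_exists_of_exp_eq_zero hθ hπ hz
  have h : Polynomial.aeval (CInfty.theta Fq) (a * b - 1) * π = 0 := by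
    rw [map_sub, map_mul, map_one, sub_mul, mul_assoc, ha, one_mul, sub_self]
  exact IsUnit.of_mul_eq_one b (sub_eq_zero.1 (carlitz_eq_zero_of_aeval_mul hθ hπ h))

theorem coeff_zero_carlitzOmega_ne_zero : PowerSeries.coeff 0 (carlitzOmega θ π) ≠ 0 := by
  intro h0
  rw [coeff_carlitzOmega hθ, zero_add, pow_one] at h0
  refine Polynomial.not_isUnit_X (carlitz_isUnit_of_aeval_mul_period (a := Polynomial.X) hθ hπ h0 ?_)
  rw [Polynomial.aeval_X, mul_inv_cancel_left₀ CInfty.theta_ne_zero]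

/-- `ω^(1) = (t - θ) ω`. -/
theorem twist_one_carlitzOmega :
    twist 1 (carlitzOmega θ π) = tSubTheta Fq * carlitzOmega θ π := by
  have h := (carlitz Fq θ 1).isEigenColumn_agf hθ (y := fun _ => π) (by
    ext i
    rw [Subsingleton.elim i 0]
    exact carlitzExp_period hθ hπ) 0
  have h1 : pairing ((carlitz Fq θ 1).phiT 0) ((carlitz Fq θ 1).agf fun _ => π) =
      PowerSeries.C (CInfty.theta Fq) * carlitzOmega θ π + twist 1 (carlitzOmega θ π) := by
    ext n
    rw [coeff_pairing, Fintype.sum_unique, evalTau_carlitz_phiT, map_add, PowerSeries.coeff_C_mul,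
      coeff_twist_one, hθ]
    rfl
  rw [h1] at h
  rw [tSubTheta, sub_mul, eq_sub_iff_add_eq']
  exact h

/-- The coefficients of `ω` decay geometrically from the first one on, so that `ω` is a unit of the
Tate algebra. A priori the normalized series `x = ω / ω_0`, which satisfies
`x - x^(1) = θ⁻¹ t x`, is congruent to some `p ∈ F_q[t]` modulo the maximal ideal, and `x / p` has the
asserted decay. Then `ω / p` is the generating function of `π / p(θ)`, which is therefore a period,
and since `π` generates the period lattice, `p = 1`. -/
theorem norm_coeff_carlitzOmega_le (i : ℕ) :
    ‖PowerSeries.coeff i (PowerSeries.C (PowerSeries.coeff 0 (carlitzOmega θ π))⁻¹ *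
      carlitzOmega θ π)‖ ≤ ((Fintype.card Fq : ℝ)⁻¹) ^ i := by
  set q := Fintype.card Fq with hq
  have hq1 : (1 : ℝ) < q := one_lt_card_real (Fq := Fq)
  have hqi0 : (0 : ℝ) < (q : ℝ)⁻¹ := by positivity
  have hqi1 : (q : ℝ)⁻¹ < 1 := inv_lt_one_of_one_lt₀ hq1
  set ω := carlitzOmega θ π with hω
  set w0 := PowerSeries.coeff 0 ω with hw0
  have hw0ne : w0 ≠ 0 := coeff_zero_carlitzOmega_ne_zero hθ hπ
  have hnθ : ‖(CInfty.theta Fq)⁻¹‖ = (q : ℝ)⁻¹ := by rw [norm_inv, CInfty.norm_theta]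
  have hw0q : CInfty.theta Fq * w0 + w0 ^ q = 0 := by
    rw [hw0, hω, coeff_carlitzOmega hθ, zero_add, pow_one, ← carlitzExp_theta_mul hθ,
      mul_inv_cancel_left₀ CInfty.theta_ne_zero, carlitzExp_period hθ hπ]
  set x := PowerSeries.C w0⁻¹ * ω with hx
  have hωx : ω = PowerSeries.C w0 * x := by
    rw [hx, ← mul_assoc, ← map_mul, mul_inv_cancel₀ hw0ne, map_one, one_mul]
  have hx0 : PowerSeries.coeff 0 x = 1 := by
    rw [hx, PowerSeries.coeff_C_mul, ← hw0, inv_mul_cancel₀ hw0ne]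
  have hxtate : x ∈ Tate Fq := mul_mem (C_mem_tate _) (carlitzOmega_mem_tate hθ π)
  have hxeq : x - twist 1 x = PowerSeries.C (CInfty.theta Fq)⁻¹ * (PowerSeries.X * x) := by
    have h1 : twist 1 ω = PowerSeries.C (w0 ^ q) * twist 1 x := by
      rw [hωx, map_mul, twist_C]
      congr 2
    have h2 := twist_one_carlitzOmega hθ hπ
    rw [← hω, h1, hωx, eq_neg_of_add_eq_zero_right hw0q, tSubTheta] at h2
    have hθne := CInfty.theta_ne_zero (Fq := Fq)
    have hc : PowerSeries.C (CInfty.theta Fq)⁻¹ * PowerSeries.C (CInfty.theta Fq) = 1 := by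
      rw [← map_mul, inv_mul_cancel₀ hθne, map_one]
    have hc' : PowerSeries.C w0⁻¹ * PowerSeries.C w0 = 1 := by
      rw [← map_mul, inv_mul_cancel₀ hw0ne, map_one]
    rw [map_neg, map_mul] at h2
    linear_combination (PowerSeries.C (CInfty.theta Fq)⁻¹ * PowerSeries.C w0⁻¹) * h2 +
      (-(x - twist 1 x) * PowerSeries.C w0⁻¹ * PowerSeries.C w0) * hc +
      (PowerSeries.C (CInfty.theta Fq)⁻¹ * PowerSeries.X * x - (x - twist 1 x)) * hc'
  have hcoeff : ∀ z : (CInfty Fq)⟦X⟧,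
      z - twist 1 z = PowerSeries.C (CInfty.theta Fq)⁻¹ * (PowerSeries.X * z) → ∀ i,
      PowerSeries.coeff (i + 1) z - PowerSeries.coeff (i + 1) z ^ Fintype.card Fq =
        (CInfty.theta Fq)⁻¹ * PowerSeries.coeff i z := by
    intro z hz i
    have h1 := congrArg (PowerSeries.coeff (i + 1)) hz
    rwa [map_sub, coeff_twist_one, PowerSeries.coeff_C_mul, PowerSeries.coeff_succ_X_mul] at h1
  -- reduction of `x` to a polynomial over `F_q`
  have happrox : ∀ i, (∃ a : Fq, ‖PowerSeries.coeff i x - algebraMap Fq (CInfty Fq) a‖ ≤ (q : ℝ)⁻¹) ∧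
      ‖PowerSeries.coeff i x‖ ≤ 1 := by
    intro i
    induction i with
    | zero =>
      refine ⟨⟨1, ?_⟩, ?_⟩
      · rw [hx0, map_one, sub_self, norm_zero]
        exact hqi0.le
      · rw [hx0, norm_one]
    | succ i ih =>
      have h1 := hcoeff x hxeq i
      obtain ⟨a, ha⟩ := exists_norm_sub_le (Fq := Fq) (z := PowerSeries.coeff (i + 1) x) hqi1 (by
        rw [h1, norm_mul, hnθ]
        exact mul_le_of_le_one_right hqi0.le ih.2)
      refine ⟨⟨a, ha⟩, ?_⟩
      rw [← sub_add_cancel (PowerSeries.coeff (i + 1) x) (algebraMap Fq (CInfty Fq) a)]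
      exact (IsUltrametricDist.norm_add_le_max _ _).trans
        (max_le (ha.trans hqi1.le) (norm_algebraMap_base_le a))
  choose a ha using fun i => (happrox i).1
  have hsmall : ∀ᶠ i in atTop, ‖algebraMap Fq (CInfty Fq) (a i)‖ < 1 := by
    filter_upwards [(tendsto_norm_of_mem_tate hxtate).eventually (gt_mem_nhds one_pos)] with i hi
    have h1 : algebraMap Fq (CInfty Fq) (a i) =
        -(PowerSeries.coeff i x - algebraMap Fq (CInfty Fq) (a i)) + PowerSeries.coeff i x := by ring
    rw [h1]
    refine (IsUltrametricDist.norm_add_le_max _ _).trans_lt (max_lt ?_ hi)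
    rw [norm_neg]
    exact (ha i).trans_lt hqi1
  obtain ⟨p, hp⟩ := exists_polynomial_of_tendsto a hsmall
  set P := toPS Fq Fq p with hP
  have hPc : ∀ i, PowerSeries.coeff i P = algebraMap Fq (CInfty Fq) (a i) := fun i => by
    rw [hP, coeff_toPS, hp]
  have ha0 : a 0 = 1 := by
    by_contra h
    have h1 := ha 0
    rw [hx0, ← map_one (algebraMap Fq (CInfty Fq)), ← map_sub,
      norm_algebraMap_base (sub_ne_zero.2 (Ne.symm h))] at h1
    linarith
  have hP0 : PowerSeries.constantCoeff P = 1 := by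
    rw [← PowerSeries.coeff_zero_eq_constantCoeff_apply, hPc, ha0, map_one]
  have hP0ne : PowerSeries.constantCoeff P ≠ 0 := by rw [hP0]; exact one_ne_zero
  have hPinv : ∀ i, ‖PowerSeries.coeff i P⁻¹‖ ≤ 1 := fun i => by
    simpa using norm_coeff_inv_le hP0 zero_le_one
      (fun i => by rw [hPc, one_pow]; exact norm_algebraMap_base_le _) i
  set x' := x * P⁻¹ with hx'
  have hxx' : x = P * x' := by
    rw [hx', mul_left_comm, PowerSeries.mul_inv_cancel _ hP0ne, mul_one]
  have hx'0 : PowerSeries.coeff 0 x' = 1 := by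
    rw [PowerSeries.coeff_zero_eq_constantCoeff_apply, hx', map_mul,
      ← PowerSeries.coeff_zero_eq_constantCoeff_apply, hx0, PowerSeries.constantCoeff_inv, hP0,
      inv_one, mul_one]
  have hx'small : ∀ i, i ≠ 0 → ‖PowerSeries.coeff i x'‖ < 1 := by
    intro i hi
    have h1 : x' = (x - P) * P⁻¹ + 1 := by
      rw [sub_mul, PowerSeries.mul_inv_cancel _ hP0ne, sub_add_cancel]
    rw [h1, map_add, PowerSeries.coeff_one, if_neg hi, add_zero, PowerSeries.coeff_mul]
    refine lt_of_le_of_lt ?_ hqi1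
    refine IsUltrametricDist.norm_sum_le_of_forall_le_of_nonneg hqi0.le fun y _ => ?_
    rw [norm_mul, map_sub, hPc]
    exact (mul_le_mul (ha _) (hPinv _) (norm_nonneg _) hqi0.le).trans_eq (mul_one _)
  have hx'eq : x' - twist 1 x' = PowerSeries.C (CInfty.theta Fq)⁻¹ * (PowerSeries.X * x') := by
    have h1 : twist 1 P⁻¹ = P⁻¹ := by
      rw [twist_inv _ _ hP0ne, hP, twist_toPS_base]
    rw [hx', map_mul, h1, ← sub_mul, hxeq]
    ring
  have hx'norm : ∀ i, ‖PowerSeries.coeff i x'‖ = ((q : ℝ)⁻¹) ^ i := by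
    intro i
    induction i with
    | zero => rw [hx'0, norm_one, pow_zero]
    | succ i ih =>
      have h1 := hcoeff x' hx'eq i
      rw [← norm_sub_pow_card (hx'small _ i.succ_ne_zero), h1, norm_mul, hnθ, ih, pow_succ']
  have hx'tate : x' ∈ Tate Fq := by
    rw [mem_tate_iff, tendsto_zero_iff_norm_tendsto_zero]
    simp only [hx'norm]
    exact tendsto_pow_atTop_nhds_zero_of_lt_one hqi0.le hqi1
  -- `ω / p` is the generating function of `π / p(θ)`
  have hpne : p ≠ 0 := by
    intro h
    have := hp 0
    rw [h, ha0, Polynomial.coeff_zero] at this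
    exact zero_ne_one this
  set pθ := Polynomial.aeval (CInfty.theta Fq) p with hpθ
  have hpθne : pθ ≠ 0 := fun h =>
    hpne (carlitz_eq_zero_of_aeval_mul hθ hπ (by rw [← hpθ, h, zero_mul]))
  set π' := pθ⁻¹ * π with hπ'
  have hD : carlitzOmega θ π' - PowerSeries.C w0 * x' = 0 := by
    refine eq_zero_of_coeff_toPS_mul hpne
      (sub_mem (carlitzOmega_mem_tate hθ π') (mul_mem (C_mem_tate _) hx'tate)) fun k hk => ?_
    have h1 : P * (PowerSeries.C w0 * x') = ω := by
      rw [mul_left_comm, ← hxx', ← hωx]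
    rw [← hP, mul_sub, h1, map_sub, sub_eq_zero, hω, coeff_carlitzOmega hθ, PowerSeries.coeff_mul]
    have h2 : ∀ y ∈ Finset.HasAntidiagonal.antidiagonal k,
        PowerSeries.coeff y.1 P * PowerSeries.coeff y.2 (carlitzOmega θ π') =
        carlitzExpLinear hθ (p.coeff y.1 • CInfty.theta Fq ^ y.1 *
          ((CInfty.theta Fq)⁻¹ ^ (k + 1) * π')) := by
      rintro ⟨b, c⟩ hbc
      rw [Finset.HasAntidiagonal.mem_antidiagonal] at hbc
      simp only at hbc ⊢
      rw [smul_mul_assoc, map_smul, hPc, ← hp, Algebra.smul_def, coeff_carlitzOmega hθ]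
      congr 1
      change carlitzExp θ _ = carlitzExp θ _
      congr 1
      have h3 : (CInfty.theta Fq)⁻¹ ^ (c + 1) =
          CInfty.theta Fq ^ b * (CInfty.theta Fq)⁻¹ ^ (k + 1) := by
        rw [← hbc, add_assoc, pow_add _ b, ← mul_assoc, ← mul_pow,
          mul_inv_cancel₀ CInfty.theta_ne_zero, one_pow, one_mul]
      rw [h3, mul_assoc]
    rw [Finset.sum_congr rfl h2, ← map_sum, ← Finset.sum_mul,
      Finset.Nat.sum_antidiagonal_eq_sum_range_succ
        (fun b _ => p.coeff b • CInfty.theta Fq ^ b),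
      ← Polynomial.aeval_eq_sum_range' (Nat.lt_succ_of_le hk), ← hpθ, hπ', mul_left_comm,
      mul_inv_cancel_left₀ hpθne]
    rfl
  have hexp : carlitzExp θ π' = 0 := by
    have h1 := congrArg (PowerSeries.coeff 0) (sub_eq_zero.1 hD)
    rw [coeff_carlitzOmega hθ, PowerSeries.coeff_C_mul, hx'0, mul_one, zero_add, pow_one] at h1
    have h2 := carlitzExp_theta_mul hθ ((CInfty.theta Fq)⁻¹ * π')
    rw [mul_inv_cancel_left₀ CInfty.theta_ne_zero, h1] at h2
    rw [h2, hw0q]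
  have hunit : IsUnit p := carlitz_isUnit_of_aeval_mul_period hθ hπ hexp (by
    rw [← hpθ, hπ', mul_inv_cancel_left₀ hpθne])
  have hp1 : p = 1 := by
    rw [Polynomial.eq_C_of_degree_eq_zero (Polynomial.degree_eq_zero_of_isUnit hunit), hp, ha0,
      Polynomial.C_1]
  have hfinal : x = x' := by
    rw [hxx', hP, hp1, map_one, one_mul]
  rw [hfinal, hx'norm]

/-- `ω⁻¹` lies in the Tate algebra. -/
theorem inv_carlitzOmega_mem_tate : (carlitzOmega θ π)⁻¹ ∈ Tate Fq := by
  have hw0 := coeff_zero_carlitzOmega_ne_zero hθ hπ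
  set w0 := PowerSeries.coeff 0 (carlitzOmega θ π) with hw0def
  set x := PowerSeries.C w0⁻¹ * carlitzOmega θ π with hx
  have hx0 : PowerSeries.constantCoeff x = 1 := by
    rw [← PowerSeries.coeff_zero_eq_constantCoeff_apply, hx, PowerSeries.coeff_C_mul,
      inv_mul_cancel₀ hw0]
  have hω : carlitzOmega θ π = PowerSeries.C w0 * x := by
    rw [hx, ← mul_assoc, ← map_mul, mul_inv_cancel₀ hw0, map_one, one_mul]
  have hxinv : x⁻¹ ∈ Tate Fq := by
    rw [mem_tate_iff, tendsto_zero_iff_norm_tendsto_zero]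
    have hq1 : (1 : ℝ) < Fintype.card Fq := one_lt_card_real (Fq := Fq)
    refine squeeze_zero (fun _ => norm_nonneg _)
      (norm_coeff_inv_le hx0 (by positivity) (norm_coeff_carlitzOmega_le hθ hπ))
      (tendsto_pow_atTop_nhds_zero_of_lt_one (by positivity) (inv_lt_one_of_one_lt₀ hq1))
  rw [hω, PowerSeries.mul_inv_rev, PowerSeries.C_inv]
  exact mul_mem hxinv (C_mem_tate _)

theorem constantCoeff_carlitzOmega_ne_zero :
    PowerSeries.constantCoeff (carlitzOmega θ π) ≠ 0 := by
  rw [← PowerSeries.coeff_zero_eq_constantCoeff_apply]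
  exact coeff_zero_carlitzOmega_ne_zero hθ hπ

theorem constantCoeff_twist_carlitzOmega_ne_zero :
    PowerSeries.constantCoeff (twist 1 (carlitzOmega θ π)) ≠ 0 := by
  rw [← PowerSeries.coeff_zero_eq_constantCoeff_apply, coeff_twist_one]
  exact pow_ne_zero _ (coeff_zero_carlitzOmega_ne_zero hθ hπ)

theorem bigOmega_mem_tate : bigOmega θ π ∈ Tate Fq := by
  rw [bigOmega, ← twist_inv _ _ (constantCoeff_carlitzOmega_ne_zero hθ hπ)]
  exact twist_one_mem_tate (inv_carlitzOmega_mem_tate hθ hπ)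

theorem constantCoeff_bigOmega_ne_zero : PowerSeries.constantCoeff (bigOmega θ π) ≠ 0 := by
  rw [bigOmega, PowerSeries.constantCoeff_inv]
  exact inv_ne_zero (constantCoeff_twist_carlitzOmega_ne_zero hθ hπ)

theorem inv_bigOmega : (bigOmega θ π)⁻¹ = twist 1 (carlitzOmega θ π) := by
  rw [PowerSeries.inv_eq_iff_mul_eq_one (constantCoeff_bigOmega_ne_zero hθ hπ), bigOmega,
    PowerSeries.mul_inv_cancel _ (constantCoeff_twist_carlitzOmega_ne_zero hθ hπ)]

theorem inv_bigOmega_mem_tate : (bigOmega θ π)⁻¹ ∈ Tate Fq := by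
  rw [inv_bigOmega hθ hπ]
  exact twist_one_mem_tate (carlitzOmega_mem_tate hθ π)

/-- `Ω^(-1) = (t - θ) Ω`. -/
theorem twist_neg_one_bigOmega :
    twist (-1) (bigOmega θ π) = tSubTheta Fq * bigOmega θ π := by
  have h0 := constantCoeff_carlitzOmega_ne_zero hθ hπ
  have h1 := constantCoeff_twist_carlitzOmega_ne_zero hθ hπ
  rw [bigOmega, twist_inv _ _ h1, twist_neg_one_twist_one,
    PowerSeries.inv_eq_iff_mul_eq_one h0, mul_right_comm, ← twist_one_carlitzOmega hθ hπ,
    PowerSeries.mul_inv_cancel _ h1]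

end Carlitz

/-! ### Constant morphisms of `t`-modules -/

section Morphisms
variable {Fq : Type*} [Field Fq] [Fintype Fq] {F : Type*} [Field F] [Algebra Fq F] [PerfectField F]
  [Algebra F (CInfty Fq)] {θ : F} {ι κ : Type*} [Fintype ι] [DecidableEq ι] [Fintype κ]
  [DecidableEq κ] {G : TModule Fq θ ι} {H : TModule Fq θ κ}

/-- A constant matrix with Frobenius-invariant entries that intertwines two `t`-modules intertwines
their exponentials, by uniqueness of the exponential coefficients. -/
theorem mul_expCoeff_of_intertwine (hθ : algebraMap F (CInfty Fq) θ = CInfty.theta Fq)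
    {P : Matrix ι κ F} (hPf : ∀ k : ℕ, P.map (frobZ Fq F k) = P)
    (hP : ∀ i, P * H.coeffMat i = G.coeffMat i * P) (k : ℕ) :
    P * H.expCoeff k = G.expCoeff k * P := by
  induction k using Nat.strong_induction_on with
  | _ k ih =>
  rcases Nat.eq_zero_or_pos k with rfl | hk
  · simp [TModule.expCoeff]
  have h1 : ∑ p ∈ Finset.HasAntidiagonal.antidiagonal k,
      G.coeffMat p.1 * (P * H.expCoeff p.2).map (frobZ Fq F p.1) =
        P * H.expCoeff k * (H.coeffMat 0).map (frobZ Fq F k) := by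
    have h := congrFun (H.twistedConv_expCoeff hθ) k
    rw [twistedConv_constSeq] at h
    rw [Matrix.mul_assoc, ← h, twistedConv, Matrix.mul_sum]
    refine Finset.sum_congr rfl fun p _ => ?_
    rw [map_frobZ_mul, hPf, ← Matrix.mul_assoc, ← hP, Matrix.mul_assoc]
  have h2 : ∑ p ∈ Finset.HasAntidiagonal.antidiagonal k,
      G.coeffMat p.1 * (G.expCoeff p.2 * P).map (frobZ Fq F p.1) =
        G.expCoeff k * P * (H.coeffMat 0).map (frobZ Fq F k) := by
    have h := congrFun (G.twistedConv_expCoeff hθ) k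
    rw [twistedConv_constSeq] at h
    have h3 : P * (H.coeffMat 0).map (frobZ Fq F k) = (G.coeffMat 0).map (frobZ Fq F k) * P := by
      have := congrArg (fun M => M.map (frobZ Fq F k)) (hP 0)
      simpa only [map_frobZ_mul, hPf] using this
    rw [Matrix.mul_assoc, h3, ← Matrix.mul_assoc, ← h, twistedConv, Matrix.sum_mul]
    refine Finset.sum_congr rfl fun p _ => ?_
    rw [map_frobZ_mul, hPf, Matrix.mul_assoc]
  have hmem : (0, k) ∈ Finset.HasAntidiagonal.antidiagonal k := by simp
  rw [← Finset.add_sum_erase _ _ hmem] at h1 h2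
  have h3 : ∀ p ∈ (Finset.HasAntidiagonal.antidiagonal k).erase (0, k),
      G.coeffMat p.1 * (P * H.expCoeff p.2).map (frobZ Fq F p.1) =
        G.coeffMat p.1 * (G.expCoeff p.2 * P).map (frobZ Fq F p.1) := by
    rintro ⟨a, b⟩ hp
    rw [Finset.mem_erase, Finset.HasAntidiagonal.mem_antidiagonal] at hp
    obtain ⟨hne, hab⟩ := hp
    simp only at hab ⊢
    have ha : a ≠ 0 := fun h0 => hne (by ext <;> simp_all)
    rw [ih b (by omega)]
  rw [Finset.sum_congr rfl h3] at h1
  simp only [Nat.cast_zero, map_frobZ_zero] at h1 h2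
  have h4 : (P * H.expCoeff k - G.expCoeff k * P) * (H.coeffMat 0).map (frobZ Fq F k) =
      G.coeffMat 0 * (P * H.expCoeff k - G.expCoeff k * P) := by
    rw [Matrix.sub_mul, Matrix.mul_sub, ← h1, ← h2]
    abel
  exact sub_eq_zero.1 (eq_zero_of_intertwine G hθ H hk.ne' _ h4)

end Morphisms

/-! ### Generating functions of extensions -/

section Extensions
variable {Fq : Type*} [Field Fq] [Fintype Fq] {F : Type*} [Field F] [Algebra Fq F] [PerfectField F]
  {θ : F} {ι : Type*} [Fintype ι] [DecidableEq ι] (G : TModule Fq θ ι) {n : ℕ}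
  (δ : Biderivation G n)

theorem extension_phiT : (G.extension δ).phiT =
    Matrix.fromBlocks G.phiT 0 (δ.toLin Polynomial.X) (carlitz Fq θ n).phiT := by
  rw [TModule.phiT, TModule.extension, Polynomial.aeval_X]

/-- The matrix of the projection onto the first summand. -/
def projLeft (F : Type*) [Field F] (ι κ : Type*) [DecidableEq ι] : Matrix ι (ι ⊕ κ) F :=
  Matrix.fromCols 1 0

theorem map_projLeft {F' : Type*} [Field F'] (κ : Type*) (f : F →+* F') :
    (projLeft F ι κ).map f = projLeft F' ι κ := by
  ext i (j | j)
  · by_cases h : i = j <;> simp [projLeft, h]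
  · simp [projLeft]

theorem projLeft_mulVec {κ : Type*} [Fintype κ] (z : ι ⊕ κ → F) :
    projLeft F ι κ *ᵥ z = z ∘ Sum.inl := by
  rw [projLeft, Matrix.fromCols_mulVec]
  simp

theorem projLeft_mul_extension_coeffMat (i : ℕ) :
    projLeft F ι (Fin n) * (G.extension δ).coeffMat i = G.coeffMat i * projLeft F ι (Fin n) := by
  have h : (G.extension δ).coeffMat i = Matrix.fromBlocks (G.coeffMat i) 0
      ((δ.toLin Polynomial.X).map fun b => b.coeff i) ((carlitz Fq θ n).coeffMat i) := by
    rw [TModule.coeffMat, extension_phiT]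
    ext (a | a) (b | b) <;> rfl
  rw [h, projLeft, Matrix.fromCols_mul_fromBlocks, Matrix.mul_fromCols]
  simp

variable [Algebra F (CInfty Fq)] (hθ : algebraMap F (CInfty Fq) θ = CInfty.theta Fq)
include hθ

theorem extension_exp_comp_inl (z : ι ⊕ Fin n → CInfty Fq) :
    (G.extension δ).exp z ∘ Sum.inl = G.exp (z ∘ Sum.inl) := by
  have hc : Continuous fun x : ι ⊕ Fin n → CInfty Fq => x ∘ (Sum.inl : ι → ι ⊕ Fin n) := by
    fun_prop
  have h := ((G.extension δ).hasSum_expTerm hθ z).map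
    (⟨⟨fun x => x ∘ Sum.inl, rfl⟩, fun _ _ => rfl⟩ :
      (ι ⊕ Fin n → CInfty Fq) →+ (ι → CInfty Fq)) hc
  have e : ∀ k, (G.extension δ).expTerm z k ∘ Sum.inl = G.expTerm (z ∘ Sum.inl) k := by
    intro k
    have h1 := mul_expCoeff_of_intertwine (G := G) (H := G.extension δ) hθ
      (P := projLeft F ι (Fin n))
      (fun k => map_projLeft (Fin n) ((frobZ Fq F k : F ≃ₐ[Fq] F) : F →+* F))
      (projLeft_mul_extension_coeffMat G δ) k
    have h2 := congrArg (fun M => M.map (algebraMap F (CInfty Fq))) h1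
    simp only [Matrix.map_mul, map_projLeft] at h2
    rw [TModule.expTerm, TModule.expTerm, ← projLeft_mulVec, Matrix.mulVec_mulVec, h2,
      ← Matrix.mulVec_mulVec, projLeft_mulVec]
    rfl
  refine HasSum.unique ?_ (G.hasSum_expTerm hθ (z ∘ Sum.inl))
  rw [← show (fun k => (G.extension δ).expTerm z k ∘ Sum.inl) = _ from funext e]
  exact h

theorem projLeft_mul_extension_lieT_inv :
    projLeft (CInfty Fq) ι (Fin n) * (G.extension δ).lieT⁻¹ =
      G.lieT⁻¹ * projLeft (CInfty Fq) ι (Fin n) := by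
  have h := congrArg (fun M => M.map (algebraMap F (CInfty Fq)))
    (projLeft_mul_extension_coeffMat G δ 0)
  simp only [Matrix.map_mul, map_projLeft] at h
  change projLeft (CInfty Fq) ι (Fin n) * (G.extension δ).lieT =
    G.lieT * projLeft (CInfty Fq) ι (Fin n) at h
  calc projLeft (CInfty Fq) ι (Fin n) * (G.extension δ).lieT⁻¹
      = G.lieT⁻¹ * (G.lieT * projLeft (CInfty Fq) ι (Fin n)) * (G.extension δ).lieT⁻¹ := by
        rw [← Matrix.mul_assoc, Matrix.nonsing_inv_mul _ (G.isUnit_det_lieT hθ), Matrix.one_mul]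
    _ = _ := by
        rw [← h, Matrix.mul_assoc, Matrix.mul_assoc,
          Matrix.mul_nonsing_inv _ ((G.extension δ).isUnit_det_lieT hθ), Matrix.mul_one]

/-- The first coordinates of a generating function of the extension form a generating function of
`G`. -/
theorem extension_agf_inl (z : ι ⊕ Fin n → CInfty Fq) (k : ι) :
    (G.extension δ).agf z (Sum.inl k) = G.agf (z ∘ Sum.inl) k := by
  ext i
  simp only [TModule.agf, PowerSeries.coeff_mk]
  have h : ∀ e : ℕ, ((G.extension δ).lieT⁻¹ ^ e *ᵥ z) ∘ Sum.inl = G.lieT⁻¹ ^ e *ᵥ (z ∘ Sum.inl) := by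
    intro e
    have h1 : ∀ e : ℕ, projLeft (CInfty Fq) ι (Fin n) * (G.extension δ).lieT⁻¹ ^ e =
        G.lieT⁻¹ ^ e * projLeft (CInfty Fq) ι (Fin n) := by
      intro e
      induction e with
      | zero => simp
      | succ e ih =>
        rw [pow_succ, ← Matrix.mul_assoc, ih, Matrix.mul_assoc,
          projLeft_mul_extension_lieT_inv G δ hθ, ← Matrix.mul_assoc, ← pow_succ]
    rw [← projLeft_mulVec, Matrix.mulVec_mulVec, h1, ← Matrix.mulVec_mulVec, projLeft_mulVec]
  rw [← h, ← extension_exp_comp_inl G δ hθ]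
  rfl

theorem toPS_X_sub_C_theta :
    toPS Fq F (Polynomial.X - Polynomial.C θ) = tSubTheta Fq := by
  rw [map_sub, toPS_X, toPS_C, hθ, tSubTheta]

/-- The difference equation of the last generating function `g_{j,1}`:
`g_{j,1}^(1) = ∑ (Φ_δ)_i ⟨m_i | 𝒢_{w_j}⟩ + (t - θ)^n g_{j,1}`. -/
theorem twist_one_gCoord [NeZero n] {r : ℕ} {m : Fin r → G.Motive}
    {Φt : Matrix (Fin r) (Fin r) F[X]} {Φδ : Matrix (Fin 1) (Fin r) F[X]}
    (hΦδ : (G.extension δ).IsMotiveFrame (G.extFamily δ m) (extFrame θ n Φt Φδ))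
    {w : Fin r → ι → CInfty Fq} {l : Fin r → Fin n → CInfty Fq}
    (hl : ∀ j, (G.extension δ).exp (Sum.elim (w j) (l j)) = 0) (j : Fin r) :
    twist 1 (G.gCoord δ w l j) =
      ∑ i, toPS Fq F (Φδ 0 i) * pairing (G.ofMotive (m i)) (G.agf (w j)) +
        tSubTheta Fq ^ n * G.gCoord δ w l j := by
  set f := (G.extension δ).agf (Sum.elim (w j) (l j)) with hf
  have h := twist_one_pairing_of_isMotiveFrame
    ((G.extension δ).isEigenColumn_agf hθ (hl j)) hΦδ (Sum.inr 0)
  have h1 : ∀ e : Fin 1, pairing ((G.extension δ).ofMotive (G.extFamily δ m (Sum.inr e))) f =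
      G.gCoord δ w l j := by
    intro e
    have : (G.extension δ).ofMotive (G.extFamily δ m (Sum.inr e)) =
        Pi.single (Sum.inr 0) (1 : TauPoly Fq F) := by
      change (Sum.elim (0 : ι → TauPoly Fq F) (Pi.single (0 : Fin n) 1) :
        ι ⊕ Fin n → TauPoly Fq F) = _
      ext1 (k | k)
      · simp
      · by_cases hk : k = 0
        · subst hk; simp
        · simp [hk]
    rw [this, pairing_single]
    rfl
  have h2 : ∀ i, pairing ((G.extension δ).ofMotive (G.extFamily δ m (Sum.inl i))) f =
      pairing (G.ofMotive (m i)) (G.agf (w j)) := by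
    intro i
    have : (G.extension δ).ofMotive (G.extFamily δ m (Sum.inl i)) =
        Sum.elim (G.ofMotive (m i)) 0 := rfl
    rw [this]
    ext k
    rw [coeff_pairing, coeff_pairing, Fintype.sum_sum_type]
    simp only [Sum.elim_inl, Sum.elim_inr, Pi.zero_apply, evalTau_zero, Finset.sum_const_zero,
      add_zero, hf, extension_agf_inl G δ hθ, Sum.elim_comp_inl]
  rw [h1, Fintype.sum_sum_type] at h
  simp only [← hf, h1, h2, Finset.univ_unique, Finset.sum_singleton, Fin.default_eq_zero] at h
  rw [h]
  simp only [extFrame, Matrix.fromBlocks_apply₂₁, Matrix.fromBlocks_apply₂₂, Matrix.of_apply,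
    map_pow, toPS_X_sub_C_theta hθ]

end Extensions

/-! ### The series of twists -/

section TwistSums
open Filter Topology
variable {Fq : Type*} [Field Fq] [Fintype Fq]

theorem norm_coeff_le_gauss {f : (CInfty Fq)⟦X⟧} (hf : f ∈ Tate Fq) (i : ℕ) :
    ‖PowerSeries.coeff i f‖ ≤ gauss f := by
  have h := PowerSeries.le_gaussNorm norm 1 f (by
    simpa only [PowerSeries.HasGaussNorm, one_pow, mul_one] using
      (tendsto_norm_of_mem_tate hf).bddAbove_range) i
  rwa [one_pow, mul_one] at h

theorem gauss_nonneg (f : (CInfty Fq)⟦X⟧) : 0 ≤ gauss f :=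
  PowerSeries.gaussNorm_nonneg _ _ _ fun a => norm_nonneg a

theorem gauss_le {f : (CInfty Fq)⟦X⟧} {C : ℝ} (h : ∀ i, ‖PowerSeries.coeff i f‖ ≤ C) :
    gauss f ≤ C := by
  rw [gauss, PowerSeries.gaussNorm_eq]
  exact ciSup_le fun i => by simpa using h i

theorem summable_pow_card_pow {x : CInfty Fq} (hx : ‖x‖ < 1) :
    Summable fun m : ℕ => x ^ Fintype.card Fq ^ m := by
  refine NonarchimedeanAddGroup.summable_of_tendsto_cofinite_zero ?_
  rw [Nat.cofinite_eq_atTop, tendsto_zero_iff_norm_tendsto_zero]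
  simp only [norm_pow]
  exact (tendsto_pow_atTop_nhds_zero_of_lt_one (norm_nonneg _) hx).comp
    (tendsto_pow_atTop_atTop_of_one_lt (α := ℕ) Fintype.one_lt_card)

theorem summable_pow_card_pow_succ {x : CInfty Fq} (hx : ‖x‖ < 1) :
    Summable fun m : ℕ => x ^ Fintype.card Fq ^ (m + 1) :=
  (summable_nat_add_iff (f := fun m => x ^ Fintype.card Fq ^ m) 1).2 (summable_pow_card_pow hx)

/-- The series `∑_{m ≥ 1} f^(m)`, summed coefficientwise. -/
def twistSum (f : (CInfty Fq)⟦X⟧) : (CInfty Fq)⟦X⟧ :=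
  PowerSeries.mk fun i => ∑' m : ℕ, PowerSeries.coeff i f ^ Fintype.card Fq ^ (m + 1)

theorem norm_coeff_twistSum_sub_le {f : (CInfty Fq)⟦X⟧} (hf : f ∈ Tate Fq) (h1 : gauss f < 1)
    (M i : ℕ) :
    ‖PowerSeries.coeff i (twistSum f - ∑ m ∈ Finset.Icc 1 M, twist (m : ℤ) f)‖ ≤
      ‖PowerSeries.coeff i f‖ ^ (M + 1) := by
  set x := PowerSeries.coeff i f with hx
  have hx1 : ‖x‖ < 1 := (norm_coeff_le_gauss hf i).trans_lt h1
  have hs := summable_pow_card_pow_succ hx1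
  have h2 : PowerSeries.coeff i (∑ m ∈ Finset.Icc 1 M, twist (m : ℤ) f) =
      ∑ m ∈ Finset.range M, x ^ Fintype.card Fq ^ (m + 1) := by
    rw [map_sum, Finset.range_eq_Ico, Finset.sum_Ico_add' (fun m => x ^ Fintype.card Fq ^ m) 0 M 1]
    exact Finset.sum_congr rfl fun m _ => coeff_twist_natCast m f i
  have h3 : PowerSeries.coeff i (twistSum f - ∑ m ∈ Finset.Icc 1 M, twist (m : ℤ) f) =
      ∑' m : ℕ, x ^ Fintype.card Fq ^ (m + M + 1) := by
    rw [map_sub, h2, twistSum, PowerSeries.coeff_mk, ← hx, sub_eq_iff_eq_add']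
    exact (hs.sum_add_tsum_nat_add M).symm
  rw [h3]
  refine IsUltrametricDist.norm_tsum_le_of_forall_le_of_nonneg (by positivity) fun m => ?_
  rw [norm_pow]
  refine pow_le_pow_of_le_one (norm_nonneg _) hx1.le ?_
  exact le_trans (by omega) (Nat.lt_pow_self (n := m + M + 1)
    (Fintype.one_lt_card (α := Fq))).le

theorem twistSum_mem_tate {f : (CInfty Fq)⟦X⟧} (hf : f ∈ Tate Fq) (h1 : gauss f < 1) :
    twistSum f ∈ Tate Fq := by
  rw [mem_tate_iff, tendsto_zero_iff_norm_tendsto_zero]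
  refine squeeze_zero (fun _ => norm_nonneg _) (fun i => ?_) (tendsto_norm_of_mem_tate hf)
  simpa using norm_coeff_twistSum_sub_le hf h1 0 i

theorem tendsto_gauss_twistSum_sub {f : (CInfty Fq)⟦X⟧} (hf : f ∈ Tate Fq) (h1 : gauss f < 1) :
    Tendsto (fun M : ℕ => gauss (twistSum f - ∑ m ∈ Finset.Icc 1 M, twist (m : ℤ) f))
      atTop (𝓝 0) := by
  have h0 := gauss_nonneg f
  refine squeeze_zero (fun _ => gauss_nonneg _)
    (fun M => gauss_le fun i => (norm_coeff_twistSum_sub_le hf h1 M i).trans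
      (pow_le_pow_left₀ (norm_nonneg _) (norm_coeff_le_gauss hf i) (M + 1)))
    ((tendsto_pow_atTop_nhds_zero_of_lt_one h0 h1).comp (tendsto_add_atTop_nat 1))

theorem twist_neg_one_twistSum {f : (CInfty Fq)⟦X⟧} (hf : f ∈ Tate Fq) (h1 : gauss f < 1) :
    twist (-1) (twistSum f) - twistSum f = f := by
  rw [sub_eq_iff_eq_add]
  have key : twistSum f = twist 1 (f + twistSum f) := by
    ext i
    set x := PowerSeries.coeff i f with hx
    have hx1 : ‖x‖ < 1 := (norm_coeff_le_gauss hf i).trans_lt h1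
    have hs := summable_pow_card_pow_succ hx1
    have hpow : (∑' m : ℕ, x ^ Fintype.card Fq ^ (m + 1)) ^ Fintype.card Fq =
        ∑' m : ℕ, x ^ Fintype.card Fq ^ (m + 1 + 1) := by
      have hmap := hs.hasSum.map (frob Fq (CInfty Fq)) (by
        change Continuous fun x : CInfty Fq => x ^ Fintype.card Fq
        fun_prop)
      rw [← frob_apply, ← hmap.tsum_eq]
      refine tsum_congr fun m => ?_
      rw [Function.comp_apply, frob_apply, ← pow_mul, ← pow_succ]
    have hS : PowerSeries.coeff i (twistSum f) = ∑' m : ℕ, x ^ Fintype.card Fq ^ (m + 1) :=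
      PowerSeries.coeff_mk _ _
    rw [map_add, map_add, coeff_twist_one, coeff_twist_one, ← hx, hS, hpow, hs.tsum_eq_zero_add,
      zero_add, pow_one]
  conv_lhs => rw [key]
  exact twist_neg_one_twist_one _

end TwistSums

/-! ### Twists and cofactors of matrices -/

section MatrixTwists
variable {Fq : Type*} [Field Fq] [Fintype Fq]

theorem map_twist_mul {α β γ : Type*} [Fintype β] (k : ℤ) (A : Matrix α β (CInfty Fq)⟦X⟧)
    (B : Matrix β γ (CInfty Fq)⟦X⟧) :
    (A * B).map (twist k) = A.map (twist k) * B.map (twist k) := Matrix.map_mul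

theorem map_twist_smul {α β : Type*} (k : ℤ) (s : (CInfty Fq)⟦X⟧)
    (A : Matrix α β (CInfty Fq)⟦X⟧) : (s • A).map (twist k) = twist k s • A.map (twist k) := by
  ext1 i j
  simp

theorem map_cof {α R S : Type*} [Fintype α] [DecidableEq α] [CommRing R] [CommRing S] (f : R →+* S)
    (M : Matrix α α R) : (cof M).map f = cof (M.map f) := by
  have h := f.map_adjugate M
  rw [RingHom.mapMatrix_apply, RingHom.mapMatrix_apply] at h
  rw [cof, cof, ← h, Matrix.transpose_map]

theorem cof_mul {α R : Type*} [Fintype α] [DecidableEq α] [CommRing R] (A B : Matrix α α R) :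
    cof (A * B) = cof A * cof B := by
  rw [cof, cof, cof, Matrix.adjugate_mul_distrib, Matrix.transpose_mul]

theorem cof_mul_transpose {α R : Type*} [Fintype α] [DecidableEq α] [CommRing R]
    (A : Matrix α α R) : cof A * Aᵀ = A.det • 1 := by
  rw [cof, ← Matrix.transpose_mul, Matrix.mul_adjugate, Matrix.transpose_smul,
    Matrix.transpose_one]

theorem mul_mem_tate {α β γ : Type*} [Fintype β] {A : Matrix α β (CInfty Fq)⟦X⟧}
    {B : Matrix β γ (CInfty Fq)⟦X⟧} (hA : ∀ i j, A i j ∈ Tate Fq) (hB : ∀ i j, B i j ∈ Tate Fq)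
    (i : α) (j : γ) : (A * B) i j ∈ Tate Fq := by
  rw [Matrix.mul_apply]
  exact sum_mem fun k _ => mul_mem (hA i k) (hB k j)

theorem withOne_mul_lowerUnipotent {r : ℕ} (z : Matrix (Fin 1) (Fin r) (CInfty Fq)⟦X⟧)
    (a : Matrix (Fin 1) (Fin r) Fq[X]) :
    withOne z * (lowerUnipotent a).map (toPS Fq Fq) = withOne (z + a.map (toPS Fq Fq)) := by
  have h : (lowerUnipotent a).map (toPS Fq Fq) =
      Matrix.fromBlocks 1 0 (a.map (toPS Fq Fq)) (1 : Matrix (Fin 1) (Fin 1) (CInfty Fq)⟦X⟧) := by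
    rw [lowerUnipotent, Matrix.fromBlocks_map]
    simp
  rw [h, withOne, withOne, Matrix.fromCols_mul_fromBlocks]
  simp

end MatrixTwists

/-! ### Difference equations over the Tate algebra -/

section DifferenceEquations
variable {Fq : Type*} [Field Fq] [Fintype Fq]

theorem tSubTheta_ne_zero : tSubTheta Fq ≠ 0 := by
  intro h
  have := congrArg (PowerSeries.coeff 1) h
  simp [tSubTheta] at this

variable {r : ℕ} {Ω : (CInfty Fq)⟦X⟧} (hΩ : twist (-1) Ω = tSubTheta Fq * Ω)
  {Φ Ψ : Matrix (Fin r) (Fin r) (CInfty Fq)⟦X⟧}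
include hΩ

/-- Multiplication by `Ω^e Cof(Ψ)` turns the equation `u^(-1) - u = h Ω^e Cof(Ψ)` into the twisted
linear equation for `g`, because `Ω^e Cof(Ψ)` solves the homogeneous equation. -/
theorem twist_neg_one_mul_smul_cof (hΩ0 : Ω ≠ 0) (hΨ : Ψ.map (twist (-1)) = Φ * Ψ)
    (hΨu : Ψ.det ≠ 0) {e : ℕ} {u g h : Matrix (Fin 1) (Fin r) (CInfty Fq)⟦X⟧}
    (hu : u = Ω ^ e • (g * cof Ψ))
    (huf : u.map (twist (-1)) - u = Ω ^ e • (h * cof Ψ)) :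
    g.map (twist (-1)) * (tSubTheta Fq ^ e • cof Φ) = g + h := by
  have h1 : u.map (twist (-1)) =
      Ω ^ e • (g.map (twist (-1)) * (tSubTheta Fq ^ e • cof Φ) * cof Ψ) := by
    rw [hu, map_twist_smul, map_twist_mul, map_cof, hΨ, cof_mul, map_pow, hΩ, mul_pow,
      Matrix.mul_smul, Matrix.smul_mul, smul_smul, mul_comm (Ω ^ e), Matrix.mul_assoc]
  rw [h1, hu, ← smul_sub, ← Matrix.sub_mul] at huf
  have h2 := smul_right_injective _ (pow_ne_zero e hΩ0) huf
  have h3 := congrArg (fun M => M * Ψᵀ) h2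
  simp only [Matrix.mul_assoc _ (cof Ψ), cof_mul_transpose, Matrix.mul_smul, Matrix.mul_one] at h3
  refine sub_eq_iff_eq_add'.1 (smul_right_injective _ hΨu ?_)
  simpa only [Matrix.mul_smul] using h3

/-- The twist of `u_c Ω^n g Vᵗʳ Υ`, for a solution `g` of the twisted linear equation. -/
theorem twist_neg_one_smul_mul_transpose_mul {d n : ℕ} (hdn : d ≤ n) {c uc : CInfty Fq}
    (hc : frobZ Fq (CInfty Fq) (-1) uc = c * uc)
    (hdet : Φ.det = PowerSeries.C c * tSubTheta Fq ^ d)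
    {Φt V U Υ : Matrix (Fin r) (Fin r) (CInfty Fq)⟦X⟧}
    (hV : V.map (twist (-1)) * Φ = Φtᵀ * V) (hU : Υ.map (twist (-1)) = U) (hΥ : Υ = Φt * U)
    {g h : Matrix (Fin 1) (Fin r) (CInfty Fq)⟦X⟧}
    (hg : g.map (twist (-1)) * (tSubTheta Fq ^ (n - d) • cof Φ) = g + h) :
    (PowerSeries.C uc • Ω ^ n • (g * Vᵀ * Υ)).map (twist (-1)) =
      PowerSeries.C uc • Ω ^ n • (g * Vᵀ * Υ) + PowerSeries.C uc • Ω ^ n • (h * Vᵀ * Υ) := by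
  have h1 : (g + h) * Φᵀ = (PowerSeries.C c * tSubTheta Fq ^ n) • g.map (twist (-1)) := by
    rw [← hg, Matrix.mul_assoc, Matrix.smul_mul, cof_mul_transpose, hdet, Matrix.mul_smul,
      Matrix.mul_smul, Matrix.mul_one, smul_smul, mul_left_comm, ← pow_add, Nat.sub_add_cancel hdn]
  have h2 : Φᵀ * (V.map (twist (-1)))ᵀ = Vᵀ * Φt := by
    rw [← Matrix.transpose_mul, hV, Matrix.transpose_mul, Matrix.transpose_transpose]
  have h3 : (PowerSeries.C c * tSubTheta Fq ^ n) •
      (g.map (twist (-1)) * (V.map (twist (-1)))ᵀ * U) = (g + h) * Vᵀ * Υ := by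
    rw [← Matrix.smul_mul, ← Matrix.smul_mul, ← h1, Matrix.mul_assoc (g + h), h2, hΥ]
    simp only [Matrix.mul_assoc]
  rw [map_twist_smul, map_twist_smul, map_twist_mul, map_twist_mul, Matrix.transpose_map, hU,
    twist_C, hc, map_pow, hΩ, ← smul_add, ← smul_add, ← Matrix.add_mul, ← Matrix.add_mul, ← h3]
  simp only [smul_smul, map_mul]
  congr 1
  ring

/-- The determinant of a rigid analytic trivialization is a multiple of `u_c Ω^d`: the quotient is a
unit of the Tate algebra fixed by the twist, hence a nonzero constant. -/
theorem exists_det_eq_smul {d : ℕ} {c uc : CInfty Fq} (hc0 : c ≠ 0) (huc0 : uc ≠ 0)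
    (hc : frobZ Fq (CInfty Fq) (-1) uc = c * uc) {D D' : (CInfty Fq)⟦X⟧} (hD : D ∈ Tate Fq)
    (hD' : D' ∈ Tate Fq) (hDD' : D * D' = 1)
    (hDt : twist (-1) D = PowerSeries.C c * tSubTheta Fq ^ d * D)
    (hΩmem : Ω ∈ Tate Fq) (hΩinv : Ω⁻¹ ∈ Tate Fq) (hΩ1 : Ω * Ω⁻¹ = 1) :
    ∃ κ : Fqˣ, D = PowerSeries.C (algebraMap Fq (CInfty Fq) κ * uc) * Ω ^ d := by
  set B := PowerSeries.C uc * Ω ^ d with hB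
  set B' := PowerSeries.C uc⁻¹ * Ω⁻¹ ^ d with hB'
  have hBB' : B * B' = 1 := by
    rw [hB, hB', mul_mul_mul_comm, ← map_mul, mul_inv_cancel₀ huc0, map_one, ← mul_pow, hΩ1,
      one_pow, one_mul]
  have hBt : twist (-1) B = PowerSeries.C c * tSubTheta Fq ^ d * B := by
    rw [hB, map_mul, twist_C, hc, map_pow, hΩ, map_mul, mul_pow]
    ring
  have hBmem : B ∈ Tate Fq := mul_mem (C_mem_tate _) (pow_mem hΩmem d)
  have hB'mem : B' ∈ Tate Fq := mul_mem (C_mem_tate _) (pow_mem hΩinv d)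
  have hfac : PowerSeries.C c * tSubTheta Fq ^ d ≠ 0 := by
    refine mul_ne_zero ?_ (pow_ne_zero d tSubTheta_ne_zero)
    intro h
    exact hc0 (PowerSeries.C_injective (h.trans (map_zero _).symm))
  have hB0 : B ≠ 0 := left_ne_zero_of_mul_eq_one hBB'
  have hD0 : D ≠ 0 := left_ne_zero_of_mul_eq_one hDD'
  have h1 : twist (-1) (D * B') = D * B' := by
    have h2 : D = D * B' * B := by rw [mul_assoc, mul_comm B', hBB', mul_one]
    have h3 := congrArg (twist (-1)) h2
    rw [map_mul _ (D * B'), hBt, hDt] at h3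
    refine mul_right_cancel₀ (mul_ne_zero hfac hB0) ?_
    rw [← h3]
    conv_lhs => rw [h2]
    ring
  have h1' : twist (-1) (D' * B) = D' * B := by
    have h2 : D * B' * (D' * B) = 1 := by rw [mul_mul_mul_comm, hDD', mul_comm B', hBB', one_mul]
    have h3 := congrArg (twist (-1)) h2
    rw [map_mul, h1, map_one, ← h2] at h3
    exact mul_left_cancel₀ (left_ne_zero_of_mul_eq_one h2) h3
  obtain ⟨a, ha⟩ := exists_toPS_of_twist_eq (mul_mem hD hB'mem) h1
  obtain ⟨b, hb⟩ := exists_toPS_of_twist_eq (mul_mem hD' hBmem) h1'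
  have hab : a * b = 1 := by
    apply toPS_base_injective
    rw [map_mul, ha, hb, map_one, mul_mul_mul_comm, hDD', mul_comm B', hBB', one_mul]
  obtain ⟨κ, hκ, hκa⟩ := Polynomial.isUnit_iff.1 (IsUnit.of_mul_eq_one b hab)
  refine ⟨hκ.unit, ?_⟩
  rw [IsUnit.unit_spec, map_mul, mul_assoc, ← hB, ← toPS_C, hκa, ha, mul_assoc, mul_comm B', hBB',
    mul_one]

end DifferenceEquations

/-! ### The root `u_c` -/

section Constants
variable {Fq : Type*} [Field Fq] [Fintype Fq]

theorem ne_zero_of_pow_card_sub_one {c uc : CInfty Fq} (hc : c ≠ 0)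
    (huc : uc ^ (Fintype.card Fq - 1) = (c ^ Fintype.card Fq)⁻¹) : uc ≠ 0 := by
  rintro rfl
  have := Fintype.one_lt_card (α := Fq)
  rw [zero_pow (by omega)] at huc
  exact inv_ne_zero (pow_ne_zero _ hc) huc.symm

theorem frobZ_neg_one_of_pow_card_sub_one {c uc : CInfty Fq} (hc : c ≠ 0)
    (huc : uc ^ (Fintype.card Fq - 1) = (c ^ Fintype.card Fq)⁻¹) :
    frobZ Fq (CInfty Fq) (-1) uc = c * uc := by
  apply (frob Fq (CInfty Fq)).injective
  have h1 : uc ^ Fintype.card Fq = uc ^ (Fintype.card Fq - 1) * uc := by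
    rw [← pow_succ, Nat.sub_add_cancel Fintype.card_pos]
  rw [frob_apply, frob_apply, frobZ_neg_one_pow, mul_pow, h1, huc, ← mul_assoc,
    mul_inv_cancel₀ (pow_ne_zero _ hc), one_mul]

end Constants

/-! ### Frames and generating functions over the power series -/

section Assembly
variable {Fq : Type*} [Field Fq] [Fintype Fq] {F : Type*} [Field F] [Algebra Fq F] [PerfectField F]
  [Algebra F (CInfty Fq)] {θ : F}

theorem map_toPS_mul {α β γ : Type*} [Fintype β] (A : Matrix α β F[X]) (B : Matrix β γ F[X]) :
    (A * B).map (toPS Fq F) = A.map (toPS Fq F) * B.map (toPS Fq F) := Matrix.map_mul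

theorem map_toPS_map_twist {α β : Type*} (A : Matrix α β F[X]) :
    (A.map (toPS Fq F)).map (twist (-1)) =
      (A.map (polyTwist (Fq := Fq) (-1))).map (toPS Fq F) := by
  ext1 i j
  exact twist_neg_one_toPS _

theorem det_map_toPS {r : ℕ} (A : Matrix (Fin r) (Fin r) F[X]) :
    (A.map (toPS Fq F)).det = toPS Fq F A.det :=
  ((toPS Fq F).map_det A).symm

theorem constantCoeff_tSubTheta_ne_zero : PowerSeries.constantCoeff (tSubTheta Fq) ≠ 0 := by
  simp [tSubTheta, CInfty.theta_ne_zero]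

theorem isUnit_tSubTheta : IsUnit (tSubTheta Fq) :=
  PowerSeries.isUnit_iff_constantCoeff.2 constantCoeff_tSubTheta_ne_zero.isUnit

theorem inv_map_toPS {r : ℕ} (V : GL (Fin r) F[X]) :
    ((V : Matrix (Fin r) (Fin r) F[X]).map (toPS Fq F))⁻¹ =
      ((V⁻¹ : GL (Fin r) F[X]) : Matrix (Fin r) (Fin r) F[X]).map (toPS Fq F) := by
  refine Matrix.inv_eq_right_inv ?_
  rw [← map_toPS_mul, ← Units.val_mul, mul_inv_cancel, Units.val_one, Matrix.map_one] <;> simp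

/-- The matrices of `τ` and `σ` have the same determinant up to a unit, so that of `τ` is invertible
over the power series. -/
theorem isUnit_det_of_frame {r d : ℕ} {Φt Φ : Matrix (Fin r) (Fin r) F[X]} {V : GL (Fin r) F[X]}
    (hθ : algebraMap F (CInfty Fq) θ = CInfty.theta Fq)
    (hV : (V : Matrix (Fin r) (Fin r) F[X]).map (polyTwist (Fq := Fq) (-1)) * Φ =
      Φtᵀ * (V : Matrix (Fin r) (Fin r) F[X])) {c : F} (hc : c ≠ 0)
    (hdet : Φ.det = Polynomial.C c * (Polynomial.X - Polynomial.C θ) ^ d) :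
    IsUnit (Φt.map (toPS Fq F)).det := by
  have hΦ : IsUnit (toPS Fq F Φ.det) := by
    rw [hdet, map_mul, map_pow, toPS_X_sub_C_theta hθ, toPS_C]
    refine IsUnit.mul (IsUnit.map _ ?_) (isUnit_tSubTheta.pow d)
    exact (IsUnit.mk0 _ hc).map (algebraMap F (CInfty Fq))
  have hVt : IsUnit (toPS Fq F ((V : Matrix (Fin r) (Fin r) F[X]).map
      (polyTwist (Fq := Fq) (-1))).det) := by
    have h1 := (polyTwist (Fq := Fq) (F := F) (-1)).map_det (V : Matrix (Fin r) (Fin r) F[X])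
    rw [RingHom.mapMatrix_apply] at h1
    rw [← h1]
    exact (((Matrix.isUnit_iff_isUnit_det _).1 V.isUnit).map _).map _
  have h := congrArg (fun M => toPS Fq F M.det) hV
  simp only [Matrix.det_mul, Matrix.det_transpose, map_mul] at h
  rw [det_map_toPS]
  refine isUnit_of_mul_isUnit_left (y := toPS Fq F (V : Matrix (Fin r) (Fin r) F[X]).det) ?_
  rw [← h]
  exact hVt.mul hΦ

/-- The row `h = -u_c⁻¹ x (V⁻¹)ᵗʳ` for a special biderivation with `Φ_δ = x Φ_t`. -/
theorem hRow_eq {r : ℕ} {uc : CInfty Fq} {Φt : Matrix (Fin r) (Fin r) F[X]}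
    {Φδ x : Matrix (Fin 1) (Fin r) F[X]} (V : GL (Fin r) F[X]) (hx : Φδ = x * Φt)
    (hΦt : IsUnit (Φt.map (toPS Fq F)).det) :
    hRow uc Φδ Φt (V : Matrix (Fin r) (Fin r) F[X]) = -(PowerSeries.C uc⁻¹ •
      (x * ((V⁻¹ : GL (Fin r) F[X]) : Matrix (Fin r) (Fin r) F[X])ᵀ).map (toPS Fq F)) := by
  rw [hRow, hx, map_toPS_mul, Matrix.mul_assoc (x.map _), Matrix.mul_nonsing_inv _ hΦt,
    Matrix.mul_one, inv_map_toPS, map_toPS_mul, Matrix.transpose_map]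

theorem hRow_mul_transpose {r : ℕ} {uc : CInfty Fq} {Φt : Matrix (Fin r) (Fin r) F[X]}
    {Φδ x : Matrix (Fin 1) (Fin r) F[X]} (V : GL (Fin r) F[X]) (hx : Φδ = x * Φt)
    (hΦt : IsUnit (Φt.map (toPS Fq F)).det) :
    hRow uc Φδ Φt (V : Matrix (Fin r) (Fin r) F[X]) *
        ((V : Matrix (Fin r) (Fin r) F[X]).map (toPS Fq F))ᵀ =
      -(PowerSeries.C uc⁻¹ • x.map (toPS Fq F)) := by
  rw [hRow_eq V hx hΦt, Matrix.neg_mul, Matrix.smul_mul, ← Matrix.transpose_map, ← map_toPS_mul,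
    Matrix.mul_assoc, ← Matrix.transpose_mul, ← Units.val_mul, mul_inv_cancel, Units.val_one,
    Matrix.transpose_one, Matrix.mul_one]

variable {ι : Type*} [Fintype ι] [DecidableEq ι] (G : TModule Fq θ ι)

theorem exp_eq_zero_of_isPeriodBasis {r : ℕ} {w : Fin r → ι → CInfty Fq} (hw : G.IsPeriodBasis w)
    (j : Fin r) : G.exp (w j) = 0 :=
  (hw.2 _).2 (Submodule.subset_span ⟨j, rfl⟩)

theorem upsilon_mem_tate (hθ : algebraMap F (CInfty Fq) θ = CInfty.theta Fq) {r : ℕ}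
    (m : Fin r → G.Motive) (w : Fin r → ι → CInfty Fq) (i j : Fin r) :
    G.upsilon m w i j ∈ Tate Fq :=
  pairing_mem_tate _ fun k => G.agf_mem_tate hθ (w j) k

/-- `Υ = Φ_t Υ^(-1)`. -/
theorem upsilon_eq (hθ : algebraMap F (CInfty Fq) θ = CInfty.theta Fq) {r : ℕ}
    {m : Fin r → G.Motive} {Φt : Matrix (Fin r) (Fin r) F[X]} (hΦt : G.IsMotiveFrame m Φt)
    {w : Fin r → ι → CInfty Fq} (hw : G.IsPeriodBasis w) :
    G.upsilon m w = Φt.map (toPS Fq F) * (G.upsilon m w).map (twist (-1)) := by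
  ext1 i j
  have h1 : ∀ i, twist (-1) (G.upsilon m w i j) = pairing (G.ofMotive (m i)) (G.agf (w j)) := by
    intro i
    rw [TModule.upsilon, Matrix.of_apply, pairing_tau, twist_neg_one_twist_one]
  rw [Matrix.mul_apply]
  simp only [Matrix.map_apply, h1]
  rw [← twist_one_pairing_of_isMotiveFrame
    (G.isEigenColumn_agf hθ (exp_eq_zero_of_isPeriodBasis G hw j)) hΦt i, ← pairing_tau]
  rfl

/-- The twist of the row `y` with entries `Ω^n g_{j,1}^(1)`: it differs from `y` by `Ω^n x Υ`, where
`Φ_δ = x Φ_t`. -/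
theorem twist_neg_one_row {n : ℕ} [NeZero n] (hθ : algebraMap F (CInfty Fq) θ = CInfty.theta Fq)
    (δ : Biderivation G n) {r : ℕ} {m : Fin r → G.Motive} {Φt : Matrix (Fin r) (Fin r) F[X]}
    (hΦt : G.IsMotiveFrame m Φt) {Φδ x : Matrix (Fin 1) (Fin r) F[X]}
    (hΦδ : (G.extension δ).IsMotiveFrame (G.extFamily δ m) (extFrame θ n Φt Φδ))
    (hx : Φδ = x * Φt) {w : Fin r → ι → CInfty Fq} (hw : G.IsPeriodBasis w)
    {l : Fin r → Fin n → CInfty Fq} (hl : ∀ j, (G.extension δ).exp (Sum.elim (w j) (l j)) = 0)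
    {Ω : (CInfty Fq)⟦X⟧} (hΩ : twist (-1) Ω = tSubTheta Fq * Ω)
    {y : Matrix (Fin 1) (Fin r) (CInfty Fq)⟦X⟧}
    (hy : ∀ j, y 0 j = Ω ^ n * twist 1 (G.gCoord δ w l j)) :
    y.map (twist (-1)) = y - Ω ^ n • (x.map (toPS Fq F) * G.upsilon m w) := by
  have h1 : Φδ.map (toPS Fq F) * (G.upsilon m w).map (twist (-1)) =
      x.map (toPS Fq F) * G.upsilon m w := by
    conv_rhs => rw [upsilon_eq G hθ hΦt hw]
    rw [hx, map_toPS_mul, Matrix.mul_assoc]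
  rw [← h1]
  ext1 e j
  rw [Subsingleton.elim e 0]
  have h2 := twist_one_gCoord G δ hθ hΦδ hl j
  have h3 : ∑ i, toPS Fq F (Φδ 0 i) * pairing (G.ofMotive (m i)) (G.agf (w j)) =
      (Φδ.map (toPS Fq F) * (G.upsilon m w).map (twist (-1))) 0 j := by
    rw [Matrix.mul_apply]
    refine Finset.sum_congr rfl fun i _ => ?_
    rw [Matrix.map_apply, Matrix.map_apply, TModule.upsilon, Matrix.of_apply, pairing_tau,
      twist_neg_one_twist_one]
  rw [h3] at h2
  rw [Matrix.map_apply, Matrix.sub_apply, Matrix.smul_apply, hy, map_mul, map_pow, hΩ,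
    twist_neg_one_twist_one, h2, smul_eq_mul]
  ring

end Assembly

end AndersonT
end

theorem theorem3p9 {Fq : Type*} [Field Fq] [Fintype Fq]
    -- a perfect field between `F_q(θ)` and `C_∞`
    (𝕂 : IntermediateField Fq (AndersonT.CInfty Fq)) [PerfectField 𝕂]
    (hθ : AndersonT.CInfty.theta Fq ∈ 𝕂)
    {d n r : ℕ} [NeZero n] (hdn : d ≤ n)
    -- a uniformizable abelian `t`-module of dimension `d` and rank `r`
    (G : AndersonT.TModule Fq (⟨AndersonT.CInfty.theta Fq, hθ⟩ : 𝕂) (Fin d))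
    (habelian : G.IsAbelian) (hunif : G.IsUniformizable)
    -- frames of its `t`-motive and of its dual `t`-motive, and the matrix that relates them
    (m : Module.Basis (Fin r) 𝕂[X] G.Motive) (Φt : Matrix (Fin r) (Fin r) 𝕂[X])
    (hΦt : G.IsMotiveFrame m Φt)
    (nu : Module.Basis (Fin r) 𝕂[X] G.DualMotive) (Φ : Matrix (Fin r) (Fin r) 𝕂[X])
    (hΦ : G.IsDualMotiveFrame nu Φ)
    (V : GL (Fin r) 𝕂[X])
    (hV : (V : Matrix (Fin r) (Fin r) 𝕂[X]).map (AndersonT.polyTwist (Fq := Fq) (-1)) * Φ =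
      Φtᵀ * (V : Matrix (Fin r) (Fin r) 𝕂[X]))
    -- a rigid analytic trivialization of the dual `t`-motive
    (Ψ : GL (Fin r) (AndersonT.Tate Fq))
    (hΨ : (((Ψ : Matrix (Fin r) (Fin r) (AndersonT.Tate Fq)).map (AndersonT.Tate Fq).subtype).map
        (AndersonT.twist (-1))) =
      Φ.map (AndersonT.toPS Fq 𝕂) *
        (Ψ : Matrix (Fin r) (Fin r) (AndersonT.Tate Fq)).map (AndersonT.Tate Fq).subtype)
    -- a basis of the period lattice, and a generator of the period lattice of the Carlitz module
    (w : Fin r → Fin d → AndersonT.CInfty Fq) (hw : G.IsPeriodBasis w)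
    (π : AndersonT.CInfty Fq)
    (hπ : (AndersonT.carlitz Fq (⟨AndersonT.CInfty.theta Fq, hθ⟩ : 𝕂) 1).IsPeriodBasis
      (fun _ : Fin 1 => fun _ => π))
    (c : 𝕂) (hc : c ≠ 0)
    (hdet : Φ.det = Polynomial.C c *
      (Polynomial.X - Polynomial.C (⟨AndersonT.CInfty.theta Fq, hθ⟩ : 𝕂)) ^ d)
    (uc : AndersonT.CInfty Fq)
    (huc : uc ^ (Fintype.card Fq - 1) = ((c : AndersonT.CInfty Fq) ^ Fintype.card Fq)⁻¹)
    -- a special biderivation, and lifts of the periods to periods of the extension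
    (δ : AndersonT.Biderivation G n) (Φδ : Matrix (Fin 1) (Fin r) 𝕂[X])
    (hΦδ : (G.extension δ).IsMotiveFrame (G.extFamily δ m)
      (AndersonT.extFrame ⟨AndersonT.CInfty.theta Fq, hθ⟩ n Φt Φδ))
    (hspecial : ∃ x : Matrix (Fin 1) (Fin r) 𝕂[X], Φδ = x * Φt)
    (l : Fin r → Fin n → AndersonT.CInfty Fq)
    (hl : ∀ j, (G.extension δ).exp (Sum.elim (w j) (l j)) = 0)
    -- notation: `Ω`, and `Ψ`, `V`, `Υ`, `h`, `f = h Ω^(n-d) Cof(Ψ)` as power series matrices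
    (Ω : (AndersonT.CInfty Fq)⟦X⟧)
    (hΩ : Ω = AndersonT.bigOmega (⟨AndersonT.CInfty.theta Fq, hθ⟩ : 𝕂) π)
    (Ψ' V' Υ : Matrix (Fin r) (Fin r) (AndersonT.CInfty Fq)⟦X⟧)
    (hΨ' : Ψ' = (Ψ : Matrix (Fin r) (Fin r) (AndersonT.Tate Fq)).map (AndersonT.Tate Fq).subtype)
    (hV' : V' = (V : Matrix (Fin r) (Fin r) 𝕂[X]).map (AndersonT.toPS Fq 𝕂))
    (hΥ : Υ = G.upsilon m w)
    (h f : Matrix (Fin 1) (Fin r) (AndersonT.CInfty Fq)⟦X⟧)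
    (hh : h = AndersonT.hRow uc Φδ Φt V)
    (hf : f = Ω ^ (n - d) • (h * AndersonT.cof Ψ'))
    -- `(Ω^n g_{1,1}^(1), …, Ω^n g_{r,1}^(1))`
    (y : Matrix (Fin 1) (Fin r) (AndersonT.CInfty Fq)⟦X⟧)
    (hy : ∀ j, y 0 j = Ω ^ n * AndersonT.twist 1 (G.gCoord δ w l j)) :
    -- `h` has polynomial entries
    (∃ x : Matrix (Fin 1) (Fin r) 𝕂[X], PowerSeries.C uc • h = x.map (AndersonT.toPS Fq 𝕂)) ∧
    -- the difference equation, and the identity among Anderson generating functions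
    (∀ u ∈ AndersonT.wpPreimage f, ∀ g : Matrix (Fin 1) (Fin r) (AndersonT.CInfty Fq)⟦X⟧,
      g = Ω⁻¹ ^ (n - d) • (u * (AndersonT.cof Ψ')⁻¹) →
      (∀ j, g 0 j ∈ AndersonT.Tate Fq) ∧
      g.map (AndersonT.twist (-1)) *
          (AndersonT.tSubTheta Fq ^ (n - d) • AndersonT.cof (Φ.map (AndersonT.toPS Fq 𝕂))) =
        g + h ∧
      ∃ a : Matrix (Fin 1) (Fin r) Fq[X],
        AndersonT.withOne y =
          AndersonT.withOne (PowerSeries.C uc • Ω ^ n • (g * V'ᵀ * Υ)) *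
            (AndersonT.lowerUnipotent a).map (AndersonT.toPS Fq Fq)) ∧
    -- the explicit series when the Gauss norm is less than `1`
    ((∀ j, AndersonT.gauss (f 0 j) < 1) →
      ∃ S : Matrix (Fin 1) (Fin r) (AndersonT.CInfty Fq)⟦X⟧,
        AndersonT.IsTwistSum f S ∧ S ∈ AndersonT.wpPreimage f ∧
        ∀ g : Matrix (Fin 1) (Fin r) (AndersonT.CInfty Fq)⟦X⟧,
          g = Ω⁻¹ ^ (n - d) • (S * (AndersonT.cof Ψ')⁻¹) →
          Ψ' * (Υᵀ * V') = 1 →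
          ∃ κ : Fqˣ,
            Ψ'.det = PowerSeries.C (algebraMap Fq (AndersonT.CInfty Fq) κ * uc) * Ω ^ d ∧
            ∃ a : Matrix (Fin 1) (Fin r) Fq[X],
              AndersonT.withOne y =
                AndersonT.withOne (PowerSeries.C uc • Ω ^ n • (g * V'ᵀ * Υ)) *
                  (AndersonT.lowerUnipotent a).map (AndersonT.toPS Fq Fq) ∧
              AndersonT.withOne y =
                AndersonT.withOne (PowerSeries.C (algebraMap Fq (AndersonT.CInfty Fq) κ)⁻¹ • S) *
                  (AndersonT.lowerUnipotent a).map (AndersonT.toPS Fq Fq)) := by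
  have hθ' : algebraMap 𝕂 (AndersonT.CInfty Fq) ⟨AndersonT.CInfty.theta Fq, hθ⟩ =
    AndersonT.CInfty.theta Fq := rfl
  obtain ⟨x, hx⟩ := hspecial
  set Φ' := Φ.map (AndersonT.toPS Fq 𝕂) with hΦ'
  set Φt' := Φt.map (AndersonT.toPS Fq 𝕂) with hΦt'
  have hc' : (c : AndersonT.CInfty Fq) ≠ 0 := by simpa using hc
  have huc0 := AndersonT.ne_zero_of_pow_card_sub_one hc' huc
  have hucF := AndersonT.frobZ_neg_one_of_pow_card_sub_one hc' huc
  -- properties of `Ω`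
  have hΩmem : Ω ∈ AndersonT.Tate Fq := hΩ ▸ AndersonT.bigOmega_mem_tate hθ' hπ
  have hΩinv : Ω⁻¹ ∈ AndersonT.Tate Fq := hΩ ▸ AndersonT.inv_bigOmega_mem_tate hθ' hπ
  have hΩt : AndersonT.twist (-1) Ω = AndersonT.tSubTheta Fq * Ω :=
    hΩ ▸ AndersonT.twist_neg_one_bigOmega hθ' hπ
  have hΩ1 : Ω * Ω⁻¹ = 1 :=
    PowerSeries.mul_inv_cancel _ (hΩ ▸ AndersonT.constantCoeff_bigOmega_ne_zero hθ' hπ)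
  have hΩ0 : Ω ≠ 0 := left_ne_zero_of_mul_eq_one hΩ1
  -- the frames and `V` over the power series
  have hdetΦ : Φ'.det = PowerSeries.C (c : AndersonT.CInfty Fq) * AndersonT.tSubTheta Fq ^ d := by
    rw [hΦ', AndersonT.det_map_toPS, hdet, map_mul, map_pow, AndersonT.toPS_X_sub_C_theta hθ',
      AndersonT.toPS_C]
    rfl
  have hΦtu : IsUnit Φt'.det := AndersonT.isUnit_det_of_frame hθ' hV hc hdet
  have hVps : V'.map (AndersonT.twist (-1)) * Φ' = Φt'ᵀ * V' := by
    rw [hV', hΦ', hΦt', AndersonT.map_toPS_map_twist, ← AndersonT.map_toPS_mul, hV,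
      AndersonT.map_toPS_mul, Matrix.transpose_map]
  have hVmem : ∀ i j, V'ᵀ i j ∈ AndersonT.Tate Fq := fun i j => by
    rw [hV']
    exact AndersonT.toPS_mem_tate _
  have hΥmem : ∀ i j, Υ i j ∈ AndersonT.Tate Fq := fun i j =>
    hΥ ▸ AndersonT.upsilon_mem_tate G hθ' m w i j
  have hΥt : Υ = Φt' * Υ.map (AndersonT.twist (-1)) := by
    rw [hΥ]
    exact AndersonT.upsilon_eq G hθ' hΦt hw
  have hhV : h * V'ᵀ = -(PowerSeries.C uc⁻¹ • x.map (AndersonT.toPS Fq 𝕂)) := by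
    rw [hh, hV']
    exact AndersonT.hRow_mul_transpose V hx hΦtu
  have hheq := AndersonT.hRow_eq (uc := uc) V hx hΦtu
  rw [← hh] at hheq
  -- `Ψ` and its inverse
  set W' := ((Ψ⁻¹ : GL (Fin r) (AndersonT.Tate Fq)) :
    Matrix (Fin r) (Fin r) (AndersonT.Tate Fq)).map (AndersonT.Tate Fq).subtype with hW'
  have hΨW : Ψ' * W' = 1 := by
    rw [hΨ', hW', ← Matrix.map_mul, ← Units.val_mul, mul_inv_cancel, Units.val_one,
      Matrix.map_one _ (map_zero _) (map_one _)]
  have hΨmem : ∀ i j, Ψ' i j ∈ AndersonT.Tate Fq := fun i j => by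
    rw [hΨ']
    exact Subtype.property _
  have hdetmem : Ψ'.det ∈ AndersonT.Tate Fq := by
    have h1 := (AndersonT.Tate Fq).subtype.map_det (Ψ : Matrix (Fin r) (Fin r) (AndersonT.Tate Fq))
    rw [hΨ']
    rw [RingHom.mapMatrix_apply] at h1
    rw [← h1]
    exact Subtype.property _
  have hdetWmem : W'.det ∈ AndersonT.Tate Fq := by
    have h1 := (AndersonT.Tate Fq).subtype.map_det
      ((Ψ⁻¹ : GL (Fin r) (AndersonT.Tate Fq)) : Matrix (Fin r) (Fin r) (AndersonT.Tate Fq))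
    rw [hW']
    rw [RingHom.mapMatrix_apply] at h1
    rw [← h1]
    exact Subtype.property _
  have hdetΨW : Ψ'.det * W'.det = 1 := by rw [← Matrix.det_mul, hΨW, Matrix.det_one]
  have hdetΨ0 : Ψ'.det ≠ 0 := left_ne_zero_of_mul_eq_one hdetΨW
  have hΨt : Ψ'.map (AndersonT.twist (-1)) = Φ' * Ψ' := by rw [hΨ', hΦ']; exact hΨ
  have hcofR : AndersonT.cof Ψ' * (W'.det • Ψ'ᵀ) = 1 := by
    rw [Matrix.mul_smul, AndersonT.cof_mul_transpose, smul_smul, mul_comm, hdetΨW, one_smul]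
  have hcofinv : (AndersonT.cof Ψ')⁻¹ = W'.det • Ψ'ᵀ := Matrix.inv_eq_right_inv hcofR
  have hcofL : (AndersonT.cof Ψ')⁻¹ * AndersonT.cof Ψ' = 1 := by
    rw [hcofinv]
    exact mul_eq_one_comm.1 hcofR
  have hu : ∀ u g : Matrix (Fin 1) (Fin r) (AndersonT.CInfty Fq)⟦X⟧,
      g = Ω⁻¹ ^ (n - d) • (u * (AndersonT.cof Ψ')⁻¹) →
      u = Ω ^ (n - d) • (g * AndersonT.cof Ψ') := by
    rintro u _ rfl
    rw [Matrix.smul_mul, smul_smul, ← mul_pow, hΩ1, one_pow, one_smul, Matrix.mul_assoc, hcofL,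
      Matrix.mul_one]
  have hfmem : ∀ j, f 0 j ∈ AndersonT.Tate Fq := by
    have hhmem : ∀ i j, h i j ∈ AndersonT.Tate Fq := fun i j => by
      rw [hheq]
      exact neg_mem (mul_mem (AndersonT.C_mem_tate _) (AndersonT.toPS_mem_tate _))
    have hcof : AndersonT.cof Ψ' = Ψ'.det • W'ᵀ := by
      have h1 : Ψ'ᵀ * W'ᵀ = 1 := by
        rw [← Matrix.transpose_mul, mul_eq_one_comm.1 hΨW, Matrix.transpose_one]
      calc AndersonT.cof Ψ' = AndersonT.cof Ψ' * (Ψ'ᵀ * W'ᵀ) := by rw [h1, Matrix.mul_one]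
        _ = Ψ'.det • W'ᵀ := by
          rw [← Matrix.mul_assoc, AndersonT.cof_mul_transpose, Matrix.smul_mul, Matrix.one_mul]
    intro j
    rw [hf, hcof]
    refine mul_mem (pow_mem hΩmem _) (AndersonT.mul_mem_tate hhmem (fun i j => ?_) 0 j)
    exact mul_mem hdetmem (by rw [hW']; exact Subtype.property _)
  -- the assertions about an arbitrary solution
  have main : ∀ u ∈ AndersonT.wpPreimage f,
      ∀ g : Matrix (Fin 1) (Fin r) (AndersonT.CInfty Fq)⟦X⟧,
      g = Ω⁻¹ ^ (n - d) • (u * (AndersonT.cof Ψ')⁻¹) →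
      (∀ j, g 0 j ∈ AndersonT.Tate Fq) ∧
      g.map (AndersonT.twist (-1)) * (AndersonT.tSubTheta Fq ^ (n - d) • AndersonT.cof Φ') =
        g + h ∧
      ∃ a : Matrix (Fin 1) (Fin r) Fq[X],
        y = PowerSeries.C uc • Ω ^ n • (g * V'ᵀ * Υ) + a.map (AndersonT.toPS Fq Fq) := by
    rintro u ⟨humem, hueq⟩ g hg
    have hgmem : ∀ i j, g i j ∈ AndersonT.Tate Fq := by
      intro i j
      rw [hg, hcofinv]
      refine mul_mem (pow_mem hΩinv _) (AndersonT.mul_mem_tate (fun i j => ?_) (fun i j => ?_) i j)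
      · rw [Subsingleton.elim i 0]
        exact humem j
      · exact mul_mem hdetWmem (hΨmem j i)
    have hgeq : g.map (AndersonT.twist (-1)) *
        (AndersonT.tSubTheta Fq ^ (n - d) • AndersonT.cof Φ') = g + h :=
      AndersonT.twist_neg_one_mul_smul_cof hΩt hΩ0 hΨt hdetΨ0 (hu u g hg) (by rw [hueq, hf])
    refine ⟨fun j => hgmem 0 j, hgeq, ?_⟩
    set z := PowerSeries.C uc • Ω ^ n • (g * V'ᵀ * Υ) with hz
    have hzt : z.map (AndersonT.twist (-1)) =
        z - Ω ^ n • (x.map (AndersonT.toPS Fq 𝕂) * Υ) := by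
      rw [hz, AndersonT.twist_neg_one_smul_mul_transpose_mul hΩt hdn hucF hdetΦ hVps rfl hΥt hgeq,
        ← hz, hhV, sub_eq_add_neg]
      congr 1
      rw [Matrix.neg_mul, Matrix.smul_mul, smul_neg, smul_neg, smul_comm (Ω ^ n), smul_smul,
        ← map_mul, mul_inv_cancel₀ huc0, map_one, one_smul]
    have hyt : y.map (AndersonT.twist (-1)) =
        y - Ω ^ n • (x.map (AndersonT.toPS Fq 𝕂) * Υ) := by
      rw [hΥ]
      exact AndersonT.twist_neg_one_row G hθ' δ hΦt hΦδ hx hw hl hΩt hy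
    -- the difference is fixed by the twist and lies in the Tate algebra
    have hfix : ∀ j, ∃ a : Fq[X], AndersonT.toPS Fq Fq a = y 0 j - z 0 j := by
      intro j
      refine AndersonT.exists_toPS_of_twist_eq (sub_mem ?_ ?_) ?_
      · rw [hy]
        exact mul_mem (pow_mem hΩmem n) (AndersonT.twist_one_mem_tate
          ((G.extension δ).agf_mem_tate hθ' _ _))
      · exact mul_mem (AndersonT.C_mem_tate _) (mul_mem (pow_mem hΩmem n)
          (AndersonT.mul_mem_tate (AndersonT.mul_mem_tate hgmem hVmem) hΥmem 0 j))
      · have h1 := congrFun (congrFun hyt 0) j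
        have h2 := congrFun (congrFun hzt 0) j
        rw [Matrix.map_apply, Matrix.sub_apply] at h1 h2
        rw [map_sub, h1, h2]
        ring
    choose a ha using hfix
    refine ⟨Matrix.of fun _ j => a j, ?_⟩
    ext1 i j
    rw [Subsingleton.elim i 0, Matrix.add_apply, Matrix.map_apply, Matrix.of_apply, ha]
    ring
  refine ⟨⟨-(x * ((V⁻¹ : GL (Fin r) 𝕂[X]) : Matrix (Fin r) (Fin r) 𝕂[X])ᵀ), ?_⟩, ?_, ?_⟩
  · rw [hheq, smul_neg, smul_smul, ← map_mul, mul_inv_cancel₀ huc0, map_one, one_smul]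
    ext1 i j
    simp only [Matrix.neg_apply, Matrix.map_apply, map_neg]
  · intro u humem g hg
    obtain ⟨h1, h2, a, ha⟩ := main u humem g hg
    exact ⟨h1, h2, a, by rw [AndersonT.withOne_mul_lowerUnipotent, ← ha]⟩
  · intro hgauss
    set S : Matrix (Fin 1) (Fin r) (AndersonT.CInfty Fq)⟦X⟧ :=
      Matrix.of fun _ j => AndersonT.twistSum (f 0 j) with hS
    have hSmem : S ∈ AndersonT.wpPreimage f := by
      refine ⟨fun j => AndersonT.twistSum_mem_tate (hfmem j) (hgauss j), ?_⟩
      ext1 i j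
      rw [Subsingleton.elim i 0]
      exact AndersonT.twist_neg_one_twistSum (hfmem j) (hgauss j)
    refine ⟨S, fun j => ⟨AndersonT.twistSum_mem_tate (hfmem j) (hgauss j),
      AndersonT.tendsto_gauss_twistSum_sub (hfmem j) (hgauss j)⟩, hSmem, ?_⟩
    intro g hg hΨΥ
    have hDt : AndersonT.twist (-1) Ψ'.det =
        PowerSeries.C (c : AndersonT.CInfty Fq) * AndersonT.tSubTheta Fq ^ d * Ψ'.det := by
      have h1 := (AndersonT.twist (Fq := Fq) (-1)).map_det Ψ'
      rw [RingHom.mapMatrix_apply] at h1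
      rw [h1, hΨt, Matrix.det_mul, hdetΦ]
    obtain ⟨κ, hκ⟩ := AndersonT.exists_det_eq_smul hΩt hc' huc0 hucF hdetmem hdetWmem hdetΨW hDt
      hΩmem hΩinv hΩ1
    refine ⟨κ, hκ, ?_⟩
    obtain ⟨-, -, a, ha⟩ := main S hSmem g hg
    refine ⟨a, by rw [AndersonT.withOne_mul_lowerUnipotent, ← ha], ?_⟩
    -- both explicit rows agree: `κ u_c Ω^n g Vᵗʳ Υ = S Ψᵗʳ Vᵗʳ Υ = S`
    have hκ0 : algebraMap Fq (AndersonT.CInfty Fq) κ ≠ 0 := by simp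
    have h1 : Ψ'ᵀ * (V'ᵀ * Υ) = 1 := by
      rw [mul_eq_one_comm]
      have := congrArg Matrix.transpose hΨΥ
      rwa [Matrix.transpose_mul, Matrix.transpose_mul, Matrix.transpose_transpose,
        Matrix.transpose_one] at this
    have h2 : S = (PowerSeries.C (algebraMap Fq (AndersonT.CInfty Fq) κ * uc) * Ω ^ n) •
        (g * (V'ᵀ * Υ)) := by
      calc S = S * (Ψ'ᵀ * (V'ᵀ * Υ)) := by rw [h1, Matrix.mul_one]
        _ = Ω ^ (n - d) • Ψ'.det • (g * (V'ᵀ * Υ)) := by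
          rw [hu S g hg, Matrix.smul_mul, ← Matrix.mul_assoc, Matrix.mul_assoc g,
            AndersonT.cof_mul_transpose, Matrix.mul_smul, Matrix.mul_one, Matrix.smul_mul]
        _ = _ := by
          rw [hκ, smul_smul, mul_left_comm, ← pow_add, Nat.sub_add_cancel hdn]
    have h3 : PowerSeries.C (algebraMap Fq (AndersonT.CInfty Fq) κ)⁻¹ • S =
        PowerSeries.C uc • Ω ^ n • (g * V'ᵀ * Υ) := by
      rw [h2, smul_smul, smul_smul, ← mul_assoc, ← map_mul, inv_mul_cancel_left₀ hκ0,
        Matrix.mul_assoc]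
    rw [h3, AndersonT.withOne_mul_lowerUnipotent, ← ha]
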